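/- Let $S^2\subset\mathbb R^3$ be the unit sphere, let $g_0$ be the standard product metric on $S^2\times S^2$ (the product of two unit round metrics), and let $\bar g_0$ be the standard product metric on $\mathbb{RP}^2\times\mathbb{RP}^2$, i.e. the metric whose pullback under the covering $S^2\times S^2\to\mathbb{RP}^2\times\mathbb{RP}^2$ is $g_0$. For a smooth manifold $M$, let $Gr_2TM$ be the bundle of two-dimensional subspaces (planes) of the tangent spaces of $M$, and let $\mathrm{dist}$ be a distance on $Gr_2TM$ inducing its standard topology. For a Riemannian metric $g$ on $M$ and $\theta>0$, write $\sec^\theta_g>0$ if $$\tfrac12\big(\sec_g(\sigma)+\sec_g(\sigma')\big)>0\quad\text{for all } p\in M \text{ and all planes } \sigma,\sigma'\subset T_pM \text{ with } \mathrm{dist}(\sigma,\sigma')\ge\theta,$$ and, if $\dim M=4$, let $\sec^\perp_g(\sigma)=\tfrac12\big(\sec_g(\sigma)+\sec_g(\sigma^\perp)\big)$ be the biorthogonal curvature of a plane $\sigma\subset T_pM$, where $\sigma^\perp\subset T_pM$ is the $g$-orthogonal plane. (1) For every distance on $Gr_2T(S^2\times S^2)$ inducing the standard topology, every $\theta>0$,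 every integer $k\ge0$ and every neighborhood $U$ of $g_0$ in the $C^k$-topology on smooth Riemannian metrics on $S^2\times S^2$, there is a smooth Riemannian metric $g^\theta\in U$ with $\sec^\theta_{g^\theta}>0$ that is invariant under the action of $\mathbb Z_2\oplus\mathbb Z_2$ on $S^2\times S^2$ generated by the antipodal maps of the two factors. (2) In particular, $S^2\times S^2$ admits smooth Riemannian metrics with $\sec^\perp>0$ for all planes, and these can be chosen invariant under the same action of $\mathbb Z_2\oplus\mathbb Z_2$. (3) The same holds on $\mathbb{RP}^2\times\mathbb{RP}^2$: for every distance on $Gr_2T(\mathbb{RP}^2\times\mathbb{RP}^2)$ inducing the standard topology, every $\theta>0$, every integer $k\ge0$ and every neighborhood $U$ of $\bar g_0$ in the $C^k$-topology, there is a smooth Riemannian metric $h\in U$ with $\sec^\theta_h>0$; and $\mathbb{RP}^2\times\mathbb{RP}^2$ admits a smooth Riemannian metric with $\sec^\perp>0$. -/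

import Mathlib

open Set Topology Manifold Module
open scoped ContDiff

namespace SecTheta

noncomputable section

section Manifolds

variable {E : Type*} [NormedAddCommGroup E] [NormedSpace ℝ E]
  {H : Type*} [TopologicalSpace H] (I : ModelWithCorners ℝ E H)
  (M : Type*) [TopologicalSpace M] [ChartedSpace H M] [IsManifold I ∞ M]

/-- Smooth Riemannian metrics on `M` (a manifold without boundary in all applications). -/
abbrev SmoothMetric := Bundle.ContMDiffRiemannianMetric I ∞ E (fun p : M ↦ TangentSpace I p)

/-- The Grassmannian bundle `Gr₂ TM`: a point of `M` with a two-dimensional subspace of the tangent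
space at that point. -/
structure TangentPlane where
  /-- the base point -/
  pt : M
  /-- the plane -/
  plane : Submodule ℝ (TangentSpace I pt)
  finrank_eq : finrank ℝ plane = 2

/-- Pairs of linearly independent tangent vectors at the same point of `M`. -/
structure TangentFrame where
  /-- the base point -/
  pt : M
  /-- the first vector -/
  fst : TangentSpace I pt
  /-- the second vector -/
  snd : TangentSpace I pt
  linInd : LinearIndependent ℝ ![fst, snd]

variable {I M}

/-- The bundle of frames is topologized as a subspace of `TM × TM`. -/
instance instTopologicalSpaceTangentFrame : TopologicalSpace (TangentFrame I M) :=
  TopologicalSpace.induced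
    (fun F : TangentFrame I M ↦ ((⟨F.pt, F.fst⟩ : TangentBundle I M),
      (⟨F.pt, F.snd⟩ : TangentBundle I M)))
    inferInstance

/-- The plane spanned by a frame. -/
def TangentFrame.span (F : TangentFrame I M) : TangentPlane I M where
  pt := F.pt
  plane := Submodule.span ℝ (range ![F.fst, F.snd])
  finrank_eq := by simpa using finrank_span_eq_card F.linInd

/-- The standard topology of `Gr₂ TM`: the quotient topology under the map from frames to the
planes that they span. -/
instance instTopologicalSpaceTangentPlane : TopologicalSpace (TangentPlane I M) :=
  TopologicalSpace.coinduced TangentFrame.span inferInstance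

/-- A distance on `Gr₂ TM` is admissible if it induces the standard topology. -/
def InducesStandardTopology (d : MetricSpace (TangentPlane I M)) : Prop :=
  d.toPseudoMetricSpace.toUniformSpace.toTopologicalSpace = instTopologicalSpaceTangentPlane

/-- The metric `g` written in the chart at `p`, i.e. the pullback of `g` under the inverse of the
chart: the matrix `(g_{ij})` as a function on the model space (meaningful on the target of the
chart). -/
def chartMetric (g : SmoothMetric I M) (p : M) (x : E) : E →L[ℝ] E →L[ℝ] ℝ :=
  let q : M := (extChartAt I p).symm x
  let A : E →L[ℝ] TangentSpace I q := mfderiv 𝓘(ℝ, E) I (extChartAt I p).symm x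
  (ContinuousLinearMap.precomp ℝ A) ∘L (g.inner q) ∘L A

end Manifolds

section Coordinates

variable {E : Type*} [NormedAddCommGroup E] [NormedSpace ℝ E]

/-- The Christoffel symbols of a metric `G` on an open subset of a vector space: `Γ(u, v)` is the
vector with `G(Γ(u, v), w) = ½ (∂ᵤ G(v, w) + ∂ᵥ G(u, w) - ∂_w G(u, v))` for all `w`. -/
def christoffel (G : E → E →L[ℝ] E →L[ℝ] ℝ) (x u v : E) : E :=
  (G x).inverse ((1 / 2 : ℝ) •
    (fderiv ℝ G x u v + fderiv ℝ G x v u - ((fderiv ℝ G x).flip u).flip v))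

/-- The Riemann curvature tensor of the Levi-Civita connection of `G`, with the sign convention
`R(u, v) = [∇ᵤ, ∇ᵥ] - ∇_{[u, v]}`:
`R(u, v)w = ∂ᵤ Γ(v, w) - ∂ᵥ Γ(u, w) + Γ(u, Γ(v, w)) - Γ(v, Γ(u, w))`. -/
def riemann (G : E → E →L[ℝ] E →L[ℝ] ℝ) (x u v w : E) : E :=
  fderiv ℝ (fun y ↦ christoffel G y v w) x u - fderiv ℝ (fun y ↦ christoffel G y u w) x v
    + christoffel G x u (christoffel G x v w) - christoffel G x v (christoffel G x u w)

/-- The sectional curvature `G(R(u, v)v, u) / (G(u, u) G(v, v) - G(u, v)²)` of the plane spanned by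
`u` and `v`. -/
def coordSec (G : E → E →L[ℝ] E →L[ℝ] ℝ) (x u v : E) : ℝ :=
  G x (riemann G x u v v) u / (G x u u * G x v v - G x u v ^ 2)

end Coordinates

section Curvature

variable {E : Type*} [NormedAddCommGroup E] [NormedSpace ℝ E]
  {H : Type*} [TopologicalSpace H] {I : ModelWithCorners ℝ E H}
  {M : Type*} [TopologicalSpace M] [ChartedSpace H M] [IsManifold I ∞ M]

/-- A basis of a plane. -/
def TangentPlane.basis (σ : TangentPlane I M) : Basis (Fin 2) ℝ σ.plane :=
  have : Module.Finite ℝ σ.plane :=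
    Module.finite_of_finrank_pos (by rw [σ.finrank_eq]; norm_num)
  Module.finBasisOfFinrankEq ℝ σ.plane σ.finrank_eq

/-- The sectional curvature of the plane `σ`, computed in the chart at its base point from a basis
of `σ` (the result depends neither on the chart nor on the basis). -/
def sec (g : SmoothMetric I M) (σ : TangentPlane I M) : ℝ :=
  let D : TangentSpace I σ.pt →L[ℝ] E := mfderiv I 𝓘(ℝ, E) (extChartAt I σ.pt) σ.pt
  coordSec (chartMetric g σ.pt) (extChartAt I σ.pt σ.pt)
    (D (σ.basis 0 : TangentSpace I σ.pt)) (D (σ.basis 1 : TangentSpace I σ.pt))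

/-- `sec^θ > 0`: the average of the sectional curvatures of any two planes tangent at the same
point and at distance at least `θ` is positive. -/
def SecThetaPos (d : MetricSpace (TangentPlane I M)) (θ : ℝ) (g : SmoothMetric I M) : Prop :=
  ∀ σ τ : TangentPlane I M, σ.pt = τ.pt → θ ≤ d.dist σ τ → 0 < (sec g σ + sec g τ) / 2

/-- The `g`-orthogonal complement of a subspace of a tangent space. -/
def perp (g : SmoothMetric I M) (p : M) (S : Submodule ℝ (TangentSpace I p)) :
    Submodule ℝ (TangentSpace I p) where
  carrier := {w | ∀ v ∈ S, g.inner p v w = 0}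
  add_mem' := by
    intro a b ha hb v hv
    simp [ha v hv, hb v hv]
  zero_mem' := by simp
  smul_mem' := by
    intro c a ha v hv
    simp [ha v hv]

lemma finrank_perp [FiniteDimensional ℝ E] (g : SmoothMetric I M) (p : M)
    (S : Submodule ℝ (TangentSpace I p)) :
    finrank ℝ (perp g p S) = finrank ℝ E - finrank ℝ S := by
  have : FiniteDimensional ℝ (TangentSpace I p) := inferInstanceAs (FiniteDimensional ℝ E)
  let B : LinearMap.BilinForm ℝ (TangentSpace I p) :=
    LinearMap.mk₂ ℝ (fun v w ↦ g.inner p v w) (by simp) (by simp) (by simp) (by simp)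
  have hrefl : B.IsRefl := fun v w h ↦ (g.symm p w v).trans h
  have hnd : B.Nondegenerate := by
    refine (LinearMap.IsRefl.nondegenerate_iff_separatingLeft hrefl).2 fun v hv ↦ ?_
    by_contra hne
    exact (g.pos p v hne).ne' (hv v)
  have hperp : perp g p S = B.orthogonal S := rfl
  rw [hperp, LinearMap.BilinForm.finrank_orthogonal hnd S]
  rfl

/-- In dimension four, the plane `σ^⊥` orthogonal to a plane `σ`. -/
def TangentPlane.orth [hE : Fact (finrank ℝ E = 4)] (g : SmoothMetric I M)
    (σ : TangentPlane I M) : TangentPlane I M where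
  pt := σ.pt
  plane := perp g σ.pt σ.plane
  finrank_eq := by
    have : FiniteDimensional ℝ E := Module.finite_of_finrank_pos (by rw [hE.out]; norm_num)
    rw [finrank_perp, hE.out, σ.finrank_eq]

/-- The biorthogonal curvature `sec^⊥(σ) = ½ (sec(σ) + sec(σ^⊥))`. -/
def secPerp [Fact (finrank ℝ E = 4)] (g : SmoothMetric I M) (σ : TangentPlane I M) : ℝ :=
  (sec g σ + sec g (σ.orth g)) / 2

variable (I M) in
/-- The `C^k` topology on the space of smooth metrics: uniform convergence, on compact subsets of
chart domains, of the components of the metric and of their derivatives of order at most `k`. -/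
abbrev CkTopology (k : ℕ) : TopologicalSpace (SmoothMetric I M) :=
  ⨅ (p : M) (j : Fin (k + 1)), TopologicalSpace.induced
    (fun g ↦ UniformOnFun.ofFun {K : Set E | IsCompact K ∧ K ⊆ (extChartAt I p).target}
      (iteratedFDeriv ℝ j (chartMetric g p)))
    inferInstance

variable {E' : Type*} [NormedAddCommGroup E'] [NormedSpace ℝ E']
  {H' : Type*} [TopologicalSpace H'] {I' : ModelWithCorners ℝ E' H'}
  {N : Type*} [TopologicalSpace N] [ChartedSpace H' N] [IsManifold I' ∞ N]

/-- `g` is the pullback `f^* h`. -/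
def IsPullback (f : M → N) (h : SmoothMetric I' N) (g : SmoothMetric I M) : Prop :=
  ∀ (p : M) (u v : TangentSpace I p),
    g.inner p u v = h.inner (f p) (mfderiv I I' f p u) (mfderiv I I' f p v)

end Curvature

section Immersion

variable {E : Type*} [NormedAddCommGroup E] [NormedSpace ℝ E] [FiniteDimensional ℝ E]
  {H : Type*} [TopologicalSpace H] {I : ModelWithCorners ℝ E H}
  {M : Type*} [TopologicalSpace M] [ChartedSpace H M] [IsManifold I ∞ M]
  {W : Type*} [NormedAddCommGroup W] [InnerProductSpace ℝ W]

/-- The metric induced on `M` by an immersion `F` into a Euclidean space: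
`g(u, v) = ⟪dF u, dF v⟫`. -/
def inducedMetric (F : M → W) (hF : ContMDiff I 𝓘(ℝ, W) ∞ F)
    (hinj : ∀ p, Function.Injective (mvfderiv I F p)) : SmoothMetric I M where
  inner p := (ContinuousLinearMap.precomp ℝ (mvfderiv I F p)) ∘L (innerSL ℝ) ∘L (mvfderiv I F p)
  symm p v w := real_inner_comm _ _
  pos p v hv := by
    refine real_inner_self_pos.2 fun h ↦ hv ?_
    exact hinj p (h.trans (map_zero _).symm)
  isVonNBounded p := by
    let A : E →L[ℝ] W := mvfderiv I F p
    have hA : Function.Injective A := hinj p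
    change Bornology.IsVonNBounded ℝ {v : E | inner ℝ (A v) (A v) < 1}
    obtain ⟨K, -, hK⟩ := (A : E →ₗ[ℝ] W).injective_iff_antilipschitz.1 hA
    rw [NormedSpace.isVonNBounded_iff]
    refine (hK.isBounded_preimage (Metric.isBounded_ball (x := (0 : W)) (r := 1))).subset ?_
    intro v hv
    have hv' : inner ℝ (A v) (A v) < 1 := hv
    rw [real_inner_self_eq_norm_sq] at hv'
    simp only [mem_preimage, Metric.mem_ball, dist_zero_right]
    change ‖A v‖ < 1
    nlinarith [norm_nonneg (A v)]
  contMDiff := by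
    intro x₀
    rw [contMDiffAt_hom_bundle]
    refine ⟨contMDiffAt_id, ?_⟩
    have h1 := (hF x₀).mfderiv_const (m := ∞) le_rfl
    let Φ : (E →L[ℝ] W) → (E →L[ℝ] E →L[ℝ] ℝ) := fun A ↦
      (ContinuousLinearMap.compL ℝ E W ℝ).flip A ∘L (innerSL ℝ) ∘L A
    have hΦ : ContDiff ℝ ∞ Φ := by
      unfold Φ
      fun_prop
    have h2 := hΦ.contMDiff.contMDiffAt.comp x₀ h1
    refine h2.congr_of_eventuallyEq ?_
    filter_upwards [(chartAt H x₀).open_source.mem_nhds (mem_chart_source H x₀)] with x hx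
    ext u v
    rw [inCoordinates_apply_eq₂ (by simpa using hx) (by simpa using hx) (mem_univ _)]
    have hA : ∀ w : E, inTangentCoordinates I 𝓘(ℝ, W) id F (mfderiv I 𝓘(ℝ, W) F) x₀ x w
        = mvfderiv I F x ((trivializationAt E (TangentSpace I) x₀).symm x w) := by
      intro w
      simp [inTangentCoordinates, ContinuousLinearMap.inCoordinates]
      change mfderiv I 𝓘(ℝ, W) F x
        (Bundle.Trivialization.symmL ℝ (trivializationAt E (TangentSpace I) x₀) x w) = _
      rw [Bundle.Trivialization.symmL_apply]
      · rfl
      · simpa using hx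
    change _ = inner ℝ (inTangentCoordinates I 𝓘(ℝ, W) id F (mfderiv I 𝓘(ℝ, W) F) x₀ x u)
      (inTangentCoordinates I 𝓘(ℝ, W) id F (mfderiv I 𝓘(ℝ, W) F) x₀ x v)
    rw [hA, hA]
    simp
    rfl

end Immersion

/-- Euclidean three-space. -/
abbrev E3 : Type := EuclideanSpace ℝ (Fin 3)

/-- The unit sphere `S² ⊆ ℝ³`. -/
abbrev S2 : Type := Metric.sphere (0 : E3) 1

/-- The antipodal action of `ℤ₂ = {1, -1}` on the sphere. -/
instance instMulActionS2 : MulAction ℤˣ S2 where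
  smul ε x := ⟨(ε : ℤ) • (x : E3), by
    rcases Int.units_eq_one_or ε with rfl | rfl <;> simp⟩
  one_smul x := Subtype.ext (one_smul ℤ _)
  mul_smul a b x := Subtype.ext (by
    change ((a * b : ℤˣ) : ℤ) • (x : E3) = (a : ℤ) • (b : ℤ) • (x : E3)
    rw [Units.val_mul, mul_smul])

lemma S2.coe_smul (ε : ℤˣ) (x : S2) : ((ε • x : S2) : E3) = (ε : ℤ) • (x : E3) := rfl

instance instContinuousConstSMulS2 : ContinuousConstSMul ℤˣ S2 where
  continuous_const_smul ε := by
    refine Continuous.subtype_mk ?_ _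
    fun_prop

instance instIsCancelSMulS2 : IsCancelSMul ℤˣ S2 where
  left_cancel' a b c h := by simpa using h
  right_cancel' a b x h := by
    have h1 := congrArg (Subtype.val) h
    rw [S2.coe_smul, S2.coe_smul] at h1
    have hx : (x : E3) ≠ 0 := ne_zero_of_mem_unit_sphere x
    rw [← Int.cast_smul_eq_zsmul ℝ, ← Int.cast_smul_eq_zsmul ℝ] at h1
    exact Units.ext (Int.cast_injective (smul_left_injective ℝ hx h1))

lemma S2.contMDiff_smul (ε : ℤˣ) : ContMDiff (𝓡 2) (𝓡 2) ∞ (fun x : S2 ↦ ε • x) := by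
  rcases Int.units_eq_one_or ε with rfl | rfl
  · exact contMDiff_id.congr fun x ↦ one_smul _ x
  · have : Fact (finrank ℝ E3 = 2 + 1) := ⟨finrank_euclideanSpace_fin⟩
    refine (contMDiff_neg_sphere (E := E3) (n := 2) (m := ∞)).congr fun x ↦ Subtype.ext ?_
    simp [S2.coe_smul]

/-- The projective plane `ℝP² = S² / {1, -1}`, with the quotient topology and the charts induced
by those of `S²`. -/
abbrev RP2 : Type := MulAction.orbitRel.Quotient ℤˣ S2

/-- The projection `S² → ℝP²`. -/
def RP2.proj : S2 → RP2 := Quotient.mk _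

lemma RP2.isLocalHomeomorph_proj : IsLocalHomeomorph RP2.proj :=
  (isQuotientCoveringMap_quotientMk_of_properlyDiscontinuousSMul
    (G := ℤˣ) (E := S2)).isCoveringMap.isLocalHomeomorph

lemma RP2.contMDiffOn_transition (hf : IsLocalHomeomorph RP2.proj) (a b : S2) :
    ContMDiffOn (𝓡 2) (𝓡 2) ∞ (fun x ↦ hf.localInverseAt b (RP2.proj x))
      ((hf.localInverseAt a).target ∩ RP2.proj ⁻¹' (hf.localInverseAt b).source) := by
  rintro z ⟨hz, hz'⟩
  have h0 : RP2.proj (hf.localInverseAt b (RP2.proj z)) = RP2.proj z :=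
    hf.apply_localInverseAt_of_mem hz'
  obtain ⟨g, hg⟩ : hf.localInverseAt b (RP2.proj z) ∈ MulAction.orbit ℤˣ z := Quotient.exact h0
  have hg' : g • z = hf.localInverseAt b (RP2.proj z) := hg
  refine ((S2.contMDiff_smul g).contMDiffAt.congr_of_eventuallyEq ?_).contMDiffWithinAt
  have : ∀ᶠ x in 𝓝 z, g • x ∈ (hf.localInverseAt b).target := by
    refine (continuous_const_smul g).continuousAt.eventually_mem
      ((hf.localInverseAt b).open_target.mem_nhds ?_)
    rw [hg']
    exact (hf.localInverseAt b).map_source hz'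
  filter_upwards [this] with x hx
  have h3 := (hf.localInverseAt b).right_inv hx
  rw [hf.localInverseAt_symm] at h3
  rw [← h3]
  congr 1
  exact (Quotient.sound ⟨g, rfl⟩ : RP2.proj (g • x) = RP2.proj x).symm

instance instIsManifoldRP2 : IsManifold (𝓡 2) ∞ RP2 := by
  refine isManifold_of_contDiffOn _ _ _ ?_
  rintro _ _ ⟨a, rfl⟩ ⟨b, rfl⟩
  generalize (Function.Surjective.hasRightInverse
    (Quotient.mk_surjective (s := MulAction.orbitRel ℤˣ S2))).choose = r
  have key := RP2.contMDiffOn_transition RP2.isLocalHomeomorph_proj (r a) (r b)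
  have hf := RP2.isLocalHomeomorph_proj
  change ContDiffOn ℝ ∞ (fun y ↦ chartAt (EuclideanSpace ℝ (Fin 2)) (r b)
    (hf.localInverseAt (r b) ((hf.localInverseAt (r a)).symm
      ((chartAt (EuclideanSpace ℝ (Fin 2)) (r a)).symm y)))) _
  rw [hf.localInverseAt_symm, ← contMDiffOn_iff_contDiffOn]
  have h1 := contMDiffOn_chart (I := 𝓡 2) (n := ∞) (x := r b) (M := S2)
  have h2 := contMDiffOn_chart_symm (I := 𝓡 2) (n := ∞) (x := r a) (M := S2)
  refine h1.comp (key.comp (h2.mono ?_) ?_) ?_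
  · intro y hy
    simp at hy ⊢
    exact hy.1.1
  · intro y hy
    simp at hy ⊢
    exact ⟨hy.1.2, hy.2.1⟩
  · intro y hy
    simp at hy ⊢
    exact hy.2.2

/-- The model with corners of the four-manifolds `S² × S²` and `ℝP² × ℝP²`. -/
abbrev I4 := (𝓡 2).prod (𝓡 2)

instance instFactFinrankFour :
    Fact (finrank ℝ (EuclideanSpace ℝ (Fin 2) × EuclideanSpace ℝ (Fin 2)) = 4) :=
  ⟨by simp⟩

/-- The inclusion `S² × S² → ℝ³ ⊕ ℝ³`. -/
def prodEmb (p : S2 × S2) : WithLp 2 (E3 × E3) := WithLp.toLp 2 ((p.1 : E3), (p.2 : E3))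

lemma contMDiff_coe_S2 : ContMDiff (𝓡 2) 𝓘(ℝ, E3) ∞ (fun x : S2 ↦ (x : E3)) := by
  have : Fact (finrank ℝ E3 = 2 + 1) := ⟨finrank_euclideanSpace_fin⟩
  exact contMDiff_coe_sphere

lemma contMDiff_prodEmb : ContMDiff I4 𝓘(ℝ, WithLp 2 (E3 × E3)) ∞ prodEmb := by
  have h : ContMDiff I4 𝓘(ℝ, E3 × E3) ∞ (fun p : S2 × S2 ↦ ((p.1 : E3), (p.2 : E3))) :=
    (contMDiff_coe_S2.comp contMDiff_fst).prodMk_space (contMDiff_coe_S2.comp contMDiff_snd)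
  exact ((WithLp.prodContinuousLinearEquiv 2 ℝ E3 E3).symm.contDiff (n := ∞)).contMDiff.comp h

lemma injective_mvfderiv_coe_S2 (x : S2) :
    Function.Injective (mvfderiv (𝓡 2) (fun x : S2 ↦ (x : E3)) x) := by
  have : Fact (finrank ℝ E3 = 2 + 1) := ⟨finrank_euclideanSpace_fin⟩
  exact injective_mvfderiv_subtypeVal_sphere x

lemma injective_mvfderiv_prodEmb (p : S2 × S2) : Function.Injective (mvfderiv I4 prodEmb p) := by
  have hd : MDifferentiableAt I4 𝓘(ℝ, WithLp 2 (E3 × E3)) prodEmb p :=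
    (contMDiff_prodEmb p).mdifferentiableAt (by simp)
  have hι (x : S2) : MDifferentiableAt (𝓡 2) 𝓘(ℝ, E3) (fun x : S2 ↦ (x : E3)) x :=
    (contMDiff_coe_S2 x).mdifferentiableAt (by simp)
  have h1 : ∀ u : EuclideanSpace ℝ (Fin 2) × EuclideanSpace ℝ (Fin 2),
      (WithLp.ofLp (mvfderiv I4 prodEmb p u)).1
        = mvfderiv (𝓡 2) (fun x : S2 ↦ (x : E3)) p.1 u.1 := fun u ↦ by
    have a := (hι p.1).hasMFDerivAt.comp p
      (hasMFDerivAt_fst (I := 𝓡 2) (I' := 𝓡 2) (M := S2) (M' := S2) p)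
    have b := (WithLp.fstL 2 ℝ E3 E3).hasMFDerivAt.comp p hd.hasMFDerivAt
    exact congrArg (fun L : EuclideanSpace ℝ (Fin 2) × EuclideanSpace ℝ (Fin 2) →L[ℝ] E3 ↦ L u)
      (hasMFDerivAt_unique b a)
  have h2 : ∀ u : EuclideanSpace ℝ (Fin 2) × EuclideanSpace ℝ (Fin 2),
      (WithLp.ofLp (mvfderiv I4 prodEmb p u)).2
        = mvfderiv (𝓡 2) (fun x : S2 ↦ (x : E3)) p.2 u.2 := fun u ↦ by
    have a := (hι p.2).hasMFDerivAt.comp p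
      (hasMFDerivAt_snd (I := 𝓡 2) (I' := 𝓡 2) (M := S2) (M' := S2) p)
    have b := (WithLp.sndL 2 ℝ E3 E3).hasMFDerivAt.comp p hd.hasMFDerivAt
    exact congrArg (fun L : EuclideanSpace ℝ (Fin 2) × EuclideanSpace ℝ (Fin 2) →L[ℝ] E3 ↦ L u)
      (hasMFDerivAt_unique b a)
  intro u v huv
  refine Prod.ext (injective_mvfderiv_coe_S2 p.1 ?_) (injective_mvfderiv_coe_S2 p.2 ?_)
  · rw [← h1 u, ← h1 v, huv]
  · rw [← h2 u, ← h2 v, huv]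

/-- The standard product metric on `S² × S²`: the product of two round metrics of radius one, which
is the metric induced from `ℝ³ ⊕ ℝ³`. -/
def productMetric : SmoothMetric I4 (S2 × S2) :=
  inducedMetric prodEmb contMDiff_prodEmb injective_mvfderiv_prodEmb

/-- The action of `(ε₁, ε₂) ∈ ℤ₂ ⊕ ℤ₂` on `S² × S²` by antipodal maps of the factors. -/
def antipodal (ε₁ ε₂ : ℤˣ) (p : S2 × S2) : S2 × S2 := (ε₁ • p.1, ε₂ • p.2)

/-- `g` is invariant under the antipodal action of `ℤ₂ ⊕ ℤ₂`. -/
def IsAntipodalInvariant (g : SmoothMetric I4 (S2 × S2)) : Prop :=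
  ∀ ε₁ ε₂ : ℤˣ, IsPullback (antipodal ε₁ ε₂) g g

/-- The covering map `S² × S² → ℝP² × ℝP²`. -/
def coveringMap (p : S2 × S2) : RP2 × RP2 := (RP2.proj p.1, RP2.proj p.2)

end

end SecTheta

open SecTheta

namespace SecTheta

noncomputable section

section GaussEquation

variable {E : Type*} [NormedAddCommGroup E] [NormedSpace ℝ E]
  {W : Type*} [NormedAddCommGroup W] [InnerProductSpace ℝ W]

/-- The pullback of the Euclidean inner product under a linear map. -/
def pullbackForm (A : E →L[ℝ] W) : E →L[ℝ] E →L[ℝ] ℝ :=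
  (ContinuousLinearMap.precomp ℝ A) ∘L (innerSL ℝ) ∘L A

@[simp]
lemma pullbackForm_apply (A : E →L[ℝ] W) (u v : E) :
    pullbackForm A u v = inner ℝ (A u) (A v) := rfl

lemma contDiff_pullbackForm : ContDiff ℝ ∞ (pullbackForm : (E →L[ℝ] W) → _) := by
  have : (pullbackForm : (E →L[ℝ] W) → _) = fun A ↦
      (ContinuousLinearMap.compL ℝ E W ℝ).flip A ∘L (innerSL ℝ) ∘L A := rfl
  rw [this]
  fun_prop

lemma isInvertible_pullbackForm [FiniteDimensional ℝ E] {A : E →L[ℝ] W}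
    (hA : Function.Injective A) : (pullbackForm A).IsInvertible := by
  have hinj : Function.Injective (pullbackForm A) := by
    refine (injective_iff_map_eq_zero _).2 fun u hu ↦ ?_
    have : inner ℝ (A u) (A u) = 0 := congrArg (fun L : E →L[ℝ] ℝ ↦ L u) hu
    exact (injective_iff_map_eq_zero A).1 hA u (inner_self_eq_zero.1 this)
  have hdim : finrank ℝ E = finrank ℝ (E →L[ℝ] ℝ) := by
    rw [← (LinearMap.toContinuousLinearMap : (E →ₗ[ℝ] ℝ) ≃ₗ[ℝ] E →L[ℝ] ℝ).finrank_eq]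
    exact Subspace.dual_finrank_eq.symm
  refine ⟨(LinearEquiv.ofInjectiveOfFinrankEq (pullbackForm A : E →ₗ[ℝ] E →L[ℝ] ℝ) hinj
    hdim).toContinuousLinearEquiv, ?_⟩
  ext u v
  rfl

lemma christoffel_spec {G : E → E →L[ℝ] E →L[ℝ] ℝ} {x : E} (h : (G x).IsInvertible) (u v w : E) :
    G x (christoffel G x u v) w =
      (1 / 2) * (fderiv ℝ G x u v w + fderiv ℝ G x v u w - fderiv ℝ G x w u v) := by
  rw [christoffel, h.self_apply_inverse]
  simp

/-- The metric on an open subset of a vector space induced by a map to a Euclidean space. -/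
def inducedForm (Φ : E → W) (x : E) : E →L[ℝ] E →L[ℝ] ℝ := pullbackForm (fderiv ℝ Φ x)

lemma hasFDerivAt_inducedForm_apply {Φ : E → W} (hΦ : ContDiff ℝ ∞ Φ) (x u v w : E) :
    fderiv ℝ (inducedForm Φ) x u v w =
      inner ℝ (fderiv ℝ (fderiv ℝ Φ) x u v) (fderiv ℝ Φ x w)
        + inner ℝ (fderiv ℝ Φ x v) (fderiv ℝ (fderiv ℝ Φ) x u w) := by
  have h1 : ContDiff ℝ ∞ (fderiv ℝ Φ) := hΦ.fderiv_right le_rfl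
  have h2 : DifferentiableAt ℝ (inducedForm Φ) x :=
    ((contDiff_pullbackForm.comp h1).differentiable (by simp)) x
  have h3 := (h2.hasFDerivAt.clm_apply (hasFDerivAt_const v x)).clm_apply (hasFDerivAt_const w x)
  have h4 : HasFDerivAt (fderiv ℝ Φ) (fderiv ℝ (fderiv ℝ Φ) x) x :=
    ((h1.differentiable (by simp)) x).hasFDerivAt
  have h5 (z : E) : HasFDerivAt (fun y ↦ fderiv ℝ Φ y z)
      ((ContinuousLinearMap.apply ℝ W z).comp (fderiv ℝ (fderiv ℝ Φ) x)) x :=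
    (ContinuousLinearMap.apply ℝ W z).hasFDerivAt.comp x h4
  have h6 := (h5 v).inner ℝ (h5 w)
  have h7 := congrArg (fun L : E →L[ℝ] ℝ ↦ L u) (h3.unique h6)
  simpa [add_comm] using h7

omit [InnerProductSpace ℝ W] in
lemma symm_sndFDeriv [NormedSpace ℝ W] {Φ : E → W} (hΦ : ContDiff ℝ ∞ Φ) (x u v : E) :
    fderiv ℝ (fderiv ℝ Φ) x u v = fderiv ℝ (fderiv ℝ Φ) x v u :=
  (hΦ.contDiffAt.isSymmSndFDerivAt (by
    rw [minSmoothness_of_isRCLikeNormedField]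
    exact WithTop.coe_le_coe.2 (le_top : (2 : ℕ∞) ≤ ⊤))).eq u v

lemma inducedForm_christoffel {Φ : E → W} (hΦ : ContDiff ℝ ∞ Φ) {x : E}
    (h : (inducedForm Φ x).IsInvertible) (u v w : E) :
    inner ℝ (fderiv ℝ Φ x (christoffel (inducedForm Φ) x u v)) (fderiv ℝ Φ x w) =
      inner ℝ (fderiv ℝ (fderiv ℝ Φ) x u v) (fderiv ℝ Φ x w) := by
  have := christoffel_spec h u v w
  simp only [hasFDerivAt_inducedForm_apply hΦ] at this
  rw [symm_sndFDeriv hΦ x v u, symm_sndFDeriv hΦ x w u, symm_sndFDeriv hΦ x w v] at this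
  rw [show inducedForm Φ x = pullbackForm (fderiv ℝ Φ x) from rfl, pullbackForm_apply] at this
  rw [this, real_inner_comm (fderiv ℝ Φ x v)]
  ring

variable [FiniteDimensional ℝ E]

lemma inducedForm_fderiv_christoffel {Φ : E → W} (hΦ : ContDiff ℝ ∞ Φ) {x : E}
    (h : Function.Injective (fderiv ℝ Φ x)) (u v w z : E) :
    inducedForm Φ x (fderiv ℝ (fun y ↦ christoffel (inducedForm Φ) y v w) x u) z
      + inducedForm Φ x (christoffel (inducedForm Φ) x u (christoffel (inducedForm Φ) x v w)) z
      + inner ℝ (fderiv ℝ Φ x (christoffel (inducedForm Φ) x v w))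
          (fderiv ℝ (fderiv ℝ Φ) x u z) =
      inner ℝ (fderiv ℝ (fun y ↦ fderiv ℝ (fderiv ℝ Φ) y v w) x u) (fderiv ℝ Φ x z)
        + inner ℝ (fderiv ℝ (fderiv ℝ Φ) x v w) (fderiv ℝ (fderiv ℝ Φ) x u z) := by
  have hi : (inducedForm Φ x).IsInvertible := isInvertible_pullbackForm h
  have h1 : ContDiff ℝ ∞ (fderiv ℝ Φ) := hΦ.fderiv_right le_rfl
  have h2 : ContDiff ℝ ∞ (fderiv ℝ (fderiv ℝ Φ)) := h1.fderiv_right le_rfl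
  have hG : ContDiff ℝ ∞ (inducedForm Φ) := contDiff_pullbackForm.comp h1
  have hev : ∀ᶠ y in 𝓝 x, (inducedForm Φ y).IsInvertible :=
    hG.continuous.continuousAt.eventually_mem (ContinuousLinearEquiv.isOpen.mem_nhds hi)
  have hΓ : DifferentiableAt ℝ (fun y ↦ christoffel (inducedForm Φ) y v w) x := by
    have : ContDiffAt ℝ ∞ (fun y ↦ (inducedForm Φ y).inverse) x :=
      (hi.contDiffAt_map_inverse (n := ∞)).comp x hG.contDiffAt
    have h3 : Differentiable ℝ
        (fun y ↦ innerSL ℝ (fderiv ℝ (fderiv ℝ Φ) y v w) ∘L fderiv ℝ Φ y) :=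
      ((innerSL ℝ).differentiable.comp (((h2.differentiable (by simp)).clm_apply
        (differentiable_const v)).clm_apply (differentiable_const w))).clm_comp
        (h1.differentiable (by simp))
    refine ((this.differentiableAt (by simp)).clm_apply (h3 x)).congr_of_eventuallyEq ?_
    filter_upwards [hev] with y hy
    refine hy.injective ?_
    rw [hy.self_apply_inverse]
    ext z
    exact inducedForm_christoffel hΦ hy v w z
  have hd1 : HasFDerivAt (fderiv ℝ Φ) (fderiv ℝ (fderiv ℝ Φ) x) x :=
    ((h1.differentiable (by simp)) x).hasFDerivAt
  have hd2 : DifferentiableAt ℝ (fun y ↦ fderiv ℝ (fderiv ℝ Φ) y v w) x :=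
    ((((h2.differentiable (by simp)).clm_apply (differentiable_const v)).clm_apply
      (differentiable_const w))) x
  have hz : HasFDerivAt (fun y ↦ fderiv ℝ Φ y z)
      ((ContinuousLinearMap.apply ℝ W z).comp (fderiv ℝ (fderiv ℝ Φ) x)) x :=
    (ContinuousLinearMap.apply ℝ W z).hasFDerivAt.comp x hd1
  have hL := (hd1.clm_apply hΓ.hasFDerivAt).inner ℝ hz
  have hR := hd2.hasFDerivAt.inner ℝ hz
  have heq : (fun y ↦ inner ℝ (fderiv ℝ Φ y (christoffel (inducedForm Φ) y v w)) (fderiv ℝ Φ y z))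
      =ᶠ[𝓝 x] fun y ↦ inner ℝ (fderiv ℝ (fderiv ℝ Φ) y v w) (fderiv ℝ Φ y z) := by
    filter_upwards [hev] with y hy using inducedForm_christoffel hΦ hy v w z
  have key := congrArg (fun L : E →L[ℝ] ℝ ↦ L u) ((hL.congr_of_eventuallyEq heq.symm).unique hR)
  have hcc := inducedForm_christoffel hΦ hi u (christoffel (inducedForm Φ) x v w) z
  simp [inner_add_left] at key
  rw [show inducedForm Φ x = pullbackForm (fderiv ℝ Φ x) from rfl, pullbackForm_apply,
    pullbackForm_apply]
  linarith

/-- The Gauss equation for the metric induced by an immersion `Φ`. -/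
theorem gauss_equation {Φ : E → W} (hΦ : ContDiff ℝ ∞ Φ) {x : E}
    (h : Function.Injective (fderiv ℝ Φ x)) (u v : E) :
    inducedForm Φ x (riemann (inducedForm Φ) x u v v) u =
      inner ℝ (fderiv ℝ (fderiv ℝ Φ) x u u) (fderiv ℝ (fderiv ℝ Φ) x v v)
      - inner ℝ (fderiv ℝ (fderiv ℝ Φ) x u v) (fderiv ℝ (fderiv ℝ Φ) x u v)
      - (inducedForm Φ x (christoffel (inducedForm Φ) x u u) (christoffel (inducedForm Φ) x v v)
        - inducedForm Φ x (christoffel (inducedForm Φ) x u v)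
            (christoffel (inducedForm Φ) x u v)) := by
  have hi : (inducedForm Φ x).IsInvertible := isInvertible_pullbackForm h
  have k1 := inducedForm_fderiv_christoffel hΦ h u v v u
  have k2 := inducedForm_fderiv_christoffel hΦ h v u v u
  have h1 : ContDiff ℝ ∞ (fderiv ℝ Φ) := hΦ.fderiv_right le_rfl
  have hsym : fderiv ℝ (fun y ↦ fderiv ℝ (fderiv ℝ Φ) y v v) x u
      = fderiv ℝ (fun y ↦ fderiv ℝ (fderiv ℝ Φ) y u v) x v := by
    have h2 : Differentiable ℝ (fderiv ℝ (fderiv ℝ Φ)) :=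
      (h1.fderiv_right (m := ∞) le_rfl).differentiable (by simp)
    have e (a b : E) : fderiv ℝ (fun y ↦ fderiv ℝ (fderiv ℝ Φ) y a v) x b
        = fderiv ℝ (fderiv ℝ (fderiv ℝ Φ)) x b a v := by
      rw [fderiv_clm_apply ((h2 x).clm_apply (differentiableAt_const a)) (differentiableAt_const v),
        fderiv_clm_apply (h2 x) (differentiableAt_const a)]
      simp
    rw [e, e]
    rw [symm_sndFDeriv h1 x u v]
  have c1 := inducedForm_christoffel hΦ hi v v (christoffel (inducedForm Φ) x u u)
  have c2 := inducedForm_christoffel hΦ hi u u (christoffel (inducedForm Φ) x v v)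
  have c3 := inducedForm_christoffel hΦ hi u v (christoffel (inducedForm Φ) x u v)
  rw [hsym] at k1
  rw [symm_sndFDeriv hΦ x v u] at k2
  simp only [riemann, map_add, map_sub, add_apply,
    sub_apply]
  have e1 : inducedForm Φ x (christoffel (inducedForm Φ) x u u) (christoffel (inducedForm Φ) x v v)
      = inner ℝ (fderiv ℝ Φ x (christoffel (inducedForm Φ) x v v))
        (fderiv ℝ (fderiv ℝ Φ) x u u) := by
    rw [real_inner_comm, ← c2]; rfl
  have e2 : inducedForm Φ x (christoffel (inducedForm Φ) x u v) (christoffel (inducedForm Φ) x u v)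
      = inner ℝ (fderiv ℝ Φ x (christoffel (inducedForm Φ) x u v))
        (fderiv ℝ (fderiv ℝ Φ) x u v) := by
    rw [real_inner_comm, ← c3]; rfl
  rw [e1, e2, real_inner_comm (fderiv ℝ (fderiv ℝ Φ) x v v)]
  linarith

end GaussEquation

end

end SecTheta

namespace SecTheta

noncomputable section

section BasisChange

variable {E : Type*} [NormedAddCommGroup E] [NormedSpace ℝ E]
  {W : Type*} [NormedAddCommGroup W] [InnerProductSpace ℝ W]

lemma christoffel_combination (G : E → E →L[ℝ] E →L[ℝ] ℝ) (x : E) (a b : ℝ) (u v w : E) :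
    christoffel G x (a • u + b • v) w = a • christoffel G x u w + b • christoffel G x v w := by
  simp only [christoffel, ← map_smul, ← map_add]
  congr 1
  ext z
  simp
  ring

lemma christoffel_combination_right (G : E → E →L[ℝ] E →L[ℝ] ℝ) (x : E) (a b : ℝ) (u v w : E) :
    christoffel G x w (a • u + b • v) = a • christoffel G x w u + b • christoffel G x w v := by
  simp only [christoffel, ← map_smul, ← map_add]
  congr 1
  ext z
  simp
  ring

lemma inducedForm_apply (Φ : E → W) (x u v : E) :
    inducedForm Φ x u v = inner ℝ (fderiv ℝ Φ x u) (fderiv ℝ Φ x v) := rfl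

lemma christoffel_inducedForm_symm {Φ : E → W} (hΦ : ContDiff ℝ ∞ Φ) (x u v : E) :
    christoffel (inducedForm Φ) x u v = christoffel (inducedForm Φ) x v u := by
  simp only [christoffel]
  congr 2
  ext z
  simp only [sub_apply, add_apply, ContinuousLinearMap.flip_apply,
    hasFDerivAt_inducedForm_apply hΦ]
  rw [real_inner_comm (fderiv ℝ Φ x u), real_inner_comm (fderiv ℝ Φ x v)
    (fderiv ℝ (fderiv ℝ Φ) x z u)]
  ring

variable [FiniteDimensional ℝ E]

/-- The sectional curvature of an induced metric depends only on the plane spanned by the two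
vectors. -/
lemma coordSec_inducedForm_combination {Φ : E → W} (hΦ : ContDiff ℝ ∞ Φ) {x : E}
    (h : Function.Injective (fderiv ℝ Φ x)) (u v : E) {a b c d : ℝ} (hdet : a * d - b * c ≠ 0) :
    coordSec (inducedForm Φ) x (a • u + b • v) (c • u + d • v) = coordSec (inducedForm Φ) x u v := by
  have hs := christoffel_inducedForm_symm hΦ x v u
  rw [coordSec, coordSec, gauss_equation hΦ h, gauss_equation hΦ h]
  have hdet2 : (a * d - b * c) ^ 2 ≠ 0 := pow_ne_zero 2 hdet
  conv_rhs => rw [← mul_div_mul_left _ _ hdet2]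
  simp only [inducedForm_apply, christoffel_combination, christoffel_combination_right, map_add, map_smul,
    add_apply, smul_apply, inner_add_left, inner_add_right, inner_smul_left, inner_smul_right,
    symm_sndFDeriv hΦ x v u, hs, RCLike.conj_to_real]
  rw [real_inner_comm (fderiv ℝ Φ x u) (fderiv ℝ Φ x v)]
  set p := fderiv ℝ (fderiv ℝ Φ) x u u
  set q := fderiv ℝ (fderiv ℝ Φ) x v v
  set r := fderiv ℝ (fderiv ℝ Φ) x u v
  set p' := fderiv ℝ Φ x (christoffel (inducedForm Φ) x u u)
  set q' := fderiv ℝ Φ x (christoffel (inducedForm Φ) x v v)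
  set r' := fderiv ℝ Φ x (christoffel (inducedForm Φ) x u v)
  rw [real_inner_comm p q, real_inner_comm p r, real_inner_comm q r, real_inner_comm p' q',
    real_inner_comm p' r', real_inner_comm q' r']
  congr 1 <;> ring

end BasisChange

section WeightedFamilies

variable {E : Type*} [NormedAddCommGroup E] [NormedSpace ℝ E] {ι : Type*} [Fintype ι]

/-- The map to Euclidean space with components `√(w k) * f k`. -/
def weightedMap (w : ι → ℝ) {X : Type*} (f : ι → X → ℝ) (x : X) : EuclideanSpace ℝ ι :=
  WithLp.toLp 2 fun k ↦ √(w k) * f k x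

lemma contDiff_weightedMap (w : ι → ℝ) {f : ι → E → ℝ} (hf : ∀ k, ContDiff ℝ ∞ (f k)) :
    ContDiff ℝ ∞ (weightedMap w f) := by
  refine (contDiff_euclidean (𝕜 := ℝ)).2 fun k ↦ ?_
  exact contDiff_const.mul (hf k)

lemma fderiv_weightedMap (w : ι → ℝ) {f : ι → E → ℝ} (hf : ∀ k, ContDiff ℝ ∞ (f k)) (x u : E)
    (k : ι) : fderiv ℝ (weightedMap w f) x u k = √(w k) * fderiv ℝ (f k) x u := by
  have h1 : HasFDerivAt (weightedMap w f) (fderiv ℝ (weightedMap w f) x) x :=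
    (((contDiff_weightedMap w hf).differentiable (by simp)) x).hasFDerivAt
  have h2 : HasFDerivAt (fun y ↦ √(w k) * f k y)
      ((EuclideanSpace.proj k : EuclideanSpace ℝ ι →L[ℝ] ℝ).comp
        (fderiv ℝ (weightedMap w f) x)) x :=
    (EuclideanSpace.proj k : EuclideanSpace ℝ ι →L[ℝ] ℝ).hasFDerivAt.comp x h1
  have h3 : HasFDerivAt (fun y ↦ √(w k) * f k y) (√(w k) • fderiv ℝ (f k) x) x :=
    ((((hf k).differentiable (by simp)) x).hasFDerivAt).const_mul _
  exact congrArg (fun L : E →L[ℝ] ℝ ↦ L u) (h2.unique h3)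

lemma fderiv_fderiv_weightedMap (w : ι → ℝ) {f : ι → E → ℝ} (hf : ∀ k, ContDiff ℝ ∞ (f k))
    (x u v : E) (k : ι) : fderiv ℝ (fderiv ℝ (weightedMap w f)) x u v k
      = √(w k) * fderiv ℝ (fderiv ℝ (f k)) x u v := by
  have h1 : Differentiable ℝ (fderiv ℝ (weightedMap w f)) :=
    ((contDiff_weightedMap w hf).fderiv_right (m := ∞) le_rfl).differentiable (by simp)
  have h2 : Differentiable ℝ (fderiv ℝ (f k)) :=
    ((hf k).fderiv_right (m := ∞) le_rfl).differentiable (by simp)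
  have h3 : HasFDerivAt (fun y ↦ fderiv ℝ (weightedMap w f) y v k) _ x :=
    (EuclideanSpace.proj k : EuclideanSpace ℝ ι →L[ℝ] ℝ).hasFDerivAt.comp x
      ((h1 x).hasFDerivAt.clm_apply (hasFDerivAt_const v x))
  simp only [fderiv_weightedMap w hf] at h3
  have h4 : HasFDerivAt (fun y ↦ √(w k) * fderiv ℝ (f k) y v) _ x :=
    ((h2 x).hasFDerivAt.clm_apply (hasFDerivAt_const v x)).const_mul _
  simpa using congrArg (fun L : E →L[ℝ] ℝ ↦ L u) (h3.unique h4)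

end WeightedFamilies

section Jets

/-- A value together with a first and a second derivative. -/
structure Jet (V : Type*) where
  /-- the value -/
  val : ℝ
  /-- the first derivative -/
  d : V → ℝ
  /-- the second derivative -/
  h : V → V → ℝ

variable {V : Type*}

instance : Add (Jet V) := ⟨fun a b ↦ ⟨a.val + b.val, fun u ↦ a.d u + b.d u,
  fun u v ↦ a.h u v + b.h u v⟩⟩

instance : Sub (Jet V) := ⟨fun a b ↦ ⟨a.val - b.val, fun u ↦ a.d u - b.d u,
  fun u v ↦ a.h u v - b.h u v⟩⟩

/-- The Leibniz rule. -/
instance : Mul (Jet V) := ⟨fun a b ↦ ⟨a.val * b.val, fun u ↦ a.d u * b.val + a.val * b.d u,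
  fun u v ↦ a.h u v * b.val + a.d u * b.d v + a.d v * b.d u + a.val * b.h u v⟩⟩

namespace Jet

variable (a b : Jet V) (u v : V)

@[simp] lemma add_val : (a + b).val = a.val + b.val := rfl
@[simp] lemma add_d : (a + b).d u = a.d u + b.d u := rfl
@[simp] lemma add_h : (a + b).h u v = a.h u v + b.h u v := rfl
@[simp] lemma sub_val : (a - b).val = a.val - b.val := rfl
@[simp] lemma sub_d : (a - b).d u = a.d u - b.d u := rfl
@[simp] lemma sub_h : (a - b).h u v = a.h u v - b.h u v := rfl
@[simp] lemma mul_val : (a * b).val = a.val * b.val := rfl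
@[simp] lemma mul_d : (a * b).d u = a.d u * b.val + a.val * b.d u := rfl
@[simp] lemma mul_h : (a * b).h u v =
    a.h u v * b.val + a.d u * b.d v + a.d v * b.d u + a.val * b.h u v := rfl

end Jet

variable {E : Type*} [NormedAddCommGroup E] [NormedSpace ℝ E]

/-- The smooth function `f` has the second order Taylor expansion `j` at `x`, where the arguments
of the derivatives of `j` are tangent vectors of `E` transported by `A`. -/
structure HasJet (A : E → V) (x : E) (f : E → ℝ) (j : Jet V) : Prop where
  contDiff : ContDiff ℝ ∞ f
  val : f x = j.val
  d : ∀ u, fderiv ℝ f x u = j.d (A u)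
  h : ∀ u v, fderiv ℝ (fderiv ℝ f) x u v = j.h (A u) (A v)

namespace HasJet

variable {A : E → V} {x : E} {f g : E → ℝ} {a b : Jet V}

lemma add (hf : HasJet A x f a) (hg : HasJet A x g b) :
    HasJet A x (fun y ↦ f y + g y) (a + b) where
  contDiff := hf.contDiff.add hg.contDiff
  val := by simp [hf.val, hg.val]
  d u := by
    rw [fderiv_fun_add (hf.contDiff.differentiable (by simp) x)
      (hg.contDiff.differentiable (by simp) x)]
    simp [hf.d, hg.d]
  h u v := by
    have e : fderiv ℝ (fun y ↦ f y + g y) = fun y ↦ fderiv ℝ f y + fderiv ℝ g y := funext fun y ↦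
      fderiv_fun_add (hf.contDiff.differentiable (by simp) y)
        (hg.contDiff.differentiable (by simp) y)
    rw [e, fderiv_fun_add
      ((hf.contDiff.fderiv_right (m := ∞) le_rfl).differentiable (by simp) x)
      ((hg.contDiff.fderiv_right (m := ∞) le_rfl).differentiable (by simp) x)]
    simp [hf.h, hg.h]

lemma sub (hf : HasJet A x f a) (hg : HasJet A x g b) :
    HasJet A x (fun y ↦ f y - g y) (a - b) where
  contDiff := hf.contDiff.sub hg.contDiff
  val := by simp [hf.val, hg.val]
  d u := by
    rw [fderiv_fun_sub (hf.contDiff.differentiable (by simp) x)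
      (hg.contDiff.differentiable (by simp) x)]
    simp [hf.d, hg.d]
  h u v := by
    have e : fderiv ℝ (fun y ↦ f y - g y) = fun y ↦ fderiv ℝ f y - fderiv ℝ g y := funext fun y ↦
      fderiv_fun_sub (hf.contDiff.differentiable (by simp) y)
        (hg.contDiff.differentiable (by simp) y)
    rw [e, fderiv_fun_sub
      ((hf.contDiff.fderiv_right (m := ∞) le_rfl).differentiable (by simp) x)
      ((hg.contDiff.fderiv_right (m := ∞) le_rfl).differentiable (by simp) x)]
    simp [hf.h, hg.h]

lemma mul (hf : HasJet A x f a) (hg : HasJet A x g b) :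
    HasJet A x (fun y ↦ f y * g y) (a * b) where
  contDiff := hf.contDiff.mul hg.contDiff
  val := by simp [hf.val, hg.val]
  d u := by
    rw [fderiv_fun_mul (hf.contDiff.differentiable (by simp) x)
      (hg.contDiff.differentiable (by simp) x)]
    simp [hf.d, hg.d, hf.val, hg.val]
    ring
  h u v := by
    have df := hf.contDiff.differentiable (by simp)
    have dg := hg.contDiff.differentiable (by simp)
    have df' := (hf.contDiff.fderiv_right (m := ∞) le_rfl).differentiable (by simp)
    have dg' := (hg.contDiff.fderiv_right (m := ∞) le_rfl).differentiable (by simp)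
    have e : fderiv ℝ (fun y ↦ f y * g y) = fun y ↦ f y • fderiv ℝ g y + g y • fderiv ℝ f y :=
      funext fun y ↦ fderiv_fun_mul (df y) (dg y)
    rw [e, fderiv_fun_add ((df x).fun_smul (dg' x)) ((dg x).fun_smul (df' x)),
      fderiv_fun_smul (df x) (dg' x), fderiv_fun_smul (dg x) (df' x)]
    simp [hf.h, hg.h, hf.d, hg.d, hf.val, hg.val]
    ring

lemma const (r : ℝ) : HasJet A x (fun _ ↦ r) ⟨r, fun _ ↦ 0, fun _ _ ↦ 0⟩ where
  contDiff := contDiff_const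
  val := rfl
  d u := by simp
  h u v := by simp [fderiv_fun_const]

lemma of_linear (L : E →L[ℝ] ℝ) {l : V → ℝ} (hl : ∀ u, L u = l (A u)) :
    HasJet A x (fun y ↦ L y) ⟨L x, l, fun _ _ ↦ 0⟩ where
  contDiff := L.contDiff
  val := rfl
  d u := by rw [L.fderiv]; exact hl u
  h u v := by
    have : fderiv ℝ (fun y ↦ L y) = fun _ ↦ L := funext fun y ↦ L.fderiv
    simp [this]

lemma congr_jet (hf : HasJet A x f a) {b : Jet V} (hv : a.val = b.val)
    (hd : ∀ u, a.d (A u) = b.d (A u)) (hh : ∀ u v, a.h (A u) (A v) = b.h (A u) (A v)) :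
    HasJet A x f b :=
  ⟨hf.contDiff, hf.val.trans hv, fun u ↦ (hf.d u).trans (hd u), fun u v ↦ (hf.h u v).trans (hh u v)⟩

end HasJet

end Jets

end

end SecTheta

namespace SecTheta

noncomputable section

section Components

/-- The dot product of `ℝ³`. -/
def dot (a b : E3) : ℝ := a 0 * b 0 + a 1 * b 1 + a 2 * b 2

lemma inner_eq_dot (a b : E3) : inner ℝ a b = dot a b := by
  simp [PiLp.inner_apply, Fin.sum_univ_three, dot, mul_comm]

/-- The triple product of `ℝ³`. -/
def det3 (a b c : E3) : ℝ :=
  a 0 * (b 1 * c 2 - b 2 * c 1) + a 1 * (b 2 * c 0 - b 0 * c 2) + a 2 * (b 0 * c 1 - b 1 * c 0)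

/-- The index set of the functions on `S² × S²` from which the metrics are built. -/
abbrev Idx : Type :=
  Fin 3 ⊕ Fin 3 ⊕ Unit ⊕ Fin 3 ⊕ (Fin 3 ⊕ (Fin 3 × Fin 3)) ⊕ Fin 3

variable {R : Type*} [Add R] [Sub R] [Mul R]

/-- The dot product of two triples. -/
def dotR (x y : Fin 3 → R) : R := x 0 * y 0 + x 1 * y 1 + x 2 * y 2

/-- The cross product of two triples. -/
def crossR (x y : Fin 3 → R) : Fin 3 → R :=
  ![x 1 * y 2 - x 2 * y 1, x 2 * y 0 - x 0 * y 2, x 0 * y 1 - x 1 * y 0]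

/-- The functions `xᵢ`, `yᵢ`, `t = ⟨x, y⟩`, `z = x × y`, `zᵢ t`, `zᵢ zⱼ` and `t xᵢ`. -/
def comp (x y : Fin 3 → R) : Idx → R
  | .inl i => x i
  | .inr (.inl i) => y i
  | .inr (.inr (.inl _)) => dotR x y
  | .inr (.inr (.inr (.inl i))) => crossR x y i
  | .inr (.inr (.inr (.inr (.inl (.inl i))))) => crossR x y i * dotR x y
  | .inr (.inr (.inr (.inr (.inl (.inr (i, j)))))) => crossR x y i * crossR x y j
  | .inr (.inr (.inr (.inr (.inr i)))) => dotR x y * x i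

/-- The weights with which the functions `comp` enter the metric. -/
def weight (c δ : ℝ) : Idx → ℝ
  | .inl _ => 1
  | .inr (.inl _) => 1
  | .inr (.inr (.inl _)) => c + 2 * c ^ 2 + 4 * c ^ 3
  | .inr (.inr (.inr (.inl _))) => c
  | .inr (.inr (.inr (.inr (.inl _)))) => c ^ 3
  | .inr (.inr (.inr (.inr (.inr _)))) => δ * c ^ 3

/-- Euclidean six-space as a product. -/
abbrev V6 : Type := WithLp 2 (E3 × E3)

lemma inner_V6 (u v : V6) : inner ℝ u v = dot u.fst v.fst + dot u.snd v.snd := by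
  rw [WithLp.prod_inner_apply, inner_eq_dot, inner_eq_dot]
  rfl

/-- Second order Taylor expansion of the coordinates of the first factor along geodesics. -/
def jetFst (z : V6) (i : Fin 3) : Jet V6 :=
  ⟨z.fst i, fun u ↦ u.fst i, fun u v ↦ -dot u.fst v.fst * z.fst i⟩

/-- Second order Taylor expansion of the coordinates of the second factor along geodesics. -/
def jetSnd (z : V6) (i : Fin 3) : Jet V6 :=
  ⟨z.snd i, fun u ↦ u.snd i, fun u v ↦ -dot u.snd v.snd * z.snd i⟩

/-- Second order Taylor expansions of the functions `comp`. -/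
def jet (z : V6) : Idx → Jet V6 := comp (jetFst z) (jetSnd z)

/-- Second order Taylor expansion of `t`. -/
def jetT (z : V6) : Jet V6 := dotR (jetFst z) (jetSnd z)

/-- Second order Taylor expansion of `z`. -/
def jetZ (z : V6) : Fin 3 → Jet V6 := crossR (jetFst z) (jetSnd z)

lemma jetT_val (z : V6) : (jetT z).val = dot z.fst z.snd := rfl

lemma jetT_d (z u : V6) : (jetT z).d u = dot u.fst z.snd + dot z.fst u.snd := by
  simp [jetT, dotR, jetFst, jetSnd, dot]; ring

lemma jetT_h (z u v : V6) : (jetT z).h u v =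
    -(dot u.fst v.fst + dot u.snd v.snd) * dot z.fst z.snd + dot u.fst v.snd + dot v.fst u.snd := by
  simp [jetT, dotR, jetFst, jetSnd, dot]; ring

/-- The cross product of `ℝ³`. -/
def cr (a b : E3) : Fin 3 → ℝ := crossR a b

lemma jetZ_val (z : V6) (i : Fin 3) : (jetZ z i).val = cr z.fst z.snd i := by
  fin_cases i <;> simp [jetZ, crossR, jetFst, jetSnd, cr]

lemma jetZ_d (z u : V6) (i : Fin 3) :
    (jetZ z i).d u = cr u.fst z.snd i + cr z.fst u.snd i := by
  fin_cases i <;> simp [jetZ, crossR, jetFst, jetSnd, cr] <;> ring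

lemma jetZ_h (z u v : V6) (i : Fin 3) : (jetZ z i).h u v =
    -(dot u.fst v.fst + dot u.snd v.snd) * cr z.fst z.snd i
      + cr u.fst v.snd i + cr v.fst u.snd i := by
  fin_cases i <;> simp [jetZ, crossR, jetFst, jetSnd, cr] <;> ring

/-- Tangency to `S² × S²` at `z`. -/
def IsTan (z u : V6) : Prop := dot z.fst u.fst = 0 ∧ dot z.snd u.snd = 0

/-- The form `β(a, b) = ⟨xy, ab⟩` for imaginary quaternions. -/
def betaForm (z : V6) (a b : E3) : ℝ := dot z.fst z.snd * dot a b - dot a z.snd * dot z.fst b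

/-- The gradient of the first order part of the second fundamental form. -/
def gamOne (z u v : V6) : V6 :=
  WithLp.toLp 2
    ((dot u.fst v.snd + dot v.fst u.snd) • z.snd - dot u.fst z.snd • v.snd - dot v.fst z.snd • u.snd
        - (betaForm z u.fst v.snd + betaForm z v.fst u.snd) • z.fst,
      (dot u.fst v.snd + dot v.fst u.snd) • z.fst - dot z.fst v.snd • u.fst - dot z.fst u.snd • v.fst
        - (betaForm z u.fst v.snd + betaForm z v.fst u.snd) • z.snd)

/-- The gradient of `t`, multiplied by its Hessian. -/
def gamTwo (z u v : V6) : V6 :=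
  (jetT z).h u v • WithLp.toLp 2
    (z.snd - dot z.fst z.snd • z.fst, z.fst - dot z.fst z.snd • z.snd)

lemma inner_gamTwo {z u v e : V6} (he : IsTan z e) :
    inner ℝ (gamTwo z u v) e = (jetT z).h u v * (jetT z).d e := by
  obtain ⟨h1, h2⟩ := he
  rw [gamTwo, inner_smul_left, inner_V6, jetT_d]
  simp only [RCLike.conj_to_real]
  congr 1
  simp [dot] at *
  linear_combination (-(z.fst 0 * z.snd 0 + z.fst 1 * z.snd 1 + z.fst 2 * z.snd 2)) * (h1 + h2)

lemma inner_gamOne {z u v e : V6} (hu : IsTan z u) (hv : IsTan z v) (he : IsTan z e) :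
    inner ℝ (gamOne z u v) e =
      (jetT z).h u v * (jetT z).d e + ∑ i, (jetZ z i).h u v * (jetZ z i).d e := by
  obtain ⟨u1, u2⟩ := hu
  obtain ⟨v1, v2⟩ := hv
  obtain ⟨e1, e2⟩ := he
  have key : (jetT z).h u v * (jetT z).d e + ∑ i, (jetZ z i).h u v * (jetZ z i).d e =
      -(dot u.fst v.fst + dot u.snd v.snd) *
        (dot z.fst e.fst * dot z.snd z.snd + dot z.fst z.fst * dot z.snd e.snd)
      + (dot u.fst v.snd * (dot e.fst z.snd + dot z.fst e.snd)
        + dot u.fst e.fst * dot z.snd v.snd - dot u.fst z.snd * dot v.snd e.fst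
        + dot z.fst u.fst * dot v.snd e.snd - dot u.fst e.snd * dot z.fst v.snd)
      + (dot v.fst u.snd * (dot e.fst z.snd + dot z.fst e.snd)
        + dot v.fst e.fst * dot z.snd u.snd - dot v.fst z.snd * dot u.snd e.fst
        + dot z.fst v.fst * dot u.snd e.snd - dot v.fst e.snd * dot z.fst u.snd) := by
    rw [Fin.sum_univ_three]
    simp only [jetT_h, jetT_d, jetZ_h, jetZ_d, cr, crossR, Matrix.cons_val_zero,
      Matrix.cons_val_one, Matrix.cons_val]
    simp only [dot]
    ring
  rw [key, e1, e2, u1, u2, v1, v2, inner_V6]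
  have h3 : dot (gamOne z u v).fst e.fst =
      (dot u.fst v.snd + dot v.fst u.snd) * dot e.fst z.snd - dot u.fst z.snd * dot v.snd e.fst
        - dot v.fst z.snd * dot u.snd e.fst
        - (betaForm z u.fst v.snd + betaForm z v.fst u.snd) * dot z.fst e.fst := by
    simp [dot, gamOne]; ring
  have h4 : dot (gamOne z u v).snd e.snd =
      (dot u.fst v.snd + dot v.fst u.snd) * dot z.fst e.snd - dot z.fst v.snd * dot u.fst e.snd
        - dot z.fst u.snd * dot v.fst e.snd
        - (betaForm z u.fst v.snd + betaForm z v.fst u.snd) * dot z.snd e.snd := by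
    simp [dot, gamOne]; ring
  rw [h3, h4, e1, e2]
  ring

end Components

end

end SecTheta

namespace SecTheta

noncomputable section

section AdaptedFrames

lemma dot_comm (a b : E3) : dot a b = dot b a := by simp only [dot]; ring
lemma dot_add_left (a b c : E3) : dot (a + b) c = dot a c + dot b c := by simp [dot]; ring
lemma dot_add_right (a b c : E3) : dot a (b + c) = dot a b + dot a c := by simp [dot]; ring
lemma dot_sub_left (a b c : E3) : dot (a - b) c = dot a c - dot b c := by simp [dot]; ring
lemma dot_sub_right (a b c : E3) : dot a (b - c) = dot a b - dot a c := by simp [dot]; ring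
lemma dot_smul_left (r : ℝ) (a b : E3) : dot (r • a) b = r * dot a b := by simp [dot]; ring
lemma dot_smul_right (r : ℝ) (a b : E3) : dot a (r • b) = r * dot a b := by simp [dot]; ring

/-- A positively oriented orthonormal basis `x, n, m` of `ℝ³`. -/
structure PosFrame (x n m : E3) : Prop where
  xx : dot x x = 1
  nn : dot n n = 1
  mm : dot m m = 1
  xn : dot x n = 0
  xm : dot x m = 0
  nm : dot n m = 0
  det : det3 x n m = 1

lemma PosFrame.eq_combination {x n m : E3} (h : PosFrame x n m) (v : E3) :
    v = dot x v • x + dot n v • n + dot m v • m := by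
  have ho : Orthonormal ℝ ![x, n, m] := by
    rw [orthonormal_iff_ite]
    intro i j
    rw [inner_eq_dot]
    fin_cases i <;> fin_cases j <;>
      simp [h.xx, h.nn, h.mm, h.xn, h.xm, h.nm, dot_comm n x, dot_comm m x, dot_comm m n]
  have hcard : Fintype.card (Fin 3) = finrank ℝ E3 := by simp
  have hb := coe_basisOfOrthonormalOfCardEqFinrank ho hcard
  have hs := ((basisOfOrthonormalOfCardEqFinrank ho hcard).toOrthonormalBasis
    (by rwa [hb])).sum_repr' v
  rw [Fin.sum_univ_three] at hs
  simpa [hb, inner_eq_dot] using hs.symm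

lemma exists_posFrame {x y : E3} (hx : dot x x = 1) (hy : dot y y = 1) :
    ∃ (n m : E3) (C S : ℝ), PosFrame x n m ∧ C ^ 2 + S ^ 2 = 1 ∧ y = C • x - S • m := by
  obtain ⟨n, hn, hxn, hyn⟩ : ∃ n : E3, dot n n = 1 ∧ dot x n = 0 ∧ dot y n = 0 := by
    have hK : (Submodule.span ℝ {x, y} : Submodule ℝ E3)ᗮ ≠ ⊥ := by
      intro hbot
      rw [Submodule.orthogonal_eq_bot_iff] at hbot
      have h1 := finrank_span_finset_le_card (R := ℝ) ({x, y} : Finset E3)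
      rw [Set.finrank, Finset.coe_pair, hbot, finrank_top, finrank_euclideanSpace_fin] at h1
      exact absurd (h1.trans Finset.card_le_two) (by norm_num)
    obtain ⟨n, hn, hn0⟩ := Submodule.exists_mem_ne_zero_of_ne_bot hK
    rw [Submodule.mem_orthogonal] at hn
    have h1 := hn x (Submodule.subset_span (by simp))
    have h2 := hn y (Submodule.subset_span (by simp))
    rw [inner_eq_dot] at h1 h2
    refine ⟨‖n‖⁻¹ • n, ?_, ?_, ?_⟩
    · rw [← inner_eq_dot, real_inner_self_eq_norm_sq, norm_smul, norm_inv, norm_norm,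
        inv_mul_cancel₀ (norm_ne_zero_iff.2 hn0), one_pow]
    · rw [dot_smul_right, h1, mul_zero]
    · rw [dot_smul_right, h2, mul_zero]
  let m : E3 := WithLp.toLp 2 (crossR x n)
  have m0 : m 0 = x 1 * n 2 - x 2 * n 1 := rfl
  have m1 : m 1 = x 2 * n 0 - x 0 * n 2 := rfl
  have m2 : m 2 = x 0 * n 1 - x 1 * n 0 := rfl
  have hmm : dot m m = dot x x * dot n n - dot x n ^ 2 := by
    simp only [dot, m0, m1, m2]; ring
  have hf : PosFrame x n m :=
    { xx := hx
      nn := hn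
      mm := by rw [hmm, hx, hn, hxn]; norm_num
      xn := hxn
      xm := by simp only [dot, m0, m1, m2]; ring
      nm := by simp only [dot, m0, m1, m2]; ring
      det := by
        have : det3 x n m = dot m m := by simp only [det3, dot, m0, m1, m2]; ring
        rw [this, hmm, hx, hn, hxn]; norm_num }
  have hyc := hf.eq_combination y
  rw [dot_comm n y, hyn, zero_smul, add_zero] at hyc
  refine ⟨n, m, dot x y, -dot m y, hf, ?_, ?_⟩
  · rw [hyc, dot_add_left, dot_add_right, dot_add_right] at hy
    simp only [dot_smul_left, dot_smul_right, hf.xx, hf.mm, hf.xm, dot_comm m x] at hy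
    linarith
  · rw [neg_smul, sub_neg_eq_add]
    exact hyc

/-- A frame adapted to a pair of points of the sphere, with coordinates for tangent vectors. -/
lemma exists_adapted_coordinates {z u v : V6} (hx : dot z.fst z.fst = 1) (hy : dot z.snd z.snd = 1)
    (hu : IsTan z u) (hv : IsTan z v) :
    ∃ (n m : E3) (C S a₁ a₂ a₁' a₂' b₁ b₂ b₁' b₂' : ℝ), PosFrame z.fst n m ∧ C ^ 2 + S ^ 2 = 1 ∧
      z.snd = C • z.fst - S • m ∧ u.fst = a₁ • n + a₂ • m ∧ v.fst = a₁' • n + a₂' • m ∧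
      u.snd = b₁ • n + b₂ • (S • z.fst + C • m) ∧ v.snd = b₁' • n + b₂' • (S • z.fst + C • m) := by
  obtain ⟨n, m, C, S, hf, hCS, hy'⟩ := exists_posFrame hx hy
  have ha (w : V6) (hw : IsTan z w) : w.fst = dot n w.fst • n + dot m w.fst • m := by
    conv_lhs => rw [hf.eq_combination w.fst, hw.1]
    simp
  have hb (w : V6) (hw : IsTan z w) :
      w.snd = dot n w.snd • n + (S * dot z.fst w.snd + C * dot m w.snd) • (S • z.fst + C • m) := by
    have h1 := hw.2
    rw [hy', dot_sub_left, dot_smul_left, dot_smul_left] at h1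
    conv_lhs => rw [hf.eq_combination w.snd]
    have e1 : dot z.fst w.snd = S * (S * dot z.fst w.snd + C * dot m w.snd) := by
      linear_combination (-dot z.fst w.snd) * hCS + C * h1
    have e2 : dot m w.snd = C * (S * dot z.fst w.snd + C * dot m w.snd) := by
      linear_combination (-dot m w.snd) * hCS - S * h1
    set r := S * dot z.fst w.snd + C * dot m w.snd with hr
    rw [e1, e2]
    module
  exact ⟨n, m, C, S, _, _, _, _, _, _, _, _, hf, hCS, hy', ha u hu, ha v hv, hb u hu, hb v hv⟩

end AdaptedFrames

section CurvatureIdentities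

/-- The Gauss curvature term of a function with Taylor expansion `j`. -/
def curvTerm (j : Jet V6) (u v : V6) : ℝ := j.h u u * j.h v v - j.h u v ^ 2

/-- The area form of the first factor. -/
def areaFst (z u v : V6) : ℝ := det3 z.fst u.fst v.fst
/-- The area form of the second factor. -/
def areaSnd (z u v : V6) : ℝ := det3 z.snd u.snd v.snd
/-- First mixed component of the bivector `u ∧ v`. -/
def mixFst (z u v : V6) : ℝ := det3 v.fst u.snd z.snd - det3 u.fst v.snd z.snd
/-- Second mixed component of the bivector `u ∧ v`. -/
def mixSnd (z u v : V6) : ℝ := det3 v.fst u.snd z.fst - det3 u.fst v.snd z.fst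

lemma det3_combination {x n m : E3} (h : det3 x n m = 1) (p q r p' q' r' p'' q'' r'' : ℝ) :
    det3 (p • x + q • n + r • m) (p' • x + q' • n + r' • m) (p'' • x + q'' • n + r'' • m)
      = p * (q' * r'' - r' * q'') + q * (r' * p'' - p' * r'') + r * (p' * q'' - q' * p'') := by
  trans (p * (q' * r'' - r' * q'') + q * (r' * p'' - p' * r'') + r * (p' * q'' - q' * p''))
    * det3 x n m
  · simp [det3]
    ring
  · rw [h, mul_one]

lemma sum_curvTerm_jetZ (z u v : V6) : ∑ i, curvTerm (jetZ z i) u v =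
    ((dot u.fst u.fst + dot u.snd u.snd) * (dot v.fst v.fst + dot v.snd v.snd)
      - (dot u.fst v.fst + dot u.snd v.snd) ^ 2)
      * (dot z.fst z.fst * dot z.snd z.snd - dot z.fst z.snd ^ 2)
    - 2 * (dot u.fst u.fst + dot u.snd u.snd)
      * (dot z.fst v.fst * dot z.snd v.snd - dot z.fst v.snd * dot v.fst z.snd)
    - 2 * (dot v.fst v.fst + dot v.snd v.snd)
      * (dot z.fst u.fst * dot z.snd u.snd - dot z.fst u.snd * dot u.fst z.snd)
    + 2 * (dot u.fst v.fst + dot u.snd v.snd)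
      * (dot z.fst u.fst * dot z.snd v.snd - dot z.fst v.snd * dot u.fst z.snd
        + dot z.fst v.fst * dot z.snd u.snd - dot z.fst u.snd * dot v.fst z.snd)
    + 4 * (dot u.fst v.fst * dot u.snd v.snd - dot u.fst v.snd * dot v.fst u.snd)
    - (dot u.fst u.fst * dot v.snd v.snd - dot u.fst v.snd ^ 2)
    - (dot v.fst v.fst * dot u.snd u.snd - dot v.fst u.snd ^ 2)
    - 2 * (dot u.fst v.fst * dot u.snd v.snd - dot u.fst u.snd * dot v.fst v.snd) := by
  rw [Fin.sum_univ_three]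
  simp only [curvTerm, jetZ_h, cr, crossR, Matrix.cons_val_zero,
      Matrix.cons_val_one, Matrix.cons_val]
  simp only [dot]
  ring

/-- The coordinates of two tangent vectors in an adapted frame, together with the expressions of
the dot products and triple products in these coordinates. -/
lemma exists_coordinates {z u v : V6} (hx : dot z.fst z.fst = 1) (hy : dot z.snd z.snd = 1)
    (hu : IsTan z u) (hv : IsTan z v) :
    ∃ (C S a₁ a₂ a₁' a₂' b₁ b₂ b₁' b₂' : ℝ), C ^ 2 + S ^ 2 = 1 ∧
      dot z.fst z.snd = C ∧
      (dot u.fst u.fst = a₁ ^ 2 + a₂ ^ 2 ∧ dot u.fst v.fst = a₁ * a₁' + a₂ * a₂' ∧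
        dot v.fst u.fst = a₁ * a₁' + a₂ * a₂' ∧ dot v.fst v.fst = a₁' ^ 2 + a₂' ^ 2) ∧
      (dot u.snd u.snd = b₁ ^ 2 + b₂ ^ 2 ∧ dot u.snd v.snd = b₁ * b₁' + b₂ * b₂' ∧
        dot v.snd u.snd = b₁ * b₁' + b₂ * b₂' ∧ dot v.snd v.snd = b₁' ^ 2 + b₂' ^ 2) ∧
      (dot u.fst u.snd = a₁ * b₁ + C * (a₂ * b₂) ∧ dot u.fst v.snd = a₁ * b₁' + C * (a₂ * b₂') ∧
        dot v.fst u.snd = a₁' * b₁ + C * (a₂' * b₂) ∧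
        dot v.fst v.snd = a₁' * b₁' + C * (a₂' * b₂')) ∧
      (dot u.fst z.snd = -S * a₂ ∧ dot v.fst z.snd = -S * a₂' ∧ dot z.fst u.snd = S * b₂ ∧
        dot z.fst v.snd = S * b₂') ∧
      (areaFst z u v = a₁ * a₂' - a₂ * a₁' ∧ areaSnd z u v = b₁ * b₂' - b₂ * b₁') ∧
      mixFst z u v = -((a₁ * b₂' - a₁' * b₂) - C * (a₂ * b₁' - a₂' * b₁)) ∧
      mixSnd z u v = -(C * (a₁ * b₂' - a₁' * b₂) - (a₂ * b₁' - a₂' * b₁)) := by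
  obtain ⟨n, m, C, S, a₁, a₂, a₁', a₂', b₁, b₂, b₁', b₂', hf, hCS, h1, h2, h3, h4, h5⟩ :=
    exists_adapted_coordinates hx hy hu hv
  have hd (w w' w'' : E3) : det3 w w' w'' =
      dot z.fst w * (dot n w' * dot m w'' - dot m w' * dot n w'')
        + dot n w * (dot m w' * dot z.fst w'' - dot z.fst w' * dot m w'')
        + dot m w * (dot z.fst w' * dot n w'' - dot n w' * dot z.fst w'') := by
    conv_lhs => rw [hf.eq_combination w, hf.eq_combination w', hf.eq_combination w'']
    exact det3_combination hf.det _ _ _ _ _ _ _ _ _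
  have hS : S ^ 2 = 1 - C ^ 2 := by linarith
  refine ⟨C, S, a₁, a₂, a₁', a₂', b₁, b₂, b₁', b₂', hCS, ?_, ⟨?_, ?_, ?_, ?_⟩, ⟨?_, ?_, ?_, ?_⟩,
    ⟨?_, ?_, ?_, ?_⟩, ⟨?_, ?_, ?_, ?_⟩, ⟨?_, ?_⟩, ?_, ?_⟩ <;>
  simp only [areaFst, areaSnd, mixFst, mixSnd, hd, h1, h2, h3, h4, h5, dot_add_left, dot_add_right,
    dot_sub_right, dot_smul_left, dot_smul_right, hf.xx, hf.nn, hf.mm, hf.xn, hf.xm,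
    hf.nm, dot_comm n z.fst, dot_comm m z.fst, dot_comm m n] <;>
  ring_nf <;> (try simp only [hS]) <;> (try ring)

/-- The first order term of the curvature of the deformed metric. -/
lemma curvTerm_first {z u v : V6} (hx : dot z.fst z.fst = 1) (hy : dot z.snd z.snd = 1)
    (hu : IsTan z u) (hv : IsTan z v) :
    curvTerm (jetT z) u v + ∑ i, curvTerm (jetZ z i) u v =
      areaFst z u v ^ 2 + areaSnd z u v ^ 2
        + 6 * dot z.fst z.snd * areaFst z u v * areaSnd z u v
        + 2 * areaFst z u v * mixFst z u v + 2 * areaSnd z u v * mixSnd z u v := by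
  obtain ⟨C, S, a₁, a₂, a₁', a₂', b₁, b₂, b₁', b₂', hCS, ht, ⟨h1, h2, h3, h4⟩, ⟨h5, h6, h7, h8⟩,
    ⟨h9, h10, h11, h12⟩, ⟨h13, h14, h15, h16⟩, ⟨h17, h18⟩, h19, h20⟩ := exists_coordinates hx hy hu hv
  rw [sum_curvTerm_jetZ]
  simp only [curvTerm, jetT_h, hx, hy, hu.1, hu.2, hv.1, hv.2, ht, h1, h2, h3, h4, h5, h6, h7, h8, h9,
    h10, h11, h12, h13, h14, h15, h16, h17, h18, h19, h20]
  have hS : S ^ 2 = 1 - C ^ 2 := by linarith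
  ring_nf
  simp only [hS]
  ring

lemma inner_gamOne_gamOne (z u v u' v' : V6) (hx : dot z.fst z.fst = 1) (hy : dot z.snd z.snd = 1)
    (hu : IsTan z u) (hv : IsTan z v) (hu' : IsTan z u') (hv' : IsTan z v') :
    inner ℝ (gamOne z u v) (gamOne z u' v') =
      2 * (dot u.fst v.snd + dot v.fst u.snd) * (dot u'.fst v'.snd + dot v'.fst u'.snd)
      + dot u.fst z.snd * dot u'.fst z.snd * dot v.snd v'.snd
      + dot u.fst z.snd * dot v'.fst z.snd * dot v.snd u'.snd
      + dot v.fst z.snd * dot u'.fst z.snd * dot u.snd v'.snd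
      + dot v.fst z.snd * dot v'.fst z.snd * dot u.snd u'.snd
      + dot z.fst v.snd * dot z.fst v'.snd * dot u.fst u'.fst
      + dot z.fst v.snd * dot z.fst u'.snd * dot u.fst v'.fst
      + dot z.fst u.snd * dot z.fst v'.snd * dot v.fst u'.fst
      + dot z.fst u.snd * dot z.fst u'.snd * dot v.fst v'.fst
      - 2 * (betaForm z u.fst v.snd + betaForm z v.fst u.snd)
        * (betaForm z u'.fst v'.snd + betaForm z v'.fst u'.snd) := by
  rw [inner_V6]
  simp only [gamOne, WithLp.toLp_fst, WithLp.toLp_snd, dot_add_left, dot_add_right, dot_sub_left, dot_sub_right, dot_smul_left,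
    dot_smul_right, hx, hy, hu.1, hu.2, hv.1, hv.2, hu'.1, hu'.2, hv'.1, hv'.2,
    dot_comm z.snd z.fst, dot_comm u.snd z.snd, dot_comm v.snd z.snd, dot_comm u.fst z.fst,
    dot_comm v.fst z.fst, dot_comm u.snd z.fst, dot_comm v.snd z.fst, dot_comm z.snd u'.fst,
    dot_comm z.snd v'.fst, betaForm]
  ring

/-- The second order term of the curvature of the deformed metric. -/
lemma curvTerm_second {z u v : V6} (hx : dot z.fst z.fst = 1) (hy : dot z.snd z.snd = 1)
    (hu : IsTan z u) (hv : IsTan z v) :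
    2 * curvTerm (jetT z) u v
        - (inner ℝ (gamOne z u u) (gamOne z v v) - inner ℝ (gamOne z u v) (gamOne z u v)) =
      mixFst z u v ^ 2 + mixSnd z u v ^ 2
        + 2 * dot z.fst z.snd ^ 2 * (areaFst z u v ^ 2 + areaSnd z u v ^ 2)
        + 4 * dot z.fst z.snd * areaFst z u v * areaSnd z u v
        + 4 * dot z.fst z.snd
          * (areaFst z u v * mixSnd z u v + areaSnd z u v * mixFst z u v) := by
  rw [inner_gamOne_gamOne _ _ _ _ _ hx hy hu hu hv hv, inner_gamOne_gamOne _ _ _ _ _ hx hy hu hv hu hv]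
  obtain ⟨C, S, a₁, a₂, a₁', a₂', b₁, b₂, b₁', b₂', hCS, ht, ⟨h1, h2, h3, h4⟩, ⟨h5, h6, h7, h8⟩,
    ⟨h9, h10, h11, h12⟩, ⟨h13, h14, h15, h16⟩, ⟨h17, h18⟩, h19, h20⟩ := exists_coordinates hx hy hu hv
  simp only [curvTerm, betaForm, jetT_h, ht, h1, h2, h3, h4, h5, h6, h7, h8, h9,
    h10, h11, h12, h13, h14, h15, h16, h17, h18, h19, h20]
  have hS : S ^ 2 = 1 - C ^ 2 := by linarith
  have hS4 : S ^ 4 = (1 - C ^ 2) ^ 2 := by rw [← hS]; ring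
  ring_nf
  simp only [hS, hS4]
  ring

end CurvatureIdentities

end

end SecTheta

namespace SecTheta

noncomputable section

section ThirdOrder

/-- The first order term of the metric. -/
def metricOne (z e e' : V6) : ℝ :=
  (jetT z).d e * (jetT z).d e' + ∑ i, (jetZ z i).d e * (jetZ z i).d e'

/-- The curvature term of the functions `t xᵢ`. -/
def curvTX (z u v : V6) : ℝ := ∑ i, curvTerm (jetT z * jetFst z i) u v

/-- The third order term of the curvature, for `δ = 0`. -/
def curvThird (z u v : V6) : ℝ :=
  4 * curvTerm (jetT z) u v + ∑ i, curvTerm (jetZ z i * jetT z) u v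
    + ∑ k : Fin 3 × Fin 3, curvTerm (jetZ z k.1 * jetZ z k.2) u v
    - 2 * (inner ℝ (gamOne z u u) (gamTwo z v v) + inner ℝ (gamTwo z u u) (gamOne z v v)
      - 2 * inner ℝ (gamOne z u v) (gamTwo z u v))
    + (metricOne z (gamOne z u u) (gamOne z v v) - metricOne z (gamOne z u v) (gamOne z u v))

/-- The third order term after completing squares. -/
def curvMain (z u v : V6) : ℝ :=
  curvThird z u v + mixFst z u v ^ 2 + mixSnd z u v ^ 2
    - 2 * dot z.fst z.snd * mixFst z u v * mixSnd z u v

lemma dotR_cr (p q r s : E3) :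
    dotR (cr p q) (cr r s) = dot p r * dot q s - dot p s * dot q r := by
  simp only [dotR, cr, crossR, Matrix.cons_val_zero, Matrix.cons_val_one, Matrix.cons_val, dot]
  ring

lemma sum_curvTerm_jetZ_mul_jetT {z u v : V6} {C p q r : ℝ} (hT : (jetT z).val = C)
    (hu : (jetT z).d u = p) (hv : (jetT z).d v = q)
    (huu : (jetT z).h u u = -C) (hvv : (jetT z).h v v = -C) (huv : (jetT z).h u v = r)
    {P A B D : Fin 3 → ℝ} (hP : ∀ i, (jetZ z i).val = P i) (hA : ∀ i, (jetZ z i).d u = A i)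
    (hB : ∀ i, (jetZ z i).d v = B i) (hPu : ∀ i, (jetZ z i).h u u = -P i)
    (hPv : ∀ i, (jetZ z i).h v v = -P i) (hD : ∀ i, (jetZ z i).h u v = D i) :
    ∑ i, curvTerm (jetZ z i * jetT z) u v =
      4 * (C ^ 2 * dotR P P - C * q * dotR P B - C * p * dotR P A + p * q * dotR A B)
      - (C ^ 2 * dotR D D + r ^ 2 * dotR P P + q ^ 2 * dotR A A + p ^ 2 * dotR B B
        + 2 * (C * r * dotR D P + C * q * dotR D A + C * p * dotR D B + r * q * dotR P A
          + r * p * dotR P B + p * q * dotR A B)) := by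
  simp only [curvTerm, Jet.mul_h, hT, hu, hv, huu, hvv, huv, hP, hA, hB, hPu, hPv, hD,
    Fin.sum_univ_three, dotR]
  ring

lemma sum_curvTerm_jetZ_mul_jetZ {z u v : V6}
    {P A B D : Fin 3 → ℝ} (hP : ∀ i, (jetZ z i).val = P i) (hA : ∀ i, (jetZ z i).d u = A i)
    (hB : ∀ i, (jetZ z i).d v = B i) (hPu : ∀ i, (jetZ z i).h u u = -P i)
    (hPv : ∀ i, (jetZ z i).h v v = -P i) (hD : ∀ i, (jetZ z i).h u v = D i) :
    ∑ k : Fin 3 × Fin 3, curvTerm (jetZ z k.1 * jetZ z k.2) u v =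
      4 * (dotR P P ^ 2 - dotR P B ^ 2 - dotR P A ^ 2 + dotR A B ^ 2)
      - 2 * (dotR D D * dotR P P + dotR D P ^ 2 + dotR A A * dotR B B + dotR A B ^ 2
        + 2 * dotR D A * dotR P B + 2 * dotR D B * dotR P A) := by
  simp only [curvTerm, Jet.mul_h, hP, hA, hB, hPu, hPv, hD, Fintype.sum_prod_type,
    Fin.sum_univ_three, dotR]
  ring

lemma sum_curvTerm_jetT_mul_jetFst {z u v : V6} {C p q r : ℝ} (hT : (jetT z).val = C)
    (hu : (jetT z).d u = p) (hv : (jetT z).d v = q)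
    (huu : (jetT z).h u u = -C) (hvv : (jetT z).h v v = -C) (huv : (jetT z).h u v = r)
    (hx : dot z.fst z.fst = 1) (ha : dot u.fst u.fst = 1) (hxa : dot z.fst u.fst = 0)
    (hv0 : v.fst = 0) :
    curvTX z u v = 2 * C ^ 2 - r ^ 2 - q ^ 2 := by
  have h0 (i : Fin 3) : v.fst i = 0 := by rw [hv0]; rfl
  have h1 : dot u.fst v.fst = 0 := by rw [hv0]; simp [dot]
  have h2 : dot v.fst v.fst = 0 := by rw [hv0]; simp [dot]
  simp only [curvTX, curvTerm, Jet.mul_h, hT, hu, hv, huu, hvv, huv, jetFst, ha, h0, h1, h2,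
    Fin.sum_univ_three]
  simp only [dot] at hx ha hxa
  linear_combination (2 * C ^ 2 - r ^ 2) * hx - q ^ 2 * ha + (-2*C*p- 2 *q * r) * hxa

lemma metricOne_self {z e : V6} (hx : dot z.fst z.fst = 1) (hy : dot z.snd z.snd = 1)
    (he : IsTan z e) :
    metricOne z e e = dot e.fst e.fst + dot e.snd e.snd - 2 * dot z.fst z.snd * dot e.fst e.snd
      + 2 * dot e.fst z.snd * dot z.fst e.snd := by
  have h : ∑ i, (jetZ z i).d e * (jetZ z i).d e =
      dotR (cr e.fst z.snd) (cr e.fst z.snd) + dotR (cr z.fst e.snd) (cr z.fst e.snd)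
        + 2 * dotR (cr e.fst z.snd) (cr z.fst e.snd) := by
    simp only [jetZ_d, Fin.sum_univ_three, dotR]
    ring
  rw [metricOne, h, dotR_cr, dotR_cr, dotR_cr, jetT_d, hx, hy, dot_comm e.fst z.fst, he.1, he.2,
    dot_comm z.snd z.fst, dot_comm z.snd e.fst, dot_comm e.snd z.fst]
  ring

lemma isTan_gamOne {z : V6} (u v : V6) (hx : dot z.fst z.fst = 1) (hy : dot z.snd z.snd = 1)
    (hu : IsTan z u) (hv : IsTan z v) : IsTan z (gamOne z u v) := by
  constructor
  · simp only [gamOne, WithLp.toLp_fst, dot_add_right, dot_sub_right, dot_smul_right, hx, betaForm,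
      dot_comm v.fst z.snd, dot_comm u.fst z.snd]
    ring
  · simp only [gamOne, WithLp.toLp_snd, dot_add_right, dot_sub_right, dot_smul_right, hy, betaForm,
      dot_comm z.snd z.fst, dot_comm z.snd u.fst, dot_comm z.snd v.fst]
    ring

set_option maxHeartbeats 1000000 in
/-- The third order term on the planes spanned by vectors tangent to the two factors. -/
lemma curvMain_mixed {z u v : V6} (hx : dot z.fst z.fst = 1) (hy : dot z.snd z.snd = 1)
    (hu : IsTan z u) (hv : IsTan z v) (hu0 : u.snd = 0) (hv0 : v.fst = 0)
    (ha : dot u.fst u.fst = 1) (hb : dot v.snd v.snd = 1) :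
    curvMain z u v = 1 - betaForm z u.fst v.snd ^ 2 := by
  have sqs {p q : ℝ} (h : 0 = p ^ 2 + q ^ 2) : p = 0 ∧ q = 0 := by
    constructor <;> nlinarith
  have l0 (w : E3) : dot 0 w = 0 := by simp [dot]
  have r0 (w : E3) : dot w 0 = 0 := by simp [dot]
  have cr0 (w : E3) (i : Fin 3) : cr w 0 i = 0 := by fin_cases i <;> simp [cr, crossR]
  have cl0 (w : E3) (i : Fin 3) : cr 0 w i = 0 := by fin_cases i <;> simp [cr, crossR]
  have guu : gamOne z u u = 0 := by
    simp [gamOne, hu0, betaForm, l0, r0]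
  have gvv : gamOne z v v = 0 := by
    simp [gamOne, hv0, betaForm, l0, r0]
  have hT := jetT_val z
  have hTu : (jetT z).d u = dot u.fst z.snd := by rw [jetT_d, hu0, r0, add_zero]
  have hTv : (jetT z).d v = dot z.fst v.snd := by rw [jetT_d, hv0, l0, zero_add]
  have hTuu : (jetT z).h u u = -dot z.fst z.snd := by rw [jetT_h, hu0, r0, r0, ha]; ring
  have hTvv : (jetT z).h v v = -dot z.fst z.snd := by rw [jetT_h, hv0, l0, l0, hb]; ring
  have hTuv : (jetT z).h u v = dot u.fst v.snd := by rw [jetT_h, hu0, hv0, l0, r0, r0]; ring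
  have hA (i : Fin 3) : (jetZ z i).d u = cr u.fst z.snd i := by rw [jetZ_d, hu0, cr0, add_zero]
  have hB (i : Fin 3) : (jetZ z i).d v = cr z.fst v.snd i := by rw [jetZ_d, hv0, cl0, zero_add]
  have hPu (i : Fin 3) : (jetZ z i).h u u = -cr z.fst z.snd i := by
    rw [jetZ_h, hu0, cr0, r0, ha]; ring
  have hPv (i : Fin 3) : (jetZ z i).h v v = -cr z.fst z.snd i := by
    rw [jetZ_h, hv0, cl0, l0, hb]; ring
  have hD (i : Fin 3) : (jetZ z i).h u v = cr u.fst v.snd i := by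
    rw [jetZ_h, hu0, hv0, cr0, l0, r0]; ring
  have hM : metricOne z 0 0 = 0 := by
    simp [metricOne, jetT_d, jetZ_d, l0, r0, cl0, cr0]
  have ht := isTan_gamOne u v hx hy hu hv
  rw [curvMain, curvThird, sum_curvTerm_jetZ_mul_jetT hT hTu hTv hTuu hTvv hTuv (jetZ_val z) hA hB
    hPu hPv hD, sum_curvTerm_jetZ_mul_jetZ (jetZ_val z) hA hB hPu hPv hD, guu, gvv, inner_zero_left,
    inner_zero_right, real_inner_comm, inner_gamTwo ht, hM, metricOne_self hx hy ht, hTuv, jetT_d,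
    ← inner_V6, inner_gamOne_gamOne _ _ _ _ _ hx hy hu hv hu hv]
  simp only [curvTerm, hTuu, hTvv, hTuv, dotR_cr]
  simp only [gamOne, WithLp.toLp_fst, WithLp.toLp_snd, hu0, hv0, betaForm, dot_add_left,
    dot_add_right, dot_sub_left, dot_sub_right, dot_smul_left, dot_smul_right, smul_zero, l0, r0]
  obtain ⟨C, S, a₁, a₂, a₁', a₂', b₁, b₂, b₁', b₂', hCS, ht', ⟨h1, h2, h3, h4⟩, ⟨h5, h6, h7, h8⟩,
    ⟨h9, h10, h11, h12⟩, ⟨h13, h14, h15, h16⟩, ⟨h17, h18⟩, h19, h20⟩ := exists_coordinates hx hy hu hv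
  rw [hu0, l0] at h5
  rw [hv0, l0] at h4
  obtain ⟨rfl, rfl⟩ := sqs h5
  obtain ⟨rfl, rfl⟩ := sqs h4
  have hS : S ^ 2 = 1 - C ^ 2 := by linarith
  have ha' : a₂ ^ 2 = 1 - a₁ ^ 2 := by linarith
  have hb' : b₂' ^ 2 = 1 - b₁' ^ 2 := by linarith
  simp only [dot_comm z.snd z.fst, dot_comm z.snd u.fst, dot_comm v.snd u.fst, dot_comm u.fst z.fst,
    dot_comm v.snd z.snd, dot_comm v.snd z.fst, hx, hy, hu.1, hv.2, ht', h1, h8, h10, h13, h16,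
    h19, h20]
  have hS4 : S ^ 4 = (1 - C ^ 2) ^ 2 := by rw [← hS]; ring
  have ha4 : a₂ ^ 4 = (1 - a₁ ^ 2) ^ 2 := by rw [← ha']; ring
  have hb4 : b₂' ^ 4 = (1 - b₁' ^ 2) ^ 2 := by rw [← hb']; ring
  have ha3 : a₂ ^ 3 = a₂ * (1 - a₁ ^ 2) := by rw [← ha']; ring
  have hb3 : b₂' ^ 3 = b₂' * (1 - b₁' ^ 2) := by rw [← hb']; ring
  ring_nf
  simp only [hS, hS4, ha', hb', ha4, hb4, ha3, hb3]
  ring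

end ThirdOrder

end

end SecTheta

namespace SecTheta

noncomputable section

section QuadraticJets

/-- The first and second order parts of `j` are linear and symmetric bilinear. -/
structure Jet.IsQuad {V : Type*} [AddCommGroup V] [Module ℝ V] (j : Jet V) : Prop where
  d_comb : ∀ (α β : ℝ) (u v : V), j.d (α • u + β • v) = α * j.d u + β * j.d v
  h_comb : ∀ (α β α' β' : ℝ) (u v : V), j.h (α • u + β • v) (α' • u + β' • v) =
    α * α' * j.h u u + (α * β' + β * α') * j.h u v + β * β' * j.h v v

namespace Jet.IsQuad

variable {V : Type*} [AddCommGroup V] [Module ℝ V] {j k : Jet V}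

lemma add (hj : j.IsQuad) (hk : k.IsQuad) : (j + k).IsQuad where
  d_comb α β u v := by simp only [Jet.add_d, hj.d_comb, hk.d_comb]; ring
  h_comb α β α' β' u v := by simp only [Jet.add_h, hj.h_comb, hk.h_comb]; ring

lemma sub (hj : j.IsQuad) (hk : k.IsQuad) : (j - k).IsQuad where
  d_comb α β u v := by simp only [Jet.sub_d, hj.d_comb, hk.d_comb]; ring
  h_comb α β α' β' u v := by simp only [Jet.sub_h, hj.h_comb, hk.h_comb]; ring

lemma mul (hj : j.IsQuad) (hk : k.IsQuad) : (j * k).IsQuad where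
  d_comb α β u v := by simp only [Jet.mul_d, hj.d_comb, hk.d_comb]; ring
  h_comb α β α' β' u v := by
    simp only [Jet.mul_h, hj.h_comb, hk.h_comb, hj.d_comb, hk.d_comb]; ring

lemma curvTerm_comb {j : Jet V6} (hj : j.IsQuad) (α β α' β' : ℝ) (u v : V6) :
    curvTerm j (α • u + β • v) (α' • u + β' • v) = (α * β' - β * α') ^ 2 * curvTerm j u v := by
  simp only [curvTerm, hj.h_comb]
  ring

end Jet.IsQuad

lemma isQuad_jetFst (z : V6) (i : Fin 3) : (jetFst z i).IsQuad where
  d_comb α β u v := by simp [jetFst]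
  h_comb α β α' β' u v := by
    simp only [jetFst, WithLp.add_fst, WithLp.smul_fst, dot_add_left, dot_add_right, dot_smul_left,
      dot_smul_right, dot_comm v.fst u.fst]
    ring

lemma isQuad_jetSnd (z : V6) (i : Fin 3) : (jetSnd z i).IsQuad where
  d_comb α β u v := by simp [jetSnd]
  h_comb α β α' β' u v := by
    simp only [jetSnd, WithLp.add_snd, WithLp.smul_snd, dot_add_left, dot_add_right, dot_smul_left,
      dot_smul_right, dot_comm v.snd u.snd]
    ring

lemma isQuad_jetT (z : V6) : (jetT z).IsQuad :=
  (((isQuad_jetFst z 0).mul (isQuad_jetSnd z 0)).add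
    ((isQuad_jetFst z 1).mul (isQuad_jetSnd z 1))).add
    ((isQuad_jetFst z 2).mul (isQuad_jetSnd z 2))

lemma isQuad_jetZ (z : V6) (i : Fin 3) : (jetZ z i).IsQuad := by
  fin_cases i <;>
  exact ((isQuad_jetFst z _).mul (isQuad_jetSnd z _)).sub
    ((isQuad_jetFst z _).mul (isQuad_jetSnd z _))

lemma isQuad_jet (z : V6) (k : Idx) : (jet z k).IsQuad := by
  rcases k with i | i | i | i | (i | ⟨i, j⟩) | i
  · exact isQuad_jetFst z i
  · exact isQuad_jetSnd z i
  · exact isQuad_jetT z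
  · exact isQuad_jetZ z i
  · exact (isQuad_jetZ z i).mul (isQuad_jetT z)
  · exact (isQuad_jetZ z i).mul (isQuad_jetZ z j)
  · exact (isQuad_jetT z).mul (isQuad_jetFst z i)

lemma gamOne_comb (z u v : V6) (α β α' β' : ℝ) :
    gamOne z (α • u + β • v) (α' • u + β' • v) =
      (α * α') • gamOne z u u + (α * β' + β * α') • gamOne z u v + (β * β') • gamOne z v v := by
  refine WithLp.ofLp_injective _ (Prod.ext ?_ ?_) <;>
  · simp only [gamOne, betaForm, WithLp.add_fst, WithLp.smul_fst, WithLp.add_snd, WithLp.smul_snd,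
      dot_add_left, dot_add_right, dot_smul_left, dot_smul_right, WithLp.ofLp_add, WithLp.ofLp_smul,
      Prod.fst_add, Prod.smul_fst, Prod.snd_add, Prod.smul_snd]
    module

lemma gamTwo_comb (z u v : V6) (α β α' β' : ℝ) :
    gamTwo z (α • u + β • v) (α' • u + β' • v) =
      (α * α') • gamTwo z u u + (α * β' + β * α') • gamTwo z u v + (β * β') • gamTwo z v v := by
  simp only [gamTwo, (isQuad_jetT z).h_comb]
  module

lemma metricOne_add_left (z a b c : V6) :
    metricOne z (a + b) c = metricOne z a c + metricOne z b c := by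
  have h := fun i ↦ (isQuad_jetZ z i).d_comb 1 1 a b
  have h' := (isQuad_jetT z).d_comb 1 1 a b
  simp only [one_smul, one_mul] at h h'
  simp only [metricOne, h, h', add_mul, Finset.sum_add_distrib]
  ring

lemma metricOne_smul_left (z a c : V6) (r : ℝ) :
    metricOne z (r • a) c = r * metricOne z a c := by
  have h := fun i ↦ (isQuad_jetZ z i).d_comb r 0 a 0
  have h' := (isQuad_jetT z).d_comb r 0 a 0
  simp only [zero_smul, zero_mul, add_zero] at h h'
  simp only [metricOne, h, h', mul_add, Finset.mul_sum, mul_assoc]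

lemma metricOne_comm (z a b : V6) : metricOne z a b = metricOne z b a := by
  simp only [metricOne, mul_comm]

lemma metricOne_add_right (z a b c : V6) :
    metricOne z c (a + b) = metricOne z c a + metricOne z c b := by
  rw [metricOne_comm, metricOne_add_left, metricOne_comm z a, metricOne_comm z b]

lemma metricOne_smul_right (z a c : V6) (r : ℝ) :
    metricOne z c (r • a) = r * metricOne z c a := by
  rw [metricOne_comm, metricOne_smul_left, metricOne_comm]

lemma det3_comb (z : E3) (a b c d : E3) (α β α' β' : ℝ) :
    det3 (α • a + β • b) (α' • c + β' • d) z = α * α' * det3 a c z + α * β' * det3 a d z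
      + β * α' * det3 b c z + β * β' * det3 b d z := by
  simp [det3]
  ring

lemma mixFst_comb (z u v : V6) (α β α' β' : ℝ) :
    mixFst z (α • u + β • v) (α' • u + β' • v) = (α * β' - β * α') * mixFst z u v := by
  simp only [mixFst, WithLp.add_fst, WithLp.smul_fst, WithLp.add_snd, WithLp.smul_snd, det3_comb]
  ring

lemma mixSnd_comb (z u v : V6) (α β α' β' : ℝ) :
    mixSnd z (α • u + β • v) (α' • u + β' • v) = (α * β' - β * α') * mixSnd z u v := by
  simp only [mixSnd, WithLp.add_fst, WithLp.smul_fst, WithLp.add_snd, WithLp.smul_snd, det3_comb]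
  ring

lemma curvMain_comb (z u v : V6) (α β α' β' : ℝ) :
    curvMain z (α • u + β • v) (α' • u + β' • v) = (α * β' - β * α') ^ 2 * curvMain z u v := by
  simp only [curvMain, curvThird, mixFst_comb, mixSnd_comb, (isQuad_jetT z).curvTerm_comb,
    ((isQuad_jetZ z _).mul (isQuad_jetT z)).curvTerm_comb,
    ((isQuad_jetZ z _).mul (isQuad_jetZ z _)).curvTerm_comb, ← Finset.mul_sum, gamOne_comb,
    gamTwo_comb, inner_add_left, inner_add_right, inner_smul_left, inner_smul_right,
    metricOne_add_left, metricOne_add_right, metricOne_smul_left, metricOne_smul_right,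
    RCLike.conj_to_real, real_inner_comm (gamTwo z v v) (gamOne z _ _),
    real_inner_comm (gamTwo z u v) (gamOne z _ _), real_inner_comm (gamTwo z u u) (gamOne z _ _),
    metricOne_comm z (gamOne z v v), metricOne_comm z (gamOne z u v) (gamOne z u u)]
  ring

lemma curvTX_comb (z u v : V6) (α β α' β' : ℝ) :
    curvTX z (α • u + β • v) (α' • u + β' • v) = (α * β' - β * α') ^ 2 * curvTX z u v := by
  simp only [curvTX, ((isQuad_jetT z).mul (isQuad_jetFst z _)).curvTerm_comb, ← Finset.mul_sum]

end QuadraticJets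

section FlatPlanes

/-- `u, v` is an orthonormal frame of a plane tangent to `S² × S²` at `z`. -/
structure OrthoFrame (z u v : V6) : Prop where
  xx : dot z.fst z.fst = 1
  yy : dot z.snd z.snd = 1
  tu : IsTan z u
  tv : IsTan z v
  uu : inner ℝ u u = 1
  vv : inner ℝ v v = 1
  uv : inner ℝ u v = 0

lemma gram_eq_areaFst {z u v : V6} (hx : dot z.fst z.fst = 1) (hy : dot z.snd z.snd = 1)
    (hu : IsTan z u) (hv : IsTan z v) :
    dot u.fst u.fst * dot v.fst v.fst - dot u.fst v.fst ^ 2 = areaFst z u v ^ 2 ∧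
    dot u.snd u.snd * dot v.snd v.snd - dot u.snd v.snd ^ 2 = areaSnd z u v ^ 2 := by
  obtain ⟨C, S, a₁, a₂, a₁', a₂', b₁, b₂, b₁', b₂', hCS, ht', ⟨h1, h2, h3, h4⟩, ⟨h5, h6, h7, h8⟩,
    -, -, ⟨h17, h18⟩, -, -⟩ := exists_coordinates hx hy hu hv
  rw [h1, h2, h4, h5, h6, h8, h17, h18]
  constructor <;> ring

lemma exists_unit_of_parallel {p q : E3} (h : dot p p * dot q q - dot p q ^ 2 = 0)
    (h1 : dot p p + dot q q = 1) :
    ∃ (a : E3) (α α' r s : ℝ), dot a a = 1 ∧ p = α • a ∧ q = α' • a ∧ α ^ 2 + α' ^ 2 = 1 ∧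
      a = r • p + s • q := by
  by_cases hp : dot p p = 0
  · have hp0 : p = 0 := by
      rwa [← inner_eq_dot, inner_self_eq_zero] at hp
    refine ⟨q, 0, 1, 0, 1, by linarith, by simp [hp0], by simp, by norm_num, by simp⟩
  · have hpos : 0 < dot p p := lt_of_le_of_ne (by rw [← inner_eq_dot]; exact real_inner_self_nonneg)
      (Ne.symm hp)
    set ρ := √(dot p p) with hρ
    have hρ0 : 0 < ρ := Real.sqrt_pos.2 hpos
    have hρ2 : ρ ^ 2 = dot p p := Real.sq_sqrt hpos.le
    have hq : q = (dot p q / dot p p) • p := by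
      rw [← sub_eq_zero, ← inner_self_eq_zero (𝕜 := ℝ), inner_eq_dot, dot_sub_left, dot_sub_right,
        dot_sub_right, dot_smul_left, dot_smul_right, dot_smul_right, dot_comm q p]
      field_simp
      rw [dot_smul_left, div_mul_cancel₀ _ hp]
      linarith
    refine ⟨ρ⁻¹ • p, ρ, dot p q / ρ, ρ⁻¹, 0, ?_, ?_, ?_, ?_, by simp⟩
    · rw [dot_smul_left, dot_smul_right, ← hρ2]; field_simp
    · rw [smul_smul, mul_inv_cancel₀ hρ0.ne', one_smul]
    · rw [smul_smul]
      conv_lhs => rw [hq, ← hρ2]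
      congr 1
      field_simp
    · rw [div_pow, hρ2]
      have : dot p q ^ 2 = dot p p * dot q q := by linarith
      rw [this]
      field_simp
      linarith

/-- A plane with vanishing curvature in the product metric is a product of lines. -/
lemma OrthoFrame.exists_mixed {z u v : V6} (h : OrthoFrame z u v) (hp : areaFst z u v = 0)
    (hq : areaSnd z u v = 0) :
    ∃ (e f : V6) (α β : ℝ), IsTan z e ∧ IsTan z f ∧ e.snd = 0 ∧ f.fst = 0 ∧ dot e.fst e.fst = 1 ∧
      dot f.snd f.snd = 1 ∧ α ^ 2 + β ^ 2 = 1 ∧ u = α • e + (-β) • f ∧ v = β • e + α • f := by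
  obtain ⟨g1, g2⟩ := gram_eq_areaFst h.xx h.yy h.tu h.tv
  have huu := h.uu
  have hvv := h.vv
  have huv := h.uv
  rw [inner_V6] at huu hvv huv
  rw [hp] at g1
  rw [hq] at g2
  have k1 : dot u.fst u.fst + dot v.fst v.fst = 1 := by
    have : dot u.snd v.snd = -dot u.fst v.fst := by linarith
    rw [this] at g2
    have e1 : dot u.snd u.snd = 1 - dot u.fst u.fst := by linarith
    have e2 : dot v.snd v.snd = 1 - dot v.fst v.fst := by linarith
    rw [e1, e2] at g2
    linarith
  have k2 : dot u.snd u.snd + dot v.snd v.snd = 1 := by linarith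
  obtain ⟨a, α, β, r, s, ha, hua, hva, hαβ, ha'⟩ :=
    exists_unit_of_parallel (g1.trans (by norm_num)) k1
  obtain ⟨b, γ, ε, r', s', hb, hub, hvb, hγε, hb'⟩ :=
    exists_unit_of_parallel (g2.trans (by norm_num)) k2
  have hxa : dot z.fst a = 0 := by
    rw [ha', dot_add_right, dot_smul_right, dot_smul_right, h.tu.1, h.tv.1]; ring
  have hyb : dot z.snd b = 0 := by
    rw [hb', dot_add_right, dot_smul_right, dot_smul_right, h.tu.2, h.tv.2]; ring
  have o1 : α ^ 2 + γ ^ 2 = 1 := by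
    rw [hua, hub, dot_smul_left, dot_smul_right, dot_smul_left, dot_smul_right, ha, hb] at huu
    linarith
  have o3 : β ^ 2 + ε ^ 2 = 1 := by
    rw [hva, hvb, dot_smul_left, dot_smul_right, dot_smul_left, dot_smul_right, ha, hb] at hvv
    linarith
  have o2 : α * β + γ * ε = 0 := by
    rw [hua, hub, hva, hvb, dot_smul_left, dot_smul_right, dot_smul_left, dot_smul_right, ha, hb]
      at huv
    linarith
  set τ := α * ε - β * γ with hτ
  have t1 : γ = τ * (-β) := by rw [hτ]; linear_combination ε * o2 - γ * o3
  have t2 : ε = τ * α := by rw [hτ]; linear_combination γ * o2 - ε * o1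
  have t3 : τ ^ 2 = 1 := by
    have : τ ^ 2 * (α ^ 2 + β ^ 2) = γ ^ 2 + ε ^ 2 := by rw [t1, t2]; ring
    rw [hαβ, hγε] at this
    linarith
  have z0 (w : E3) : dot w 0 = 0 := by simp [dot]
  refine ⟨WithLp.toLp 2 (a, 0), WithLp.toLp 2 (0, τ • b), α, β, ⟨hxa, z0 _⟩, ⟨z0 _, ?_⟩, rfl, rfl,
    ha, ?_, hαβ, ?_, ?_⟩
  · change dot z.snd (τ • b) = 0
    rw [dot_smul_right, hyb, mul_zero]
  · change dot (τ • b) (τ • b) = 1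
    rw [dot_smul_right, dot_smul_left, hb]
    linarith
  · refine WithLp.ofLp_injective _ (Prod.ext ?_ ?_)
    · change u.fst = _
      simp [hua]
    · change u.snd = _
      simp [hub, smul_smul, t1, mul_comm]
  · refine WithLp.ofLp_injective _ (Prod.ext ?_ ?_)
    · change v.fst = _
      simp [hva]
    · change v.snd = _
      simp [hvb, smul_smul, t2, mul_comm]

lemma curvTX_mixed {z u v : V6} (hx : dot z.fst z.fst = 1) (hu : IsTan z u) (hu0 : u.snd = 0)
    (hv0 : v.fst = 0) (ha : dot u.fst u.fst = 1) (hb : dot v.snd v.snd = 1) :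
    curvTX z u v =
      2 * dot z.fst z.snd ^ 2 - dot u.fst v.snd ^ 2 - dot z.fst v.snd ^ 2 := by
  have l0 (w : E3) : dot 0 w = 0 := by simp [dot]
  have r0 (w : E3) : dot w 0 = 0 := by simp [dot]
  exact sum_curvTerm_jetT_mul_jetFst (jetT_val z) rfl (by rw [jetT_d, hv0, l0, zero_add])
    (by rw [jetT_h, hu0, r0, r0, ha]; ring) (by rw [jetT_h, hv0, l0, l0, hb]; ring)
    (by rw [jetT_h, hu0, hv0, l0, r0, r0]; ring) hx ha hu.1 hv0

/-- Coordinates for the frame of a flat plane. -/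
lemma mixed_coordinates {C S a₁ a₂ b₁ b₂ : ℝ} (hCS : C ^ 2 + S ^ 2 = 1)
    (ha : a₁ ^ 2 + a₂ ^ 2 = 1) (hb : b₁ ^ 2 + b₂ ^ 2 = 1) :
    1 - (C * (a₁ * b₁) + a₂ * b₂) ^ 2 =
      (C * a₁ * b₂ - a₂ * b₁) ^ 2 + S ^ 2 * a₁ ^ 2 := by
  have hS : S ^ 2 = 1 - C ^ 2 := by linarith
  have ha' : a₂ ^ 2 = 1 - a₁ ^ 2 := by linarith
  have hb' : b₂ ^ 2 = 1 - b₁ ^ 2 := by linarith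
  rw [hS]
  ring_nf
  simp only [ha', hb']
  ring

lemma PosFrame.exists_mixed_coordinates {z : V6} {n m a b : E3} {C S : ℝ}
    (hF : PosFrame z.fst n m) (hCS : C ^ 2 + S ^ 2 = 1) (hz : z.snd = C • z.fst - S • m)
    (ha : dot a a = 1) (hxa : dot z.fst a = 0) (hb : dot b b = 1) (hyb : dot z.snd b = 0) :
    ∃ a₁ a₂ b₁ b₂ : ℝ, a = a₁ • n + a₂ • m ∧ b = b₁ • n + b₂ • (S • z.fst + C • m) ∧
      a₁ ^ 2 + a₂ ^ 2 = 1 ∧ b₁ ^ 2 + b₂ ^ 2 = 1 ∧ dot z.fst z.snd = C ∧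
      dot a b = a₁ * b₁ + C * (a₂ * b₂) ∧ dot z.fst b = S * b₂ ∧
      betaForm z a b = C * (a₁ * b₁) + a₂ * b₂ := by
  have ha' := hF.eq_combination a
  rw [hxa, zero_smul, zero_add] at ha'
  have hb' : b = dot n b • n + (S * dot z.fst b + C * dot m b) • (S • z.fst + C • m) := by
    rw [hz, dot_sub_left, dot_smul_left, dot_smul_left] at hyb
    have e1 : dot z.fst b = S * (S * dot z.fst b + C * dot m b) := by
      linear_combination (-dot z.fst b) * hCS + C * hyb
    have e2 : dot m b = C * (S * dot z.fst b + C * dot m b) := by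
      linear_combination (-dot m b) * hCS - S * hyb
    conv_lhs => rw [hF.eq_combination b]
    set r := S * dot z.fst b + C * dot m b with hr
    rw [e1, e2]
    module
  generalize dot n a = a₁ at ha'
  generalize dot m a = a₂ at ha'
  generalize S * dot z.fst b + C * dot m b = b₂ at hb'
  generalize dot n b = b₁ at hb'
  subst ha' hb'
  simp only [dot_add_left, dot_add_right, dot_smul_left, dot_smul_right, hF.xx, hF.nn, hF.mm, hF.xn,
    hF.xm, hF.nm, dot_comm n z.fst, dot_comm m z.fst, dot_comm m n] at ha hb
  refine ⟨a₁, a₂, b₁, b₂, rfl, rfl, by linarith, ?_, ?_, ?_, ?_, ?_⟩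
  · linear_combination hb - b₂ ^ 2 * hCS
  all_goals
    simp only [betaForm, hz, dot_add_left, dot_add_right, dot_sub_right, dot_smul_left,
      dot_smul_right, hF.xx, hF.nn, hF.mm, hF.xn, hF.xm, hF.nm, dot_comm n z.fst, dot_comm m z.fst,
      dot_comm m n]
  · ring
  · ring
  · ring
  · linear_combination (a₂ * b₂) * hCS

lemma OrthoFrame.curvMain_nonneg {z u v : V6} (h : OrthoFrame z u v) (hp : areaFst z u v = 0)
    (hq : areaSnd z u v = 0) : 0 ≤ curvMain z u v := by
  obtain ⟨e, f, α, β, he, hf, he0, hf0, ha, hb, hαβ, rfl, rfl⟩ := h.exists_mixed hp hq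
  rw [curvMain_comb, curvMain_mixed h.xx h.yy he hf he0 hf0 ha hb]
  refine mul_nonneg (sq_nonneg _) ?_
  obtain ⟨n, m, C, S, hF, hCS, hz⟩ := exists_posFrame h.xx h.yy
  obtain ⟨a₁, a₂, b₁, b₂, -, -, h1, h2, -, -, -, hβ⟩ :=
    hF.exists_mixed_coordinates hCS hz ha he.1 hb hf.2
  rw [hβ, mixed_coordinates hCS h1 h2]
  positivity

lemma span_pair_combination {V : Type*} [AddCommGroup V] [Module ℝ V] (e f : V) {p q r s : ℝ}
    (h : p * s - q * r ≠ 0) :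
    Submodule.span ℝ {p • e + q • f, r • e + s • f} = Submodule.span ℝ {e, f} := by
  refine le_antisymm (Submodule.span_le.2 ?_) (Submodule.span_le.2 ?_)
  · rintro w (rfl | rfl) <;> exact Submodule.mem_span_pair.2 ⟨_, _, rfl⟩
  · rintro w (rfl | rfl) <;> refine Submodule.mem_span_pair.2 ?_
    · refine ⟨s / (p * s - q * r), -q / (p * s - q * r), ?_⟩
      trans ((p * s - q * r) / (p * s - q * r)) • w
      · module
      · rw [div_self h, one_smul]
    · refine ⟨-r / (p * s - q * r), p / (p * s - q * r), ?_⟩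
      trans ((p * s - q * r) / (p * s - q * r)) • w
      · module
      · rw [div_self h, one_smul]

lemma OrthoFrame.span_eq_or_curvTX {z u v : V6} (h : OrthoFrame z u v) {n m : E3} {C S : ℝ}
    (hF : PosFrame z.fst n m) (hCS : C ^ 2 + S ^ 2 = 1) (hz : z.snd = C • z.fst - S • m)
    (hp : areaFst z u v = 0) (hq : areaSnd z u v = 0) (h0 : curvMain z u v = 0) :
    (S ≠ 0 → Submodule.span ℝ {u, v} =
      Submodule.span ℝ {WithLp.toLp 2 (m, 0), WithLp.toLp 2 (0, S • z.fst + C • m)}) ∧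
    (S = 0 → 0 < curvTX z u v) := by
  obtain ⟨e, f, α, β, he, hf, he0, hf0, ha, hb, hαβ, rfl, rfl⟩ := h.exists_mixed hp hq
  have hdet : α * α - -β * β = 1 := by linarith
  obtain ⟨a₁, a₂, b₁, b₂, hea, hfb, h1, h2, ht, hab, hxb, hβ⟩ :=
    hF.exists_mixed_coordinates hCS hz ha he.1 hb hf.2
  rw [curvMain_comb, curvMain_mixed h.xx h.yy he hf he0 hf0 ha hb, hdet, hβ, one_pow,
    one_mul, mixed_coordinates hCS h1 h2] at h0
  have k1 : C * a₁ * b₂ - a₂ * b₁ = 0 := by nlinarith [sq_nonneg (S * a₁)]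
  have k2 : S * a₁ = 0 := by nlinarith [sq_nonneg (C * a₁ * b₂ - a₂ * b₁)]
  constructor
  · intro hS
    obtain rfl : a₁ = 0 := by simpa [hS] using k2
    have ha2 : a₂ ≠ 0 := fun h ↦ by norm_num [h] at h1
    obtain rfl : b₁ = 0 := by simpa [ha2] using k1
    have hb2 : b₂ ≠ 0 := fun h ↦ by norm_num [h] at h2
    rw [span_pair_combination _ _ (by rw [hdet]; exact one_ne_zero)]
    have e1 : e = a₂ • WithLp.toLp 2 (m, 0) + (0 : ℝ) • WithLp.toLp 2 (0, S • z.fst + C • m) := by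
      refine WithLp.ofLp_injective _ (Prod.ext ?_ ?_)
      · change e.fst = _
        simp [hea]
      · change e.snd = _
        simp [he0]
    have e2 : f = (0 : ℝ) • WithLp.toLp 2 (m, 0) + b₂ • WithLp.toLp 2 (0, S • z.fst + C • m) := by
      refine WithLp.ofLp_injective _ (Prod.ext ?_ ?_)
      · change f.fst = _
        simp [hf0]
      · change f.snd = _
        simp [hfb]
    rw [e1, e2, span_pair_combination _ _ (by simp [ha2, hb2])]
  · rintro rfl
    rw [curvTX_comb, curvTX_mixed h.xx he he0 hf0 ha hb, hdet, ht, hab, hxb]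
    have hC : C ^ 2 = 1 := by linarith
    have : (a₁ * b₁ + C * (a₂ * b₂)) ^ 2 = 1 := by
      have := mixed_coordinates hCS h1 h2
      rw [k1] at this
      have e3 : (a₁ * b₁ + C * (a₂ * b₂)) ^ 2 = (C * (a₁ * b₁) + a₂ * b₂) ^ 2 := by
        linear_combination ((a₂ * b₂) ^ 2 - (a₁ * b₁) ^ 2) * hC
      rw [e3]
      linarith
    rw [this, hC]
    norm_num

/-- Two flat planes at the same point coincide if the main term vanishes on them, unless the term
of the functions `t xᵢ` is positive on both of them. -/
lemma OrthoFrame.rigidity {z u v u' v' : V6} (h : OrthoFrame z u v) (h' : OrthoFrame z u' v')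
    (hp : areaFst z u v = 0) (hq : areaSnd z u v = 0) (hp' : areaFst z u' v' = 0)
    (hq' : areaSnd z u' v' = 0) (h0 : curvMain z u v = 0) (h0' : curvMain z u' v' = 0)
    (hne : Submodule.span ℝ {u, v} ≠ Submodule.span ℝ {u', v'}) :
    0 < curvTX z u v ∧ 0 < curvTX z u' v' := by
  obtain ⟨n, m, C, S, hF, hCS, hz⟩ := exists_posFrame h.xx h.yy
  obtain ⟨k1, k2⟩ := h.span_eq_or_curvTX hF hCS hz hp hq h0
  obtain ⟨k1', k2'⟩ := h'.span_eq_or_curvTX hF hCS hz hp' hq' h0'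
  by_cases hS : S = 0
  · exact ⟨k2 hS, k2' hS⟩
  · exact absurd ((k1 hS).trans (k1' hS).symm) hne

end FlatPlanes

end

end SecTheta

namespace SecTheta

noncomputable section

section Perturbation

/-- Expansion of a product of solutions of linear equations `⟪Γ, e⟫ + c K(Γ, e) = B(e)`. -/
lemma product_estimate {V : Type*} [NormedAddCommGroup V] [InnerProductSpace ℝ V]
    (T : Submodule ℝ V) {c C : ℝ} (hc : 0 ≤ c) (hc1 : c ≤ 1) (hC : 1 ≤ C) {K H : V → V → ℝ}
    (hadd : ∀ a b e, K (a + b) e = K a e + K b e) (hsmul : ∀ (r : ℝ) a e, K (r • a) e = r * K a e)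
    (hpos : ∀ e, 0 ≤ K e e)
    (hK : ∀ e ∈ T, ∀ e' ∈ T, |K e e'| ≤ C * ‖e‖ * ‖e'‖)
    (hH : ∀ e ∈ T, ∀ e' ∈ T, |K e e' - H e e'| ≤ c * C * ‖e‖ * ‖e'‖)
    {B B' : V → ℝ} {γ₁ γ₂ γ₁' γ₂' Γ Γ' : V} (h1 : γ₁ ∈ T) (h1' : γ₁' ∈ T) (hΓ : Γ ∈ T) (hΓ' : Γ' ∈ T)
    (n1 : ‖γ₁‖ ≤ C) (n2 : ‖γ₂‖ ≤ C) (n1' : ‖γ₁'‖ ≤ C) (n2' : ‖γ₂'‖ ≤ C)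
    (hB : ∀ e ∈ T, |B e - c * inner ℝ γ₁ e - 2 * c ^ 2 * inner ℝ γ₂ e| ≤ C * c ^ 3 * ‖e‖)
    (hB' : ∀ e ∈ T, |B' e - c * inner ℝ γ₁' e - 2 * c ^ 2 * inner ℝ γ₂' e| ≤ C * c ^ 3 * ‖e‖)
    (hE : ∀ e ∈ T, inner ℝ Γ e + c * K Γ e = B e)
    (hE' : ∀ e ∈ T, inner ℝ Γ' e + c * K Γ' e = B' e) :
    |inner ℝ Γ Γ' + c * K Γ Γ' - c ^ 2 * inner ℝ γ₁ γ₁'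
      - c ^ 3 * (2 * inner ℝ γ₁ γ₂' + 2 * inner ℝ γ₂ γ₁' - H γ₁' γ₁)| ≤ 27 * C ^ 4 * c ^ 4 := by
  have hC0 : 0 ≤ C := by linarith
  have c2 : c ^ 2 ≤ c := by nlinarith
  have c3 : c ^ 3 ≤ c ^ 2 := by nlinarith [sq_nonneg c]
  have b1 : ∀ e, ∀ γ : V, ‖γ‖ ≤ C → |inner ℝ γ e| ≤ C * ‖e‖ := fun e γ hγ ↦
    (abs_real_inner_le_norm _ _).trans (by gcongr)
  have norm_le {r : ℝ} {w : V} (h : ‖w‖ ^ 2 ≤ r * ‖w‖) (hr : 0 ≤ r) : ‖w‖ ≤ r := by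
    by_contra! hlt
    nlinarith [norm_nonneg w]
  have size (Γ γ₁ γ₂ : V) (B : V → ℝ) (hΓ : Γ ∈ T) (n1 : ‖γ₁‖ ≤ C) (n2 : ‖γ₂‖ ≤ C)
      (hB : ∀ e ∈ T, |B e - c * inner ℝ γ₁ e - 2 * c ^ 2 * inner ℝ γ₂ e| ≤ C * c ^ 3 * ‖e‖)
      (hE : ∀ e ∈ T, inner ℝ Γ e + c * K Γ e = B e) : ‖Γ‖ ≤ 4 * C * c := by
    refine norm_le ?_ (by positivity)
    have e1 := hE Γ hΓ
    have e2 := (abs_le.1 (hB Γ hΓ)).2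
    have e3 := (abs_le.1 (b1 Γ γ₁ n1)).2
    have e4 := (abs_le.1 (b1 Γ γ₂ n2)).2
    rw [real_inner_self_eq_norm_sq] at e1
    have e5 := mul_nonneg hc (hpos Γ)
    have e6 : c * inner ℝ γ₁ Γ ≤ c * (C * ‖Γ‖) := by gcongr
    have e7 : 2 * c ^ 2 * inner ℝ γ₂ Γ ≤ 2 * c * (C * ‖Γ‖) := by
      calc 2 * c ^ 2 * inner ℝ γ₂ Γ ≤ 2 * c ^ 2 * (C * ‖Γ‖) := by gcongr
        _ ≤ _ := by gcongr
    have e8 : C * c ^ 3 * ‖Γ‖ ≤ C * c * ‖Γ‖ := by gcongr; linarith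
    linarith
  have diff (Γ γ₁ γ₂ : V) (B : V → ℝ) (hΓ : Γ ∈ T) (h1 : γ₁ ∈ T) (n1 : ‖γ₁‖ ≤ C) (n2 : ‖γ₂‖ ≤ C)
      (hB : ∀ e ∈ T, |B e - c * inner ℝ γ₁ e - 2 * c ^ 2 * inner ℝ γ₂ e| ≤ C * c ^ 3 * ‖e‖)
      (hE : ∀ e ∈ T, inner ℝ Γ e + c * K Γ e = B e) : ‖Γ - c • γ₁‖ ≤ 7 * C ^ 2 * c ^ 2 := by
    have hs := size Γ γ₁ γ₂ B hΓ n1 n2 hB hE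
    have hD : Γ - c • γ₁ ∈ T := T.sub_mem hΓ (T.smul_mem _ h1)
    refine norm_le ?_ (by positivity)
    set D := Γ - c • γ₁ with hDdef
    have e1 := hE D hD
    have e2 := (abs_le.1 (hB D hD)).2
    have e4 := (abs_le.1 (b1 D γ₂ n2)).2
    have e5 := (abs_le.1 (hK Γ hΓ D hD)).1
    have e6 : inner ℝ Γ D = ‖D‖ ^ 2 + c * inner ℝ γ₁ D := by
      have : Γ = D + c • γ₁ := by rw [hDdef]; abel
      conv_lhs => rw [this]
      rw [inner_add_left, real_inner_self_eq_norm_sq, inner_smul_left]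
      rfl
    have e7 : 2 * c ^ 2 * inner ℝ γ₂ D ≤ 2 * c ^ 2 * (C * ‖D‖) := by gcongr
    have e8 : c * (C * ‖Γ‖ * ‖D‖) ≤ c * (C * (4 * C * c) * ‖D‖) := by gcongr
    have e9 : C * c ^ 3 * ‖D‖ ≤ C * c ^ 2 * ‖D‖ := by gcongr
    have e10 : 3 * (C * c ^ 2 * ‖D‖) ≤ 3 * (C ^ 2 * c ^ 2 * ‖D‖) := by gcongr; nlinarith
    have e11 := mul_le_mul_of_nonneg_left e5 hc
    clear * - e1 e2 e6 e7 e8 e9 e10 e11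
    linarith
  have s' := size Γ' γ₁' γ₂' B' hΓ' n1' n2' hB' hE'
  have d' := diff Γ' γ₁' γ₂' B' hΓ' h1' n1' n2' hB' hE'
  have hD : Γ' - c • γ₁' ∈ T := T.sub_mem hΓ' (T.smul_mem _ h1')
  set D := Γ' - c • γ₁' with hDdef
  have hΓD : Γ' = c • γ₁' + D := by rw [hDdef]; abel
  have f1 := hB Γ' hΓ'
  have f2 : inner ℝ γ₂ Γ' = c * inner ℝ γ₂ γ₁' + inner ℝ γ₂ D := by
    rw [hΓD, inner_add_right, inner_smul_right]
  have f3 : |inner ℝ γ₂ D| ≤ C * (7 * C ^ 2 * c ^ 2) := (b1 D γ₂ n2).trans (by gcongr)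
  have f4 := hB' γ₁ h1
  have f5 := hE' γ₁ h1
  have f6 : K Γ' γ₁ = c * K γ₁' γ₁ + K D γ₁ := by rw [hΓD, hadd, hsmul]
  have f7 : |K D γ₁| ≤ C * (7 * C ^ 2 * c ^ 2) * C := (hK D hD γ₁ h1).trans (by gcongr)
  have f8 : |K γ₁' γ₁ - H γ₁' γ₁| ≤ c * C * C * C := (hH γ₁' h1' γ₁ h1).trans (by gcongr)
  have f9 : C * c ^ 3 * ‖γ₁‖ ≤ C * c ^ 3 * C := by gcongr
  have f10 : C * c ^ 3 * ‖Γ'‖ ≤ C * c ^ 3 * (4 * C * c) := by gcongr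
  rw [hE Γ' hΓ']
  have key : B Γ' - c ^ 2 * inner ℝ γ₁ γ₁'
      - c ^ 3 * (2 * inner ℝ γ₁ γ₂' + 2 * inner ℝ γ₂ γ₁' - H γ₁' γ₁) =
      (B Γ' - c * inner ℝ γ₁ Γ' - 2 * c ^ 2 * inner ℝ γ₂ Γ') + 2 * c ^ 2 * inner ℝ γ₂ D
      + c * (B' γ₁ - c * inner ℝ γ₁' γ₁ - 2 * c ^ 2 * inner ℝ γ₂' γ₁)
      - c ^ 2 * K D γ₁ - c ^ 3 * (K γ₁' γ₁ - H γ₁' γ₁) := by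
    rw [← f5, f6, f2, real_inner_comm γ₁ Γ', real_inner_comm γ₁' γ₁, real_inner_comm γ₁ γ₂']
    ring
  rw [key]
  have g1 : |2 * c ^ 2 * inner ℝ γ₂ D| ≤ 2 * c ^ 2 * (C * (7 * C ^ 2 * c ^ 2)) := by
    rw [abs_mul, abs_of_nonneg (by positivity)]; gcongr
  have g2 : |c * (B' γ₁ - c * inner ℝ γ₁' γ₁ - 2 * c ^ 2 * inner ℝ γ₂' γ₁)|
      ≤ c * (C * c ^ 3 * C) := by
    rw [abs_mul, abs_of_nonneg hc]
    exact mul_le_mul_of_nonneg_left (f4.trans f9) hc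
  have g3 : |c ^ 2 * K D γ₁| ≤ c ^ 2 * (C * (7 * C ^ 2 * c ^ 2) * C) := by
    rw [abs_mul, abs_of_nonneg (by positivity)]; gcongr
  have g4 : |c ^ 3 * (K γ₁' γ₁ - H γ₁' γ₁)| ≤ c ^ 3 * (c * C * C * C) := by
    rw [abs_mul, abs_of_nonneg (by positivity)]; gcongr
  have C23 : C ^ 2 * c ^ 4 ≤ C ^ 4 * c ^ 4 := by gcongr <;> norm_num
  have C34 : C ^ 3 * c ^ 4 ≤ C ^ 4 * c ^ 4 := by gcongr <;> norm_num
  have g5 := f1.trans f10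
  clear * - g1 g2 g3 g4 g5 C23 C34
  rw [abs_le] at *
  obtain ⟨g1, g1'⟩ := g1
  obtain ⟨g2, g2'⟩ := g2
  obtain ⟨g3, g3'⟩ := g3
  obtain ⟨g4, g4'⟩ := g4
  obtain ⟨g5, g5'⟩ := g5
  constructor
  · linarith
  · linarith

end Perturbation

section Expansion

/-- The derivative of the weights. -/
def weightOne (c δ : ℝ) : Idx → ℝ
  | .inl _ => 0
  | .inr (.inl _) => 0
  | .inr (.inr (.inl _)) => 1 + 2 * c + 4 * c ^ 2
  | .inr (.inr (.inr (.inl _))) => 1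
  | .inr (.inr (.inr (.inr (.inl _)))) => c ^ 2
  | .inr (.inr (.inr (.inr (.inr _)))) => δ * c ^ 2

/-- The second order part of the weights. -/
def weightTwo (c δ : ℝ) : Idx → ℝ
  | .inl _ => 0
  | .inr (.inl _) => 0
  | .inr (.inr (.inl _)) => 2 + 4 * c
  | .inr (.inr (.inr (.inl _))) => 0
  | .inr (.inr (.inr (.inr (.inl _)))) => c
  | .inr (.inr (.inr (.inr (.inr _)))) => δ * c

/-- The third order part of the weights. -/
def weightThree (δ : ℝ) : Idx → ℝ
  | .inl _ => 0
  | .inr (.inl _) => 0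
  | .inr (.inr (.inl _)) => 4
  | .inr (.inr (.inr (.inl _))) => 0
  | .inr (.inr (.inr (.inr (.inl _)))) => 1
  | .inr (.inr (.inr (.inr (.inr _)))) => δ

/-- The sum over `Idx`, block by block. -/
lemma sum_Idx (F : Idx → ℝ) : ∑ k, F k =
    ∑ i, F (.inl i) + (∑ i, F (.inr (.inl i)) + (F (.inr (.inr (.inl ())))
      + (∑ i, F (.inr (.inr (.inr (.inl i))))
        + (∑ i, F (.inr (.inr (.inr (.inr (.inl (.inl i))))))
          + ∑ k, F (.inr (.inr (.inr (.inr (.inl (.inr k))))))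
          + ∑ i, F (.inr (.inr (.inr (.inr (.inr i)))))))) ) := by
  simp only [Fintype.sum_sum_type, Finset.univ_unique, Finset.sum_singleton]

lemma weight_sum (c δ : ℝ) (z : V6) (F : Jet V6 → ℝ) :
    ∑ k, weight c δ k * F (jet z k) = ∑ i, F (jetFst z i) + ∑ i, F (jetSnd z i)
      + (c + 2 * c ^ 2 + 4 * c ^ 3) * F (jetT z) + c * ∑ i, F (jetZ z i)
      + c ^ 3 * (∑ i, F (jetZ z i * jetT z) + ∑ k : Fin 3 × Fin 3, F (jetZ z k.1 * jetZ z k.2))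
      + c ^ 3 * δ * ∑ i, F (jetT z * jetFst z i) := by
  rw [sum_Idx]
  simp only [weight, jet, comp, ← Finset.mul_sum]
  change _ * ∑ i, F (jetFst z i) + (_ * ∑ i, F (jetSnd z i) + (_ * F (jetT z)
    + (c * ∑ i, F (jetZ z i) + (_ * ∑ i, F (jetZ z i * jetT z)
    + _ * ∑ k : Fin 3 × Fin 3, F (jetZ z k.1 * jetZ z k.2) + _ * ∑ i, F (jetT z * jetFst z i))))) = _
  ring

lemma weightOne_sum (c δ : ℝ) (z : V6) (F : Jet V6 → ℝ) :
    ∑ k, weightOne c δ k * F (jet z k) =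
      F (jetT z) + ∑ i, F (jetZ z i) + c * ∑ k, weightTwo c δ k * F (jet z k) := by
  rw [sum_Idx, sum_Idx]
  simp only [weightOne, weightTwo, jet, comp, ← Finset.mul_sum]
  change _ + (_ + (_ * F (jetT z) + (_ * ∑ i, F (jetZ z i) + _))) =
    F (jetT z) + _ + _ * (_ + (_ + (_ * F (jetT z) + (_ * ∑ i, F (jetZ z i) + _))))
  ring

lemma weightTwo_sum (c δ : ℝ) (z : V6) (F : Jet V6 → ℝ) :
    ∑ k, weightTwo c δ k * F (jet z k) =
      2 * F (jetT z) + c * ∑ k, weightThree δ k * F (jet z k) := by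
  rw [sum_Idx, sum_Idx]
  simp only [weightTwo, weightThree, jet, comp, ← Finset.mul_sum]
  change _ + (_ + (_ * F (jetT z) + (_ * ∑ i, F (jetZ z i) + _))) =
    _ * F (jetT z) + _ * (_ + (_ + (_ * F (jetT z) + (_ * ∑ i, F (jetZ z i) + _))))
  ring

lemma weight_sum_eq_weightOne_sum (c δ : ℝ) (z : V6) (F : Jet V6 → ℝ) :
    ∑ k, weight c δ k * F (jet z k) = ∑ i, F (jetFst z i) + ∑ i, F (jetSnd z i)
      + c * ∑ k, weightOne c δ k * F (jet z k) := by
  rw [sum_Idx, sum_Idx]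
  simp only [weight, weightOne, jet, comp, ← Finset.mul_sum]
  change _ * ∑ i, F (jetFst z i) + (_ * ∑ i, F (jetSnd z i) + (_ * F (jetT z)
    + (_ * ∑ i, F (jetZ z i) + _))) = _ + c * (_ + (_ + (_ * F (jetT z) +
    (_ * ∑ i, F (jetZ z i) + _))))
  ring

end Expansion

end

end SecTheta

namespace SecTheta

noncomputable section

section Continuity

/-- A family of Taylor expansions depending continuously on the base point and on the vectors. -/
structure ContJet (J : V6 → Jet V6) : Prop where
  val : Continuous fun z ↦ (J z).val
  d : Continuous fun w : V6 × V6 ↦ (J w.1).d w.2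
  h : Continuous fun w : V6 × V6 × V6 ↦ (J w.1).h w.2.1 w.2.2

namespace ContJet

variable {J K : V6 → Jet V6}

lemma add (hJ : ContJet J) (hK : ContJet K) : ContJet fun z ↦ J z + K z where
  val := hJ.val.add hK.val
  d := hJ.d.add hK.d
  h := hJ.h.add hK.h

lemma sub (hJ : ContJet J) (hK : ContJet K) : ContJet fun z ↦ J z - K z where
  val := hJ.val.sub hK.val
  d := hJ.d.sub hK.d
  h := hJ.h.sub hK.h

lemma mul (hJ : ContJet J) (hK : ContJet K) : ContJet fun z ↦ J z * K z where
  val := hJ.val.mul hK.val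
  d := ((hJ.val.comp continuous_fst).mul hK.d).add ((hK.val.comp continuous_fst).mul hJ.d) |>.congr
    fun w ↦ by simp only [Jet.mul_d, Function.comp, Pi.add_apply, Pi.mul_apply]; ring
  h := by
    have a1 : Continuous fun w : V6 × V6 × V6 ↦ (J w.1).d w.2.1 :=
      hJ.d.comp (continuous_fst.prodMk (continuous_fst.comp continuous_snd))
    have a2 : Continuous fun w : V6 × V6 × V6 ↦ (J w.1).d w.2.2 :=
      hJ.d.comp (continuous_fst.prodMk (continuous_snd.comp continuous_snd))
    have b1 : Continuous fun w : V6 × V6 × V6 ↦ (K w.1).d w.2.1 :=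
      hK.d.comp (continuous_fst.prodMk (continuous_fst.comp continuous_snd))
    have b2 : Continuous fun w : V6 × V6 × V6 ↦ (K w.1).d w.2.2 :=
      hK.d.comp (continuous_fst.prodMk (continuous_snd.comp continuous_snd))
    exact (((hJ.h.mul (hK.val.comp continuous_fst)).add (a1.mul b2)).add (a2.mul b1)).add
      ((hJ.val.comp continuous_fst).mul hK.h)

end ContJet

@[fun_prop]
lemma continuous_dot {X : Type*} [TopologicalSpace X] {f g : X → E3} (hf : Continuous f)
    (hg : Continuous g) : Continuous fun x ↦ dot (f x) (g x) := by
  unfold dot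
  fun_prop

lemma contJet_jetFst (i : Fin 3) : ContJet fun z ↦ jetFst z i where
  val := by simp only [jetFst]; fun_prop
  d := by simp only [jetFst]; fun_prop
  h := by simp only [jetFst]; fun_prop

lemma contJet_jetSnd (i : Fin 3) : ContJet fun z ↦ jetSnd z i where
  val := by simp only [jetSnd]; fun_prop
  d := by simp only [jetSnd]; fun_prop
  h := by simp only [jetSnd]; fun_prop

lemma contJet_jetT : ContJet jetT :=
  (((contJet_jetFst 0).mul (contJet_jetSnd 0)).add
    ((contJet_jetFst 1).mul (contJet_jetSnd 1))).add
    ((contJet_jetFst 2).mul (contJet_jetSnd 2))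

lemma contJet_jetZ (i : Fin 3) : ContJet fun z ↦ jetZ z i := by
  fin_cases i <;>
  exact ((contJet_jetFst _).mul (contJet_jetSnd _)).sub
    ((contJet_jetFst _).mul (contJet_jetSnd _))

lemma contJet_jet (k : Idx) : ContJet fun z ↦ jet z k := by
  rcases k with i | i | i | i | (i | ⟨i, j⟩) | i
  · exact contJet_jetFst i
  · exact contJet_jetSnd i
  · exact contJet_jetT
  · exact contJet_jetZ i
  · exact (contJet_jetZ i).mul contJet_jetT
  · exact (contJet_jetZ i).mul (contJet_jetZ j)
  · exact contJet_jetT.mul (contJet_jetFst i)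

@[fun_prop]
lemma ContJet.continuous_d {J : V6 → Jet V6} (hJ : ContJet J) {X : Type*} [TopologicalSpace X]
    {z u : X → V6} (hz : Continuous z) (hu : Continuous u) :
    Continuous fun x ↦ (J (z x)).d (u x) :=
  hJ.d.comp (hz.prodMk hu)

lemma ContJet.continuous_h {J : V6 → Jet V6} (hJ : ContJet J) {X : Type*} [TopologicalSpace X]
    {z u v : X → V6} (hz : Continuous z) (hu : Continuous u) (hv : Continuous v) :
    Continuous fun x ↦ (J (z x)).h (u x) (v x) :=
  hJ.h.comp (hz.prodMk (hu.prodMk hv))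

lemma ContJet.continuous_curvTerm {J : V6 → Jet V6} (hJ : ContJet J) {X : Type*}
    [TopologicalSpace X] {z u v : X → V6} (hz : Continuous z) (hu : Continuous u)
    (hv : Continuous v) : Continuous fun x ↦ curvTerm (J (z x)) (u x) (v x) :=
  ((hJ.continuous_h hz hu hu).mul (hJ.continuous_h hz hv hv)).sub
    ((hJ.continuous_h hz hu hv).pow 2)

variable {X : Type*} [TopologicalSpace X] {z u v w : X → V6}

lemma continuous_gamOne (hz : Continuous z) (hu : Continuous u) (hv : Continuous v) :
    Continuous fun x ↦ gamOne (z x) (u x) (v x) := by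
  unfold gamOne betaForm
  fun_prop

lemma continuous_gamTwo (hz : Continuous z) (hu : Continuous u) (hv : Continuous v) :
    Continuous fun x ↦ gamTwo (z x) (u x) (v x) := by
  have := contJet_jetT.continuous_h hz hu hv
  unfold gamTwo
  fun_prop

lemma continuous_metricOne (hz : Continuous z) (hu : Continuous u) (hv : Continuous v) :
    Continuous fun x ↦ metricOne (z x) (u x) (v x) :=
  ((contJet_jetT.continuous_d hz hu).mul (contJet_jetT.continuous_d hz hv)).add
    (continuous_finsetSum _ fun i _ ↦
      ((contJet_jetZ i).continuous_d hz hu).mul ((contJet_jetZ i).continuous_d hz hv))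

lemma continuous_det3 {a b c : X → E3} (ha : Continuous a) (hb : Continuous b) (hc : Continuous c) :
    Continuous fun x ↦ det3 (a x) (b x) (c x) := by
  unfold det3
  fun_prop

lemma continuous_areaFst (hz : Continuous z) (hu : Continuous u) (hv : Continuous v) :
    Continuous fun x ↦ areaFst (z x) (u x) (v x) :=
  continuous_det3 (by fun_prop) (by fun_prop) (by fun_prop)

lemma continuous_areaSnd (hz : Continuous z) (hu : Continuous u) (hv : Continuous v) :
    Continuous fun x ↦ areaSnd (z x) (u x) (v x) :=
  continuous_det3 (by fun_prop) (by fun_prop) (by fun_prop)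

lemma continuous_mixFst (hz : Continuous z) (hu : Continuous u) (hv : Continuous v) :
    Continuous fun x ↦ mixFst (z x) (u x) (v x) :=
  (continuous_det3 (by fun_prop) (by fun_prop) (by fun_prop)).sub
    (continuous_det3 (by fun_prop) (by fun_prop) (by fun_prop))

lemma continuous_mixSnd (hz : Continuous z) (hu : Continuous u) (hv : Continuous v) :
    Continuous fun x ↦ mixSnd (z x) (u x) (v x) :=
  (continuous_det3 (by fun_prop) (by fun_prop) (by fun_prop)).sub
    (continuous_det3 (by fun_prop) (by fun_prop) (by fun_prop))

lemma continuous_curvTX (hz : Continuous z) (hu : Continuous u) (hv : Continuous v) :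
    Continuous fun x ↦ curvTX (z x) (u x) (v x) :=
  continuous_finsetSum _ fun i _ ↦ (contJet_jetT.mul (contJet_jetFst i)).continuous_curvTerm hz hu hv

lemma continuous_curvMain (hz : Continuous z) (hu : Continuous u) (hv : Continuous v) :
    Continuous fun x ↦ curvMain (z x) (u x) (v x) := by
  have h1 := contJet_jetT.continuous_curvTerm hz hu hv
  have h2 (i : Fin 3) := ((contJet_jetZ i).mul contJet_jetT).continuous_curvTerm hz hu hv
  have h3 (k : Fin 3 × Fin 3) :=
    ((contJet_jetZ k.1).mul (contJet_jetZ k.2)).continuous_curvTerm hz hu hv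
  have a1 := continuous_gamOne hz hu hu
  have a2 := continuous_gamOne hz hu hv
  have a3 := continuous_gamOne hz hv hv
  have b1 := continuous_gamTwo hz hu hu
  have b2 := continuous_gamTwo hz hu hv
  have b3 := continuous_gamTwo hz hv hv
  have c1 := continuous_metricOne hz a1 a3
  have c2 := continuous_metricOne hz a2 a2
  have d1 := continuous_mixFst hz hu hv
  have d2 := continuous_mixSnd hz hu hv
  unfold curvMain curvThird
  fun_prop

end Continuity

section Bounds

lemma exists_bound_unit {W : Type*} [NormedAddCommGroup W] {f : V6 × V6 × V6 → W}
    (hf : Continuous f) : ∃ C, ∀ z u v, ‖z‖ ≤ 2 → ‖u‖ ≤ 1 → ‖v‖ ≤ 1 → ‖f (z, u, v)‖ ≤ C := by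
  obtain ⟨C, hC⟩ := ((isCompact_closedBall (0 : V6) 2).prod ((isCompact_closedBall (0 : V6) 1).prod
    (isCompact_closedBall (0 : V6) 1))).exists_bound_of_continuousOn hf.continuousOn
  exact ⟨C, fun z u v hz hu hv ↦ hC _ ⟨by simpa using hz, by simpa using hu, by simpa using hv⟩⟩

lemma exists_bound_jet : ∃ C, 1 ≤ C ∧ ∀ k z, ‖z‖ ≤ 2 → (∀ e, |(jet z k).d e| ≤ C * ‖e‖) ∧
    ∀ u v, ‖u‖ ≤ 1 → ‖v‖ ≤ 1 → |(jet z k).h u v| ≤ C := by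
  have key (k : Idx) : ∃ C, 1 ≤ C ∧ ∀ z, ‖z‖ ≤ 2 → (∀ e, |(jet z k).d e| ≤ C * ‖e‖) ∧
      ∀ u v, ‖u‖ ≤ 1 → ‖v‖ ≤ 1 → |(jet z k).h u v| ≤ C := by
    obtain ⟨C, hC⟩ := exists_bound_unit ((contJet_jet k).continuous_d
      (continuous_fst (X := V6) (Y := V6 × V6)) (continuous_fst.comp continuous_snd))
    obtain ⟨C', hC'⟩ := exists_bound_unit (contJet_jet k).h
    refine ⟨max 1 (max C C'), le_max_left _ _, fun z hz ↦ ⟨fun e ↦ ?_, fun u v hu hv ↦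
      (hC' z u v hz hu hv).trans ((le_max_right _ _).trans (le_max_right _ _))⟩⟩
    have hq := (isQuad_jet z k).d_comb
    rcases eq_or_ne e 0 with rfl | he
    · have := hq 0 0 0 0
      simp at this
      simp [this]
    · have h1 := hC z (‖e‖⁻¹ • e) 0 hz (by simp [norm_smul, he]) (by simp)
      have h2 := hq ‖e‖⁻¹ 0 e 0
      simp only [smul_zero, add_zero, zero_mul] at h2
      rw [Function.comp, h2, Real.norm_eq_abs, abs_mul, abs_of_pos (by positivity),
        inv_mul_le_iff₀ (norm_pos_iff.2 he)] at h1
      rw [mul_comm]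
      exact h1.trans (by gcongr; exact (le_max_left _ _).trans (le_max_right _ _))
  choose C hC1 hC using key
  refine ⟨∑ k, C k, ?_, fun k z hz ↦ ?_⟩
  · exact (hC1 (.inl 0)).trans (Finset.single_le_sum (f := C)
      (fun k _ ↦ by linarith [hC1 k]) (Finset.mem_univ _))
  · have hk : C k ≤ ∑ k, C k := Finset.single_le_sum (f := C)
      (fun k _ ↦ by linarith [hC1 k]) (Finset.mem_univ _)
    exact ⟨fun e ↦ ((hC k z hz).1 e).trans (by gcongr), fun u v hu hv ↦
      ((hC k z hz).2 u v hu hv).trans hk⟩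

end Bounds

end

end SecTheta

namespace SecTheta

noncomputable section

section Numerator

/-- The metric, in terms of Taylor expansions. -/
def jetMetric (c δ : ℝ) (z e e' : V6) : ℝ := ∑ k, weight c δ k * ((jet z k).d e * (jet z k).d e')

/-- The second fundamental form paired with the differential, in terms of Taylor expansions. -/
def jetSecond (c δ : ℝ) (z u v e : V6) : ℝ := ∑ k, weight c δ k * ((jet z k).h u v * (jet z k).d e)

/-- `Γ` is the tangential part of the second derivative in the directions `u` and `v`. -/
structure IsGamma (c δ : ℝ) (z u v Γ : V6) : Prop where
  tan : IsTan z Γ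
  eq : ∀ e, IsTan z e → jetMetric c δ z Γ e = jetSecond c δ z u v e

/-- The numerator of the sectional curvature given by the Gauss equation. -/
def jetCurv (c δ : ℝ) (z u v Γ₁₁ Γ₁₂ Γ₂₂ : V6) : ℝ :=
  ∑ k, weight c δ k * curvTerm (jet z k) u v
    - (jetMetric c δ z Γ₁₁ Γ₂₂ - jetMetric c δ z Γ₁₂ Γ₁₂)

/-- The derivative of the metric in the parameter. -/
def jetMetricOne (c δ : ℝ) (z e e' : V6) : ℝ :=
  ∑ k, weightOne c δ k * ((jet z k).d e * (jet z k).d e')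

lemma jetMetric_eq (c δ : ℝ) (z e e' : V6) :
    jetMetric c δ z e e' = inner ℝ e e' + c * jetMetricOne c δ z e e' := by
  rw [jetMetric, weight_sum_eq_weightOne_sum c δ z fun j ↦ j.d e * j.d e', inner_V6, jetMetricOne,
    Fin.sum_univ_three, Fin.sum_univ_three]
  rfl

lemma jetMetricOne_eq (c δ : ℝ) (z e e' : V6) : jetMetricOne c δ z e e' = metricOne z e e'
    + c * ∑ k, weightTwo c δ k * ((jet z k).d e * (jet z k).d e') :=
  weightOne_sum c δ z fun j ↦ j.d e * j.d e'

lemma jetSecond_eq (c δ : ℝ) {z u v e : V6} (hu : IsTan z u) (hv : IsTan z v) (he : IsTan z e) :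
    jetSecond c δ z u v e = c * inner ℝ (gamOne z u v) e + 2 * c ^ 2 * inner ℝ (gamTwo z u v) e
      + c ^ 3 * ∑ k, weightThree δ k * ((jet z k).h u v * (jet z k).d e) := by
  rw [jetSecond, weight_sum_eq_weightOne_sum c δ z fun j ↦ j.h u v * j.d e,
    weightOne_sum c δ z fun j ↦ j.h u v * j.d e, weightTwo_sum c δ z fun j ↦ j.h u v * j.d e,
    inner_gamOne hu hv he, inner_gamTwo he]
  have h1 : ∑ i, (jetFst z i).h u v * (jetFst z i).d e = 0 := by
    trans -dot u.fst v.fst * dot z.fst e.fst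
    · simp only [jetFst, Fin.sum_univ_three, dot]; ring
    · rw [he.1, mul_zero]
  have h2 : ∑ i, (jetSnd z i).h u v * (jetSnd z i).d e = 0 := by
    trans -dot u.snd v.snd * dot z.snd e.snd
    · simp only [jetSnd, Fin.sum_univ_three, dot]; ring
    · rw [he.2, mul_zero]
  rw [h1, h2]
  ring

/-- Tangent vectors as a subspace. -/
def tanSpace (z : V6) : Submodule ℝ V6 where
  carrier := {e | IsTan z e}
  add_mem' := fun {a b} ha hb ↦ by
    constructor
    · rw [WithLp.add_fst, dot_add_right, ha.1, hb.1, add_zero]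
    · rw [WithLp.add_snd, dot_add_right, ha.2, hb.2, add_zero]
  zero_mem' := by constructor <;> simp [dot]
  smul_mem' r a ha := by
    constructor
    · rw [WithLp.smul_fst, dot_smul_right, ha.1, mul_zero]
    · rw [WithLp.smul_snd, dot_smul_right, ha.2, mul_zero]

variable {c δ : ℝ}

lemma weightOne_nonneg (hc : 0 ≤ c) (hδ : 0 ≤ δ) (k : Idx) : 0 ≤ weightOne c δ k := by
  rcases k with i | i | i | i | (i | ⟨i, j⟩) | i <;> simp only [weightOne] <;> positivity

lemma abs_weightOne_le (hc : 0 ≤ c) (hc1 : c ≤ 1) (hδ : 0 ≤ δ) (hδ1 : δ ≤ 1) (k : Idx) :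
    |weightOne c δ k| ≤ 7 := by
  rw [abs_of_nonneg (weightOne_nonneg hc hδ k)]
  have h2 : c ^ 2 ≤ 1 := pow_le_one₀ hc hc1
  have h3 : δ * c ^ 2 ≤ 1 := mul_le_one₀ hδ1 (by positivity) h2
  rcases k with i | i | i | i | (i | ⟨i, j⟩) | i <;> simp only [weightOne] <;> linarith

lemma abs_weightTwo_le (hc : 0 ≤ c) (hc1 : c ≤ 1) (hδ : 0 ≤ δ) (hδ1 : δ ≤ 1) (k : Idx) :
    |weightTwo c δ k| ≤ 7 := by
  have h3 : δ * c ≤ 1 := mul_le_one₀ hδ1 hc hc1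
  have h4 : 0 ≤ δ * c := by positivity
  rcases k with i | i | i | i | (i | ⟨i, j⟩) | i <;> simp only [weightTwo] <;> rw [abs_le] <;>
    constructor <;> linarith

lemma abs_weightThree_le (hδ : 0 ≤ δ) (hδ1 : δ ≤ 1) (k : Idx) : |weightThree δ k| ≤ 7 := by
  rcases k with i | i | i | i | (i | ⟨i, j⟩) | i <;> simp only [weightThree] <;> rw [abs_le] <;>
    constructor <;> linarith

lemma abs_sum_le_card {η f g : Idx → ℝ} {C r s : ℝ} (hη : ∀ k, |η k| ≤ 7) (hf : ∀ k, |f k| ≤ C * r)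
    (hg : ∀ k, |g k| ≤ C * s) (h0 : 0 ≤ C * r) :
    |∑ k, η k * (f k * g k)| ≤ 7 * Fintype.card Idx * C ^ 2 * r * s := by
  refine (Finset.abs_sum_le_sum_abs _ _).trans ?_
  have : ∀ k ∈ Finset.univ, |η k * (f k * g k)| ≤ 7 * ((C * r) * (C * s)) := fun k _ ↦ by
    rw [abs_mul, abs_mul]
    gcongr
    · exact hη k
    · exact hf k
    · exact hg k
  refine (Finset.sum_le_card_nsmul _ _ _ this).trans (le_of_eq ?_)
  rw [nsmul_eq_mul, Finset.card_univ]
  ring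

lemma OrthoFrame.norm_le {z u v : V6} (h : OrthoFrame z u v) : ‖z‖ ≤ 2 ∧ ‖u‖ ≤ 1 ∧ ‖v‖ ≤ 1 := by
  have h1 := h.uu
  have h2 := h.vv
  have h3 : inner ℝ z z = (2 : ℝ) := by rw [inner_V6, h.xx, h.yy]; norm_num
  rw [real_inner_self_eq_norm_sq] at h1 h2 h3
  refine ⟨?_, ?_, ?_⟩ <;> nlinarith [norm_nonneg z, norm_nonneg u, norm_nonneg v]

/-- The products of the tangential parts, up to fourth order. -/
lemma exists_product_bound : ∃ B, ∀ c δ : ℝ, 0 ≤ c → c ≤ 1 → 0 ≤ δ → δ ≤ 1 →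
    ∀ z u v u' v' Γ Γ' : V6, dot z.fst z.fst = 1 → dot z.snd z.snd = 1 → ‖z‖ ≤ 2 →
    IsTan z u → IsTan z v → IsTan z u' → IsTan z v' → ‖u‖ ≤ 1 → ‖v‖ ≤ 1 → ‖u'‖ ≤ 1 → ‖v'‖ ≤ 1 →
    IsGamma c δ z u v Γ → IsGamma c δ z u' v' Γ' →
    |jetMetric c δ z Γ Γ' - c ^ 2 * inner ℝ (gamOne z u v) (gamOne z u' v')
      - c ^ 3 * (2 * inner ℝ (gamOne z u v) (gamTwo z u' v')
        + 2 * inner ℝ (gamTwo z u v) (gamOne z u' v')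
        - metricOne z (gamOne z u' v') (gamOne z u v))| ≤ B * c ^ 4 := by
  obtain ⟨C, hC1, hC⟩ := exists_bound_jet
  obtain ⟨C₁, hC₁⟩ := exists_bound_unit (continuous_gamOne
    (continuous_fst (X := V6) (Y := V6 × V6)) (continuous_fst.comp continuous_snd)
    (continuous_snd.comp continuous_snd))
  obtain ⟨C₂, hC₂⟩ := exists_bound_unit (continuous_gamTwo
    (continuous_fst (X := V6) (Y := V6 × V6)) (continuous_fst.comp continuous_snd)
    (continuous_snd.comp continuous_snd))
  set D := max (7 * Fintype.card Idx * C ^ 2) (max 1 (max C₁ C₂)) with hD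
  have hD0 : 7 * Fintype.card Idx * C ^ 2 ≤ D := le_max_left _ _
  have hD1 : 1 ≤ D := (le_max_left _ _).trans (le_max_right _ _)
  have hD2 : C₁ ≤ D := (le_max_left _ _).trans ((le_max_right _ _).trans (le_max_right _ _))
  have hD3 : C₂ ≤ D := (le_max_right _ _).trans ((le_max_right _ _).trans (le_max_right _ _))
  refine ⟨27 * D ^ 4, fun c δ hc hc1 hδ hδ1 z u v u' v' Γ Γ' hx hy hz hu hv hu' hv' nu nv nu' nv'
    hΓ hΓ' ↦ ?_⟩
  have hB (u v : V6) (hu : IsTan z u) (hv : IsTan z v) (nu : ‖u‖ ≤ 1) (nv : ‖v‖ ≤ 1) :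
      ∀ e ∈ tanSpace z, |jetSecond c δ z u v e - c * inner ℝ (gamOne z u v) e
        - 2 * c ^ 2 * inner ℝ (gamTwo z u v) e| ≤ D * c ^ 3 * ‖e‖ := fun e he ↦ by
    rw [jetSecond_eq c δ hu hv he]
    have h1 := abs_sum_le_card (abs_weightThree_le hδ hδ1)
      (fun k ↦ ((hC k z hz).2 u v nu nv).trans_eq (mul_one C).symm) (fun k ↦ (hC k z hz).1 e)
      (by positivity)
    rw [show ∀ a b s : ℝ, a + b + c ^ 3 * s - a - b = c ^ 3 * s by intros; ring, abs_mul,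
      abs_of_nonneg (by positivity)]
    calc _ ≤ c ^ 3 * (7 * Fintype.card Idx * C ^ 2 * 1 * ‖e‖) := by gcongr
      _ ≤ c ^ 3 * (D * 1 * ‖e‖) := by gcongr
      _ = _ := by ring
  have hq := fun k ↦ (isQuad_jet z k).d_comb
  rw [jetMetric_eq]
  refine product_estimate (tanSpace z) hc hc1 hD1 (K := jetMetricOne c δ z) (H := metricOne z)
    (B := jetSecond c δ z u v) (B' := jetSecond c δ z u' v') ?_ ?_ ?_ ?_ ?_
    (isTan_gamOne u v hx hy hu hv) (isTan_gamOne u' v' hx hy hu' hv') hΓ.tan hΓ'.tan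
    ((hC₁ z u v hz nu nv).trans hD2) ((hC₂ z u v hz nu nv).trans hD3)
    ((hC₁ z u' v' hz nu' nv').trans hD2) ((hC₂ z u' v' hz nu' nv').trans hD3)
    (hB u v hu hv nu nv) (hB u' v' hu' hv' nu' nv') ?_ ?_
  · intro a b e
    have h := fun k ↦ hq k 1 1 a b
    simp only [one_smul, one_mul] at h
    simp only [jetMetricOne, h, ← Finset.sum_add_distrib]
    exact Finset.sum_congr rfl fun k _ ↦ by ring
  · intro r a e
    have h := fun k ↦ hq k r 0 a 0
    simp only [zero_smul, zero_mul, add_zero] at h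
    simp only [jetMetricOne, h, Finset.mul_sum]
    exact Finset.sum_congr rfl fun k _ ↦ by ring
  · exact fun e ↦ Finset.sum_nonneg fun k _ ↦
      mul_nonneg (weightOne_nonneg hc hδ k) (mul_self_nonneg _)
  · intro e _ e' _
    refine (abs_sum_le_card (abs_weightOne_le hc hc1 hδ hδ1) (fun k ↦ (hC k z hz).1 e)
      (fun k ↦ (hC k z hz).1 e') (by positivity)).trans ?_
    gcongr
  · intro e _ e' _
    rw [jetMetricOne_eq, add_sub_cancel_left, abs_mul, abs_of_nonneg hc]
    have := abs_sum_le_card (abs_weightTwo_le hc hc1 hδ hδ1) (fun k ↦ (hC k z hz).1 e)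
      (fun k ↦ (hC k z hz).1 e') (by positivity)
    calc _ ≤ c * (7 * Fintype.card Idx * C ^ 2 * ‖e‖ * ‖e'‖) := by gcongr
      _ ≤ c * (D * ‖e‖ * ‖e'‖) := by gcongr
      _ = _ := by ring
  · exact fun e he ↦ (jetMetric_eq c δ z Γ e).symm.trans (hΓ.eq e he)
  · exact fun e he ↦ (jetMetric_eq c δ z Γ' e).symm.trans (hΓ'.eq e he)

lemma sum_curvTerm_jetFst {z u v : V6} (hx : dot z.fst z.fst = 1) (hy : dot z.snd z.snd = 1)
    (hu : IsTan z u) (hv : IsTan z v) :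
    ∑ i, curvTerm (jetFst z i) u v = areaFst z u v ^ 2 ∧
    ∑ i, curvTerm (jetSnd z i) u v = areaSnd z u v ^ 2 := by
  obtain ⟨g1, g2⟩ := gram_eq_areaFst hx hy hu hv
  rw [← g1, ← g2]
  constructor
  · trans (dot u.fst u.fst * dot v.fst v.fst - dot u.fst v.fst ^ 2) * dot z.fst z.fst
    · simp only [curvTerm, jetFst, Fin.sum_univ_three]
      generalize dot u.fst u.fst = a
      generalize dot v.fst v.fst = b
      generalize dot u.fst v.fst = d
      simp only [dot]
      ring
    · rw [hx, mul_one]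
  · trans (dot u.snd u.snd * dot v.snd v.snd - dot u.snd v.snd ^ 2) * dot z.snd z.snd
    · simp only [curvTerm, jetSnd, Fin.sum_univ_three]
      generalize dot u.snd u.snd = a
      generalize dot v.snd v.snd = b
      generalize dot u.snd v.snd = d
      simp only [dot]
      ring
    · rw [hy, mul_one]

/-- The Taylor polynomial of the curvature numerator. -/
def curvPoly (c δ : ℝ) (z u v : V6) : ℝ :=
  areaFst z u v ^ 2 + areaSnd z u v ^ 2
    + c * (areaFst z u v ^ 2 + areaSnd z u v ^ 2 + 6 * dot z.fst z.snd * areaFst z u v * areaSnd z u v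
      + 2 * areaFst z u v * mixFst z u v + 2 * areaSnd z u v * mixSnd z u v)
    + c ^ 2 * (mixFst z u v ^ 2 + mixSnd z u v ^ 2
        + 2 * dot z.fst z.snd ^ 2 * (areaFst z u v ^ 2 + areaSnd z u v ^ 2)
        + 4 * dot z.fst z.snd * areaFst z u v * areaSnd z u v
        + 4 * dot z.fst z.snd
          * (areaFst z u v * mixSnd z u v + areaSnd z u v * mixFst z u v))
    + c ^ 3 * (curvThird z u v + δ * curvTX z u v)

/-- The expansion of the curvature numerator. -/
lemma exists_jetCurv_bound : ∃ B, 0 ≤ B ∧ ∀ c δ : ℝ, 0 ≤ c → c ≤ 1 → 0 ≤ δ → δ ≤ 1 →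
    ∀ z u v Γ₁₁ Γ₁₂ Γ₂₂ : V6, OrthoFrame z u v →
    IsGamma c δ z u u Γ₁₁ → IsGamma c δ z u v Γ₁₂ → IsGamma c δ z v v Γ₂₂ →
    |jetCurv c δ z u v Γ₁₁ Γ₁₂ Γ₂₂ - curvPoly c δ z u v| ≤ B * c ^ 4 := by
  obtain ⟨B, hB⟩ := exists_product_bound
  refine ⟨2 * |B|, by positivity, fun c δ hc hc1 hδ hδ1 z u v Γ₁₁ Γ₁₂ Γ₂₂ h h11 h12 h22 ↦ ?_⟩
  obtain ⟨nz, nu, nv⟩ := h.norm_le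
  have e1 := hB c δ hc hc1 hδ hδ1 z u u v v Γ₁₁ Γ₂₂ h.xx h.yy nz h.tu h.tu h.tv h.tv nu nu nv nv
    h11 h22
  have e2 := hB c δ hc hc1 hδ hδ1 z u v u v Γ₁₂ Γ₁₂ h.xx h.yy nz h.tu h.tv h.tu h.tv nu nv nu nv
    h12 h12
  have hB4 : B * c ^ 4 ≤ |B| * c ^ 4 := by gcongr; exact le_abs_self B
  obtain ⟨s1, s2⟩ := sum_curvTerm_jetFst h.xx h.yy h.tu h.tv
  have k1 := curvTerm_first h.xx h.yy h.tu h.tv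
  have k2 := curvTerm_second h.xx h.yy h.tu h.tv
  have e3 : jetCurv c δ z u v Γ₁₁ Γ₁₂ Γ₂₂ - curvPoly c δ z u v =
      -(jetMetric c δ z Γ₁₁ Γ₂₂ - c ^ 2 * inner ℝ (gamOne z u u) (gamOne z v v)
      - c ^ 3 * (2 * inner ℝ (gamOne z u u) (gamTwo z v v)
        + 2 * inner ℝ (gamTwo z u u) (gamOne z v v)
        - metricOne z (gamOne z v v) (gamOne z u u)))
      + (jetMetric c δ z Γ₁₂ Γ₁₂ - c ^ 2 * inner ℝ (gamOne z u v) (gamOne z u v)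
      - c ^ 3 * (2 * inner ℝ (gamOne z u v) (gamTwo z u v)
        + 2 * inner ℝ (gamTwo z u v) (gamOne z u v)
        - metricOne z (gamOne z u v) (gamOne z u v))) := by
    rw [jetCurv, weight_sum c δ z fun j ↦ curvTerm j u v, s1, s2, curvPoly, ← k1, ← k2, curvThird,
      curvTX, metricOne_comm z (gamOne z v v), real_inner_comm (gamOne z u v) (gamTwo z u v)]
    ring
  rw [e3]
  rw [abs_le] at *
  constructor <;> linarith [e1.1, e1.2, e2.1, e2.2]

end Numerator

end

end SecTheta

namespace SecTheta

noncomputable section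

section LowerBounds

/-- The Gram determinant of `u, v`. -/
def jetGram (c δ : ℝ) (z u v : V6) : ℝ :=
  jetMetric c δ z u u * jetMetric c δ z v v - jetMetric c δ z u v ^ 2

lemma exists_jetGram_bound : ∃ D, 0 ≤ D ∧ ∀ c δ : ℝ, 0 ≤ c → c ≤ 1 → 0 ≤ δ → δ ≤ 1 →
    ∀ z u v : V6, OrthoFrame z u v →
    1 ≤ jetGram c δ z u v ∧ jetGram c δ z u v ≤ 1 + D * c := by
  obtain ⟨C, hC1, hC⟩ := exists_bound_jet
  set K := 7 * Fintype.card Idx * C ^ 2 with hK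
  have hK0 : 0 ≤ K := by positivity
  refine ⟨2 * K + K ^ 2, by positivity, fun c δ hc hc1 hδ hδ1 z u v h ↦ ?_⟩
  obtain ⟨nz, nu, nv⟩ := h.norm_le
  have b (e : V6) (he : ‖e‖ ≤ 1) : jetMetricOne c δ z e e ≤ K := by
    refine (le_abs_self _).trans ((abs_sum_le_card (abs_weightOne_le hc hc1 hδ hδ1)
      (fun k ↦ (hC k z nz).1 e) (fun k ↦ (hC k z nz).1 e) (by positivity)).trans ?_)
    have : ‖e‖ * ‖e‖ ≤ 1 := mul_le_one₀ he (norm_nonneg _) he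
    calc _ = K * (‖e‖ * ‖e‖) := by ring
      _ ≤ K * 1 := by gcongr
      _ = K := mul_one K
  have p (e : V6) : 0 ≤ jetMetricOne c δ z e e := Finset.sum_nonneg fun k _ ↦
      mul_nonneg (weightOne_nonneg hc hδ k) (mul_self_nonneg _)
  have cs : jetMetricOne c δ z u v ^ 2 ≤ jetMetricOne c δ z u u * jetMetricOne c δ z v v := by
    have := Finset.sum_mul_sq_le_sq_mul_sq Finset.univ
      (fun k ↦ √(weightOne c δ k) * (jet z k).d u) (fun k ↦ √(weightOne c δ k) * (jet z k).d v)
    have s (k : Idx) := Real.mul_self_sqrt (weightOne_nonneg hc hδ k)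
    have e (a b : V6) : jetMetricOne c δ z a b =
        ∑ k, √(weightOne c δ k) * (jet z k).d a * (√(weightOne c δ k) * (jet z k).d b) :=
      Finset.sum_congr rfl fun k _ ↦ by
        linear_combination (-(jet z k).d a * (jet z k).d b) * s k
    simp only [sq] at this ⊢
    rw [e, e, e]
    exact this
  have hb1 := b u nu
  have hb2 := b v nv
  have hp1 := p u
  have hp2 := p v
  rw [jetGram, jetMetric_eq, jetMetric_eq, jetMetric_eq, h.uu, h.vv, h.uv]
  generalize jetMetricOne c δ z u u = x at *
  generalize jetMetricOne c δ z v v = y at *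
  generalize jetMetricOne c δ z u v = w at *
  have c2 : c ^ 2 ≤ c := by nlinarith
  constructor
  · nlinarith [mul_nonneg hc hp1, mul_nonneg hc hp2,
      mul_nonneg (sq_nonneg c) (sub_nonneg.2 cs)]
  · have h1 : c * x ≤ c * K := by gcongr
    have h2 : c * y ≤ c * K := by gcongr
    have h3 : c ^ 2 * (x * y) ≤ c * (K * K) := by gcongr
    nlinarith [sq_nonneg (c * w)]

lemma le_div_of_gram {m N G K e : ℝ} (hm : m ≤ N) (hG : 1 ≤ G) (hG' : G ≤ 1 + e) (hK : |m| ≤ K) :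
    m - K * e ≤ N / G := by
  have hG0 : 0 < G := by linarith
  rw [le_div_iff₀ hG0]
  have h1 := abs_le.1 hK
  have hK0 : 0 ≤ K := (abs_nonneg m).trans hK
  have he : 0 ≤ e := by linarith
  nlinarith [mul_nonneg (mul_nonneg hK0 he) (sub_nonneg.2 hG), mul_nonneg hK0 (sub_nonneg.2 hG'),
    mul_nonneg (sub_nonneg.2 h1.2) (sub_nonneg.2 hG)]

/-- The functions in the expansion of the curvature. -/
def coeffs (w : V6 × V6 × V6) : Fin 11 → ℝ :=
  let z := w.1
  let u := w.2.1
  let v := w.2.2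
  let p := areaFst z u v
  let q := areaSnd z u v
  let l := mixFst z u v
  let m := mixSnd z u v
  let t := dot z.fst z.snd
  ![p ^ 2 + q ^ 2 + 6 * t * p * q + 2 * p * l + 2 * q * m,
    l ^ 2 + m ^ 2 + 2 * t ^ 2 * (p ^ 2 + q ^ 2) + 4 * t * p * q + 4 * t * (p * m + q * l),
    curvThird z u v, curvTX z u v, curvMain z u v, t,
    -2 * l - 2 * t * m + 2 * t ^ 2 * p, 2 * t ^ 2 * l + 4 * t * m,
    -2 * m - 2 * t * l + 2 * t ^ 2 * q + 4 * t * p, 2 * t ^ 2 * m,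
    2 * t ^ 2 * (l ^ 2 + m ^ 2) + 4 * t * l * m]

lemma continuous_curvThird {X : Type*} [TopologicalSpace X] {z u v : X → V6} (hz : Continuous z)
    (hu : Continuous u) (hv : Continuous v) : Continuous fun x ↦ curvThird (z x) (u x) (v x) := by
  have h1 := continuous_curvMain hz hu hv
  have d1 := continuous_mixFst hz hu hv
  have d2 := continuous_mixSnd hz hu hv
  have e : (fun x ↦ curvThird (z x) (u x) (v x)) = fun x ↦ curvMain (z x) (u x) (v x)
      - mixFst (z x) (u x) (v x) ^ 2 - mixSnd (z x) (u x) (v x) ^ 2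
      + 2 * dot (z x).fst (z x).snd * mixFst (z x) (u x) (v x) * mixSnd (z x) (u x) (v x) := by
    funext x
    simp only [curvMain]
    ring
  rw [e]
  fun_prop

lemma continuous_coeffs : Continuous coeffs := by
  have hz : Continuous fun w : V6 × V6 × V6 ↦ w.1 := continuous_fst
  have hu : Continuous fun w : V6 × V6 × V6 ↦ w.2.1 := continuous_fst.comp continuous_snd
  have hv : Continuous fun w : V6 × V6 × V6 ↦ w.2.2 := continuous_snd.comp continuous_snd
  have h1 := continuous_areaFst hz hu hv
  have h2 := continuous_areaSnd hz hu hv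
  have h3 := continuous_mixFst hz hu hv
  have h4 := continuous_mixSnd hz hu hv
  have h5 := continuous_curvMain hz hu hv
  have h6 := continuous_curvTX hz hu hv
  have h7 := continuous_curvThird hz hu hv
  refine continuous_pi fun i ↦ ?_
  fin_cases i <;> simp [coeffs] <;> fun_prop

lemma curvPoly_eq (c δ : ℝ) (z u v : V6) : curvPoly c δ z u v =
    areaFst z u v ^ 2 + areaSnd z u v ^ 2 + c * coeffs (z, u, v) 0 + c ^ 2 * coeffs (z, u, v) 1
      + c ^ 3 * (coeffs (z, u, v) 2 + δ * coeffs (z, u, v) 3) := rfl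

/-- Completing squares in the expansion of the curvature. -/
lemma curvPoly_eq_squares (c δ : ℝ) (z u v : V6) : ∃ r s : ℝ, curvPoly c δ z u v =
    r ^ 2 + s ^ 2 + c * (r ^ 2 + s ^ 2 + 6 * coeffs (z, u, v) 5 * r * s)
      + c ^ 2 * (r * (coeffs (z, u, v) 6 - c * coeffs (z, u, v) 7)
        + s * (coeffs (z, u, v) 8 - c * coeffs (z, u, v) 9))
      + c ^ 3 * (curvMain z u v + δ * curvTX z u v) + c ^ 4 * coeffs (z, u, v) 10 := by
  refine ⟨areaFst z u v + c * mixFst z u v, areaSnd z u v + c * mixSnd z u v, ?_⟩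
  change curvPoly c δ z u v = _ + _ * (_ + _ + 6 * dot z.fst z.snd * _ * _)
    + _ * (_ * (-2 * mixFst z u v - 2 * dot z.fst z.snd * mixSnd z u v
      + 2 * dot z.fst z.snd ^ 2 * areaFst z u v
      - c * (2 * dot z.fst z.snd ^ 2 * mixFst z u v + 4 * dot z.fst z.snd * mixSnd z u v))
      + _ * (-2 * mixSnd z u v - 2 * dot z.fst z.snd * mixFst z u v
        + 2 * dot z.fst z.snd ^ 2 * areaSnd z u v + 4 * dot z.fst z.snd * areaFst z u v
        - c * (2 * dot z.fst z.snd ^ 2 * mixSnd z u v))) + _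
    + c ^ 4 * (2 * dot z.fst z.snd ^ 2 * (mixFst z u v ^ 2 + mixSnd z u v ^ 2)
      + 4 * dot z.fst z.snd * mixFst z u v * mixSnd z u v)
  simp only [curvPoly, curvMain]
  ring

lemma completed_squares {c K t r s S T : ℝ} (hc : 0 ≤ c) (hcK : c * (6 * K) ≤ 1) (ht : |t| ≤ K)
    (hS : S ^ 2 ≤ (2 * K) ^ 2) (hT : T ^ 2 ≤ (2 * K) ^ 2) :
    -(4 * K ^ 2 * c ^ 4) ≤
      r ^ 2 + s ^ 2 + c * (r ^ 2 + s ^ 2 + 6 * t * r * s) + c ^ 2 * (r * S + s * T) := by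
  have q1 : |c * (6 * t * r * s)| ≤ (1 / 2) * (r ^ 2 + s ^ 2) := by
    rw [show c * (6 * t * r * s) = (c * 6 * t) * (r * s) by ring, abs_mul, abs_mul,
      abs_of_nonneg (by positivity : 0 ≤ c * 6)]
    have i1 : c * 6 * |t| ≤ 1 := (mul_le_mul_of_nonneg_left ht (by positivity)).trans (by linarith)
    have i2 : |r * s| ≤ (1 / 2) * (r ^ 2 + s ^ 2) := by
      have e1 := sq_nonneg (r + s)
      have e2 := sq_nonneg (r - s)
      rw [abs_le]
      constructor <;> linarith
    calc _ ≤ 1 * |r * s| := by gcongr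
      _ ≤ _ := by linarith
  have q1' := (abs_le.1 q1).1
  have q2 := sq_nonneg (r + c ^ 2 * S)
  have q3 := sq_nonneg (s + c ^ 2 * T)
  have q4 := mul_le_mul_of_nonneg_left hS (pow_nonneg hc 4)
  have q5 := mul_le_mul_of_nonneg_left hT (pow_nonneg hc 4)
  have q6 : 0 ≤ c * (r ^ 2 + s ^ 2) := by positivity
  linarith

/-- Lower bounds for the sectional curvature. -/
theorem exists_curvature_bounds : ∃ B c₀, 0 < c₀ ∧ 0 ≤ B ∧ ∀ c δ : ℝ, 0 ≤ c → c ≤ c₀ → 0 ≤ δ → δ ≤ 1 →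
    ∀ z u v Γ₁₁ Γ₁₂ Γ₂₂ : V6, OrthoFrame z u v →
    IsGamma c δ z u u Γ₁₁ → IsGamma c δ z u v Γ₁₂ → IsGamma c δ z v v Γ₂₂ →
    c ^ 3 * (curvMain z u v + δ * curvTX z u v) - B * c ^ 4
      ≤ jetCurv c δ z u v Γ₁₁ Γ₁₂ Γ₂₂ / jetGram c δ z u v ∧
    areaFst z u v ^ 2 + areaSnd z u v ^ 2 - B * c
      ≤ jetCurv c δ z u v Γ₁₁ Γ₁₂ Γ₂₂ / jetGram c δ z u v := by
  obtain ⟨B, hB0, hB⟩ := exists_jetCurv_bound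
  obtain ⟨D, hD0, hD⟩ := exists_jetGram_bound
  obtain ⟨K', hK'⟩ := exists_bound_unit continuous_coeffs
  obtain ⟨A, hA⟩ := exists_bound_unit (((continuous_areaFst (continuous_fst (X := V6) (Y := V6 × V6))
    (continuous_fst.comp continuous_snd) (continuous_snd.comp continuous_snd)).pow 2).add
    ((continuous_areaSnd (continuous_fst (X := V6) (Y := V6 × V6))
    (continuous_fst.comp continuous_snd) (continuous_snd.comp continuous_snd)).pow 2))
  set K := max 1 K' with hK
  have hK1 : 1 ≤ K := le_max_left _ _
  set B₁ := B + K + 4 * K ^ 2 with hB₁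
  set B₂ := B + 4 * K with hB₂
  refine ⟨max (B₁ + (2 * K + B₁) * D) (B₂ + (|A| + B₂) * D), min 1 (1 / (6 * K)), by positivity,
    le_max_of_le_left (by positivity), ?_⟩
  intro c δ hc hcc hδ hδ1 z u v Γ₁₁ Γ₁₂ Γ₂₂ h h11 h12 h22
  have hc1 : c ≤ 1 := hcc.trans (min_le_left _ _)
  have hcK : c * (6 * K) ≤ 1 := by
    rw [← le_div_iff₀ (by positivity)]
    exact hcc.trans (min_le_right _ _)
  obtain ⟨nz, nu, nv⟩ := h.norm_le
  have hk (i : Fin 11) : |coeffs (z, u, v) i| ≤ K :=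
    ((norm_le_pi_norm (coeffs (z, u, v)) i).trans (hK' z u v nz nu nv)).trans (le_max_right _ _)
  have hN := (abs_le.1 (hB c δ hc hc1 hδ hδ1 z u v Γ₁₁ Γ₁₂ Γ₂₂ h h11 h12 h22)).1
  obtain ⟨hG, hG'⟩ := hD c δ hc hc1 hδ hδ1 z u v h
  have c2 : c ^ 2 ≤ c := by nlinarith
  have c3 : c ^ 3 ≤ c ^ 2 := by nlinarith [sq_nonneg c]
  have c4 : c ^ 4 ≤ c ^ 3 := by nlinarith [pow_nonneg hc 3]
  set N := jetCurv c δ z u v Γ₁₁ Γ₁₂ Γ₂₂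
  set G := jetGram c δ z u v
  have hQ : |curvMain z u v + δ * curvTX z u v| ≤ 2 * K := by
    have h4 : |curvMain z u v| ≤ K := hk 4
    have h3 : |δ * curvTX z u v| ≤ 1 * K := by
      rw [abs_mul, abs_of_nonneg hδ]
      exact mul_le_mul hδ1 (hk 3) (abs_nonneg _) (by norm_num)
    refine (abs_add_le _ _).trans (by linarith)
  constructor
  · have hm : c ^ 3 * (curvMain z u v + δ * curvTX z u v) - B₁ * c ^ 4 ≤ N := by
      obtain ⟨r, s, hrs⟩ := curvPoly_eq_squares c δ z u v
      have bound (a b : Fin 11) : (coeffs (z, u, v) a - c * coeffs (z, u, v) b) ^ 2 ≤ (2 * K) ^ 2 := by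
        rw [sq_le_sq, abs_of_nonneg (a := 2 * K) (by positivity)]
        refine (abs_sub _ _).trans ?_
        rw [abs_mul, abs_of_nonneg hc]
        have := mul_le_mul hc1 (hk b) (abs_nonneg _) zero_le_one
        linarith [hk a]
      have b1 := bound 6 7
      have b2 := bound 8 9
      generalize coeffs (z, u, v) 6 - c * coeffs (z, u, v) 7 = S at *
      generalize coeffs (z, u, v) 8 - c * coeffs (z, u, v) 9 = T at *
      have h10 := (abs_le.1 (hk 10)).1
      have h5 := hk 5
      generalize coeffs (z, u, v) 10 = S₃ at *
      generalize coeffs (z, u, v) 5 = t at *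
      have q1 := completed_squares hc hcK h5 b1 b2 (r := r) (s := s)
      have q4 : c ^ 4 * S₃ ≥ c ^ 4 * (-K) := by gcongr
      rw [hB₁]
      linarith
    have hmK : |c ^ 3 * (curvMain z u v + δ * curvTX z u v) - B₁ * c ^ 4| ≤
        c ^ 3 * (2 * K + B₁) := by
      refine (abs_sub _ _).trans ?_
      rw [abs_mul, abs_of_nonneg (by positivity : 0 ≤ c ^ 3),
        abs_of_nonneg (by positivity : 0 ≤ B₁ * c ^ 4)]
      have : B₁ * c ^ 4 ≤ B₁ * c ^ 3 := by gcongr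
      have := mul_le_mul_of_nonneg_left hQ (pow_nonneg hc 3)
      linarith
    refine le_trans ?_ (le_div_of_gram hm hG hG' hmK)
    have := mul_le_mul_of_nonneg_right
      (le_max_left (B₁ + (2 * K + B₁) * D) (B₂ + (|A| + B₂) * D)) (pow_nonneg hc 4)
    linarith
  · have hm : areaFst z u v ^ 2 + areaSnd z u v ^ 2 - B₂ * c ≤ N := by
      rw [curvPoly_eq] at hN
      have k0 : c * coeffs (z, u, v) 0 ≥ c * (-K) := by gcongr; exact (abs_le.1 (hk 0)).1
      have k1 : c ^ 2 * coeffs (z, u, v) 1 ≥ c ^ 2 * (-K) := by gcongr; exact (abs_le.1 (hk 1)).1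
      have k2 : c ^ 3 * coeffs (z, u, v) 2 ≥ c ^ 3 * (-K) := by gcongr; exact (abs_le.1 (hk 2)).1
      have k3 : c ^ 3 * (δ * coeffs (z, u, v) 3) ≥ c ^ 3 * (-K) := by
        gcongr
        have := mul_le_mul hδ1 (hk 3) (abs_nonneg _) zero_le_one
        have : |δ * coeffs (z, u, v) 3| ≤ K := by
          rw [abs_mul, abs_of_nonneg hδ]
          linarith
        exact (abs_le.1 this).1
      have j1 : c ^ 2 * K ≤ c * K := by gcongr
      have j2 : c ^ 3 * K ≤ c * K := by gcongr; linarith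
      have j3 : B * c ^ 4 ≤ B * c := by gcongr; linarith
      rw [hB₂]
      linarith
    have hmK : |areaFst z u v ^ 2 + areaSnd z u v ^ 2 - B₂ * c| ≤ |A| + B₂ := by
      refine (abs_sub _ _).trans ?_
      have h1 : |areaFst z u v ^ 2 + areaSnd z u v ^ 2| ≤ |A| :=
        (hA z u v nz nu nv).trans (le_abs_self A)
      have h2 : |B₂ * c| ≤ B₂ := by
        rw [abs_of_nonneg (by positivity)]
        exact mul_le_of_le_one_right (by positivity) hc1
      linarith
    refine le_trans ?_ (le_div_of_gram hm hG hG' hmK)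
    have := mul_le_mul_of_nonneg_right
      (le_max_right (B₁ + (2 * K + B₁) * D) (B₂ + (|A| + B₂) * D)) hc
    linarith

end LowerBounds

end

end SecTheta

namespace SecTheta

noncomputable section

section Parameters

/-- `s` is the sectional curvature, as given by the Gauss equation. -/
def IsSec (c δ : ℝ) (z u v : V6) (s : ℝ) : Prop :=
  ∃ Γ₁₁ Γ₁₂ Γ₂₂, IsGamma c δ z u u Γ₁₁ ∧ IsGamma c δ z u v Γ₁₂ ∧ IsGamma c δ z v v Γ₂₂ ∧
    s = jetCurv c δ z u v Γ₁₁ Γ₁₂ Γ₂₂ / jetGram c δ z u v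

lemma exists_pos_le_or_le {X : Type*} [TopologicalSpace X] {K : Set X} (hK : IsCompact K)
    {f g : X → ℝ} (hf : Continuous f) (hg : Continuous g) (h : ∀ x ∈ K, 0 ≤ f x)
    (h0 : ∀ x ∈ K, f x = 0 → 0 < g x) : ∃ η > 0, ∀ x ∈ K, η ≤ f x ∨ η ≤ g x := by
  rcases K.eq_empty_or_nonempty with rfl | hne
  · exact ⟨1, one_pos, by simp⟩
  · obtain ⟨x₀, hx₀, hmin⟩ := hK.exists_isMinOn hne (hf.max hg).continuousOn
    refine ⟨max (f x₀) (g x₀), ?_, fun x hx ↦ le_max_iff.1 (hmin hx)⟩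
    rcases (h x₀ hx₀).eq_or_lt' with h1 | h1
    · exact lt_max_of_lt_right (h0 x₀ hx₀ h1)
    · exact lt_max_of_lt_left h1

/-- Orthonormal frames of planes. -/
def frameSet : Set (V6 × V6 × V6) := {w | OrthoFrame w.1 w.2.1 w.2.2}

/-- On a compact set of pairs of distinct planes, the sum of the sectional curvatures is positive
for suitable parameters. -/
theorem exists_parameters {K : Set ((V6 × V6 × V6) × (V6 × V6 × V6))} (hK : IsCompact K)
    (hf : ∀ w ∈ K, w.1 ∈ frameSet ∧ w.2 ∈ frameSet) (hb : ∀ w ∈ K, w.1.1 = w.2.1)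
    (hne : ∀ w ∈ K, Submodule.span ℝ {w.1.2.1, w.1.2.2} ≠ Submodule.span ℝ {w.2.2.1, w.2.2.2}) :
    ∃ δ, 0 ≤ δ ∧ δ ≤ 1 ∧ ∃ c₁ > 0, ∀ c, 0 < c → c < c₁ → ∀ w ∈ K, ∀ s s',
      IsSec c δ w.1.1 w.1.2.1 w.1.2.2 s → IsSec c δ w.2.1 w.2.2.1 w.2.2.2 s' → 0 < s + s' := by
  obtain ⟨B, c₀, hc₀, hB0, hB⟩ := exists_curvature_bounds
  let X := (V6 × V6 × V6) × (V6 × V6 × V6)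
  have z1 : Continuous fun w : X ↦ w.1.1 := by fun_prop
  have u1 : Continuous fun w : X ↦ w.1.2.1 := by fun_prop
  have v1 : Continuous fun w : X ↦ w.1.2.2 := by fun_prop
  have z2 : Continuous fun w : X ↦ w.2.1 := by fun_prop
  have u2 : Continuous fun w : X ↦ w.2.2.1 := by fun_prop
  have v2 : Continuous fun w : X ↦ w.2.2.2 := by fun_prop
  let φ : X → ℝ := fun w ↦
    (areaFst w.1.1 w.1.2.1 w.1.2.2 ^ 2 + areaSnd w.1.1 w.1.2.1 w.1.2.2 ^ 2)
      + (areaFst w.2.1 w.2.2.1 w.2.2.2 ^ 2 + areaSnd w.2.1 w.2.2.1 w.2.2.2 ^ 2)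
  let ψ : X → ℝ := fun w ↦ curvMain w.1.1 w.1.2.1 w.1.2.2 + curvMain w.2.1 w.2.2.1 w.2.2.2
  let χ : X → ℝ := fun w ↦ curvTX w.1.1 w.1.2.1 w.1.2.2 + curvTX w.2.1 w.2.2.1 w.2.2.2
  have hφ : Continuous φ :=
    (((continuous_areaFst z1 u1 v1).pow 2).add ((continuous_areaSnd z1 u1 v1).pow 2)).add
      (((continuous_areaFst z2 u2 v2).pow 2).add ((continuous_areaSnd z2 u2 v2).pow 2))
  have hψ : Continuous ψ := (continuous_curvMain z1 u1 v1).add (continuous_curvMain z2 u2 v2)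
  have hχ : Continuous χ := (continuous_curvTX z1 u1 v1).add (continuous_curvTX z2 u2 v2)
  have hφ0 (w : X) : 0 ≤ φ w := by positivity
  have flat (w : X) (h : φ w = 0) : areaFst w.1.1 w.1.2.1 w.1.2.2 = 0 ∧
      areaSnd w.1.1 w.1.2.1 w.1.2.2 = 0 ∧ areaFst w.2.1 w.2.2.1 w.2.2.2 = 0 ∧
      areaSnd w.2.1 w.2.2.1 w.2.2.2 = 0 := by
    simp only [φ] at h
    refine ⟨?_, ?_, ?_, ?_⟩ <;> nlinarith
  have hK0 : IsCompact (K ∩ {w | φ w = 0}) := hK.inter_right (isClosed_eq hφ continuous_const)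
  obtain ⟨η, hη, hd⟩ := exists_pos_le_or_le hK0 hψ hχ
    (by
      rintro w ⟨hw, h0⟩
      obtain ⟨k1, k2, k3, k4⟩ := flat w h0
      exact add_nonneg (OrthoFrame.curvMain_nonneg (hf w hw).1 k1 k2)
        (OrthoFrame.curvMain_nonneg (hf w hw).2 k3 k4))
    (by
      rintro w ⟨hw, h0⟩ hw0
      obtain ⟨k1, k2, k3, k4⟩ := flat w h0
      have o1 := OrthoFrame.curvMain_nonneg (hf w hw).1 k1 k2
      have o2 := OrthoFrame.curvMain_nonneg (hf w hw).2 k3 k4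
      have f1 : OrthoFrame w.1.1 w.1.2.1 w.1.2.2 := (hf w hw).1
      have f2 : OrthoFrame w.2.1 w.2.2.1 w.2.2.2 := (hf w hw).2
      simp only [ψ] at hw0
      have p1 : curvMain w.1.1 w.1.2.1 w.1.2.2 = 0 := by linarith
      have p2 : curvMain w.2.1 w.2.2.1 w.2.2.2 = 0 := by linarith
      simp only [χ]
      rw [← hb w hw] at f2 k3 k4 p2 ⊢
      have := f1.rigidity f2 k1 k2 k3 k4 p1 p2 (hne w hw)
      exact add_pos this.1 this.2)
  obtain ⟨A, hA⟩ := hK.exists_bound_of_continuousOn hχ.continuousOn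
  set δ := min 1 (η / (2 * (|A| + 1))) with hδ
  have hδ0 : 0 < δ := by positivity
  have hδ1 : δ ≤ 1 := min_le_left _ _
  have hδA : δ * (|A| + 1) ≤ η / 2 := by
    have : δ ≤ η / (2 * (|A| + 1)) := min_le_right _ _
    rw [le_div_iff₀ (by positivity)] at this
    linarith
  obtain ⟨ε, hε, hd'⟩ := exists_pos_le_or_le hK hφ (g := fun w ↦ ψ w + δ * χ w)
    (hψ.add (hχ.const_mul δ))
    (fun w _ ↦ hφ0 w)
    (by
      intro w hw h0
      obtain ⟨k1, k2, k3, k4⟩ := flat w h0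
      have hψ0 : 0 ≤ ψ w := add_nonneg (OrthoFrame.curvMain_nonneg (hf w hw).1 k1 k2)
        (OrthoFrame.curvMain_nonneg (hf w hw).2 k3 k4)
      rcases hd w ⟨hw, h0⟩ with h | h
      · have h1 := (abs_le.1 ((hA w hw).trans (le_abs_self A))).1
        have h2 : δ * χ w ≥ δ * (-|A|) := by gcongr
        linarith
      · have : 0 < δ * χ w := mul_pos hδ0 (hη.trans_le h)
        linarith)
  refine ⟨δ, hδ0.le, hδ1, min c₀ (ε / (2 * B + 1)), by positivity, ?_⟩
  rintro c hc hcc w hw s s' ⟨Γ₁, Γ₂, Γ₃, g1, g2, g3, rfl⟩ ⟨Γ₁', Γ₂', Γ₃', g1', g2', g3', rfl⟩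
  have hc1 : c ≤ c₀ := hcc.le.trans (min_le_left _ _)
  have hcε : 2 * B * c < ε := by
    have := hcc.trans_le (min_le_right _ _)
    rw [lt_div_iff₀ (by positivity)] at this
    linarith
  obtain ⟨A1, A2⟩ := hB c δ hc.le hc1 hδ0.le hδ1 _ _ _ _ _ _ (hf w hw).1 g1 g2 g3
  obtain ⟨A1', A2'⟩ := hB c δ hc.le hc1 hδ0.le hδ1 _ _ _ _ _ _ (hf w hw).2 g1' g2' g3'
  rcases hd' w hw with h | h
  · simp only [φ] at h
    linarith
  · simp only [ψ, χ] at h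
    have h3 : 0 < c ^ 3 := by positivity
    have := mul_le_mul_of_nonneg_left h h3.le
    have := mul_lt_mul_of_pos_left hcε h3
    linarith

end Parameters

end

end SecTheta

namespace SecTheta

noncomputable section

section SphereCharts

/-- The Euclidean plane. -/
abbrev E2 : Type := EuclideanSpace ℝ (Fin 2)

instance instFactFinrankE3 : Fact (finrank ℝ E3 = 2 + 1) := ⟨finrank_euclideanSpace_fin⟩

/-- The isometry from the model space onto the tangent plane of the sphere at `x` with which the
chart at `x` is defined. -/
def sphereIso (x : S2) : (ℝ ∙ ((-x : S2) : E3))ᗮ ≃ₗᵢ[ℝ] E2 :=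
  (OrthonormalBasis.fromOrthogonalSpanSingleton 2 (ne_zero_of_mem_unit_sphere (-x))).repr

/-- The isometric embedding of the model space onto the tangent plane of the sphere at `x`. -/
def sphereFrame (x : S2) : E2 →L[ℝ] E3 :=
  (ℝ ∙ ((-x : S2) : E3))ᗮ.subtypeL ∘L
    ((sphereIso x).symm.toContinuousLinearEquiv : E2 →L[ℝ] (ℝ ∙ ((-x : S2) : E3))ᗮ)

lemma sphereFrame_apply (x : S2) (w : E2) : sphereFrame x w = ((sphereIso x).symm w : E3) := rfl

lemma inner_sphereFrame (x : S2) (v w : E2) :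
    inner ℝ (sphereFrame x v) (sphereFrame x w) = inner ℝ v w := by
  rw [sphereFrame_apply, sphereFrame_apply, ← Submodule.coe_inner, LinearIsometryEquiv.inner_map_map]

lemma norm_sphereFrame (x : S2) (v : E2) : ‖sphereFrame x v‖ = ‖v‖ := by
  rw [sphereFrame_apply, ← Submodule.coe_norm, LinearIsometryEquiv.norm_map]

lemma dot_sphereFrame (x : S2) (w : E2) : dot (x : E3) (sphereFrame x w) = 0 := by
  have h := Submodule.mem_orthogonal_singleton_iff_inner_right.1 ((sphereIso x).symm w).2
  rw [← inner_eq_dot, sphereFrame_apply]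
  simpa using h

lemma exists_sphereFrame_eq (x : S2) {a : E3} (h : dot (x : E3) a = 0) :
    ∃ w, sphereFrame x w = a := by
  have ha : a ∈ (ℝ ∙ ((-x : S2) : E3))ᗮ := by
    rw [Submodule.mem_orthogonal_singleton_iff_inner_right]
    simpa [inner_eq_dot] using h
  exact ⟨sphereIso x ⟨a, ha⟩, by rw [sphereFrame_apply, LinearIsometryEquiv.symm_apply_apply]⟩

/-- The inverse of the chart at `x`, as a map to `ℝ³`. -/
def sphereParam (x : S2) (w : E2) : E3 := ((chartAt E2 x).symm w : E3)

lemma sphereParam_eq (x : S2) (w : E2) : sphereParam x w =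
    (‖w‖ ^ 2 + 4)⁻¹ • ((4 : ℝ) • sphereFrame x w + (4 - ‖w‖ ^ 2) • (x : E3)) := by
  have h := stereographic'_symm_apply (n := 2) (-x) w
  change sphereParam x w = _ at h
  rw [h]
  have e : ‖((sphereIso x).symm w : E3)‖ = ‖w‖ := norm_sphereFrame x w
  change (‖((sphereIso x).symm w : E3)‖ ^ 2 + 4)⁻¹ • (4 : ℝ) • sphereFrame x w
    + (‖((sphereIso x).symm w : E3)‖ ^ 2 + 4)⁻¹ • (‖((sphereIso x).symm w : E3)‖ ^ 2 - 4)
      • ((-x : S2) : E3) = _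
  rw [e]
  simp only [coe_neg_sphere]
  module

lemma contDiff_sphereParam (x : S2) : ContDiff ℝ ∞ (sphereParam x) := by
  have : sphereParam x = fun w ↦
      (‖w‖ ^ 2 + 4)⁻¹ • ((4 : ℝ) • sphereFrame x w + (4 - ‖w‖ ^ 2) • (x : E3)) :=
    funext (sphereParam_eq x)
  rw [this]
  have h0 : ContDiff ℝ ∞ fun w : E2 ↦ ‖w‖ ^ 2 := contDiff_norm_sq ℝ
  have h1 : ContDiff ℝ ∞ fun w : E2 ↦ (‖w‖ ^ 2 + 4)⁻¹ :=
    (h0.add contDiff_const).inv fun w ↦ by positivity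
  refine h1.smul ?_
  have h2 : ContDiff ℝ ∞ fun w : E2 ↦ (4 : ℝ) - ‖w‖ ^ 2 := contDiff_const.sub h0
  exact ((sphereFrame x).contDiff.const_smul (4 : ℝ)).add (h2.smul contDiff_const)

lemma chartAt_sphere_target (x : S2) : (chartAt E2 x).target = univ := stereographic'_target (-x)

lemma chartAt_sphere_self (x : S2) : chartAt E2 x x = 0 := by
  change sphereIso x (stereographic (norm_eq_of_mem_sphere (-x)) x) = 0
  rw [stereographic_neg_apply, map_zero]

end SphereCharts

section ChartJets

variable {E : Type*} [NormedAddCommGroup E] [NormedSpace ℝ E] {V : Type*}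

lemma HasJet.transport {f : E → ℝ} {x : E} {j : Jet E} (h : HasJet id x f j) {A : E → V} {k : Jet V}
    (hv : j.val = k.val) (hd : ∀ u, j.d u = k.d (A u)) (hh : ∀ u v, j.h u v = k.h (A u) (A v)) :
    HasJet A x f k :=
  ⟨h.contDiff, h.val.trans hv, fun u ↦ (h.d u).trans (hd u), fun u v ↦ (h.h u v).trans (hh u v)⟩

/-- The Taylor expansion of the components of the inverse of the stereographic projection. -/
lemma hasJet_of_stereographic {f : E → ℝ} (hf : ContDiff ℝ ∞ f) (L₀ L₁ K : E →L[ℝ] ℝ) (r : ℝ)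
    (h : ∀ w, f w * (L₀ w * L₀ w + L₁ w * L₁ w + 4) =
      4 * K w + (4 - (L₀ w * L₀ w + L₁ w * L₁ w)) * r) :
    HasJet id 0 f ⟨r, K, fun u v ↦ -(L₀ u * L₀ v + L₁ u * L₁ v) * r⟩ := by
  have l (L : E →L[ℝ] ℝ) : HasJet id 0 (fun w ↦ L w) ⟨L 0, L, fun _ _ ↦ 0⟩ :=
    HasJet.of_linear L fun u ↦ rfl
  have c (s : ℝ) : HasJet (id : E → E) 0 (fun _ ↦ s) ⟨s, fun _ ↦ 0, fun _ _ ↦ 0⟩ := HasJet.const s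
  have n := ((l L₀).mul (l L₀)).add ((l L₁).mul (l L₁))
  have f0 : HasJet id 0 f ⟨f 0, fderiv ℝ f 0, fun u v ↦ fderiv ℝ (fderiv ℝ f) 0 u v⟩ :=
    ⟨hf, rfl, fun _ ↦ rfl, fun _ _ ↦ rfl⟩
  have k1 := f0.mul (n.add (c 4))
  have k2 := ((c 4).mul (l K)).add (((c 4).sub n).mul (c r))
  have he : (fun w ↦ f w * (L₀ w * L₀ w + L₁ w * L₁ w + 4)) =
      fun w ↦ 4 * K w + (4 - (L₀ w * L₀ w + L₁ w * L₁ w)) * r := funext h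
  rw [he] at k1
  have v0 := h 0
  simp only [map_zero] at v0
  have v1 : f 0 = r := by linarith
  refine f0.congr_jet v1 (fun u ↦ ?_) fun u v ↦ ?_
  · have := (k1.d u).symm.trans (k2.d u)
    simp at this
    change fderiv ℝ f 0 u = K u
    linarith
  · have := (k1.h u v).symm.trans (k2.h u v)
    simp [v1] at this
    simp
    linarith

/-- The embedding of the model space as tangent space of `S² × S²` at `p`. -/
def prodFrame (p : S2 × S2) (w : E2 × E2) : V6 :=
  WithLp.toLp 2 (sphereFrame p.1 w.1, sphereFrame p.2 w.2)

lemma isTan_prodFrame (p : S2 × S2) (w : E2 × E2) : IsTan (prodEmb p) (prodFrame p w) :=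
  ⟨dot_sphereFrame p.1 w.1, dot_sphereFrame p.2 w.2⟩

lemma exists_prodFrame_eq (p : S2 × S2) {e : V6} (he : IsTan (prodEmb p) e) :
    ∃ w, prodFrame p w = e := by
  obtain ⟨w₁, h1⟩ := exists_sphereFrame_eq p.1 he.1
  obtain ⟨w₂, h2⟩ := exists_sphereFrame_eq p.2 he.2
  exact ⟨(w₁, w₂), WithLp.ofLp_injective _ (Prod.ext h1 h2)⟩

lemma norm_sq_E2 (w : E2) : ‖w‖ ^ 2 = w 0 * w 0 + w 1 * w 1 := by
  rw [EuclideanSpace.norm_sq_eq, Fin.sum_univ_two]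
  simp [sq]

lemma dot_sphereFrame_sphereFrame (x : S2) (v w : E2) :
    dot (sphereFrame x v) (sphereFrame x w) = v 0 * w 0 + v 1 * w 1 := by
  rw [← inner_eq_dot, inner_sphereFrame]
  simp [PiLp.inner_apply, Fin.sum_univ_two, mul_comm]

lemma sphereParam_mul (x : S2) (w : E2) (i : Fin 3) :
    sphereParam x w i * (w 0 * w 0 + w 1 * w 1 + 4) =
      4 * sphereFrame x w i + (4 - (w 0 * w 0 + w 1 * w 1)) * (x : E3) i := by
  rw [sphereParam_eq, ← norm_sq_E2]
  have : ‖w‖ ^ 2 + 4 ≠ 0 := by positivity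
  simp only [PiLp.smul_apply, PiLp.add_apply, smul_eq_mul]
  field_simp

lemma hasJet_fst (p : S2 × S2) (i : Fin 3) :
    HasJet (prodFrame p) 0 (fun w : E2 × E2 ↦ sphereParam p.1 w.1 i) (jetFst (prodEmb p) i) := by
  let L (j : Fin 2) : E2 × E2 →L[ℝ] ℝ :=
    (EuclideanSpace.proj j : E2 →L[ℝ] ℝ) ∘L ContinuousLinearMap.fst ℝ E2 E2
  refine (hasJet_of_stereographic (f := fun w : E2 × E2 ↦ sphereParam p.1 w.1 i) ?_ (L 0) (L 1)
    ((EuclideanSpace.proj i : E3 →L[ℝ] ℝ) ∘L sphereFrame p.1 ∘L ContinuousLinearMap.fst ℝ E2 E2)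
    ((p.1 : E3) i) fun w ↦ sphereParam_mul p.1 w.1 i).transport rfl (fun u ↦ rfl) fun u v ↦ ?_
  · exact (EuclideanSpace.proj i : E3 →L[ℝ] ℝ).contDiff.comp
      ((contDiff_sphereParam p.1).comp contDiff_fst)
  · exact congrArg (fun r ↦ -r * (p.1 : E3) i) (dot_sphereFrame_sphereFrame p.1 u.1 v.1).symm

lemma hasJet_snd (p : S2 × S2) (i : Fin 3) :
    HasJet (prodFrame p) 0 (fun w : E2 × E2 ↦ sphereParam p.2 w.2 i) (jetSnd (prodEmb p) i) := by
  let L (j : Fin 2) : E2 × E2 →L[ℝ] ℝ :=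
    (EuclideanSpace.proj j : E2 →L[ℝ] ℝ) ∘L ContinuousLinearMap.snd ℝ E2 E2
  refine (hasJet_of_stereographic (f := fun w : E2 × E2 ↦ sphereParam p.2 w.2 i) ?_ (L 0) (L 1)
    ((EuclideanSpace.proj i : E3 →L[ℝ] ℝ) ∘L sphereFrame p.2 ∘L ContinuousLinearMap.snd ℝ E2 E2)
    ((p.2 : E3) i) fun w ↦ sphereParam_mul p.2 w.2 i).transport rfl (fun u ↦ rfl) fun u v ↦ ?_
  · exact (EuclideanSpace.proj i : E3 →L[ℝ] ℝ).contDiff.comp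
      ((contDiff_sphereParam p.2).comp contDiff_snd)
  · exact congrArg (fun r ↦ -r * (p.2 : E3) i) (dot_sphereFrame_sphereFrame p.2 u.2 v.2).symm

/-- The functions `comp` in the chart at `p`. -/
def chartComp (p : S2 × S2) (k : Idx) (w : E2 × E2) : ℝ :=
  comp (sphereParam p.1 w.1) (sphereParam p.2 w.2) k

lemma hasJet_chartComp (p : S2 × S2) (k : Idx) :
    HasJet (prodFrame p) 0 (chartComp p k) (jet (prodEmb p) k) := by
  have hT : HasJet (prodFrame p) 0
      (fun w ↦ dotR (sphereParam p.1 w.1) (sphereParam p.2 w.2)) (jetT (prodEmb p)) :=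
    (((hasJet_fst p 0).mul (hasJet_snd p 0)).add ((hasJet_fst p 1).mul (hasJet_snd p 1))).add
      ((hasJet_fst p 2).mul (hasJet_snd p 2))
  have hZ (i : Fin 3) : HasJet (prodFrame p) 0
      (fun w ↦ crossR (sphereParam p.1 w.1) (sphereParam p.2 w.2) i) (jetZ (prodEmb p) i) := by
    fin_cases i <;>
    exact ((hasJet_fst p _).mul (hasJet_snd p _)).sub ((hasJet_fst p _).mul (hasJet_snd p _))
  rcases k with i | i | i | i | (i | ⟨i, j⟩) | i
  · exact hasJet_fst p i
  · exact hasJet_snd p i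
  · exact hT
  · exact hZ i
  · exact (hZ i).mul hT
  · exact (hZ i).mul (hZ j)
  · exact hT.mul (hasJet_fst p i)

end ChartJets

section GaussFormula

variable {c δ : ℝ}

lemma weight_nonneg (hc : 0 ≤ c) (hδ : 0 ≤ δ) (k : Idx) : 0 ≤ weight c δ k := by
  rcases k with i | i | i | i | (i | ⟨i, j⟩) | i <;> simp only [weight] <;> positivity

/-- The map with which the metrics are defined, in the chart at `p`. -/
def chartMap (c δ : ℝ) (p : S2 × S2) : E2 × E2 → EuclideanSpace ℝ Idx :=
  weightedMap (weight c δ) (chartComp p)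

lemma contDiff_chartMap (c δ : ℝ) (p : S2 × S2) : ContDiff ℝ ∞ (chartMap c δ p) :=
  contDiff_weightedMap _ fun k ↦ (hasJet_chartComp p k).contDiff

lemma inner_weighted (hc : 0 ≤ c) (hδ : 0 ≤ δ) {v w : EuclideanSpace ℝ Idx} {f g : Idx → ℝ}
    (hv : ∀ k, v k = √(weight c δ k) * f k) (hw : ∀ k, w k = √(weight c δ k) * g k) :
    inner ℝ v w = ∑ k, weight c δ k * (f k * g k) := by
  rw [PiLp.inner_apply]
  refine Finset.sum_congr rfl fun k _ ↦ ?_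
  have := Real.mul_self_sqrt (weight_nonneg hc hδ k)
  simp only [hv, hw, RCLike.inner_apply, RCLike.conj_to_real]
  linear_combination (f k * g k) * this

lemma fderiv_chartMap (c δ : ℝ) (p : S2 × S2) (u : E2 × E2) (k : Idx) :
    fderiv ℝ (chartMap c δ p) 0 u k =
      √(weight c δ k) * (jet (prodEmb p) k).d (prodFrame p u) := by
  rw [chartMap, fderiv_weightedMap _ fun k ↦ (hasJet_chartComp p k).contDiff,
    (hasJet_chartComp p k).d]

lemma fderiv_fderiv_chartMap (c δ : ℝ) (p : S2 × S2) (u v : E2 × E2) (k : Idx) :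
    fderiv ℝ (fderiv ℝ (chartMap c δ p)) 0 u v k =
      √(weight c δ k) * (jet (prodEmb p) k).h (prodFrame p u) (prodFrame p v) := by
  rw [chartMap, fderiv_fderiv_weightedMap _ fun k ↦ (hasJet_chartComp p k).contDiff,
    (hasJet_chartComp p k).h]

lemma inducedForm_chartMap (hc : 0 ≤ c) (hδ : 0 ≤ δ) (p : S2 × S2) (u v : E2 × E2) :
    inducedForm (chartMap c δ p) 0 u v =
      jetMetric c δ (prodEmb p) (prodFrame p u) (prodFrame p v) :=
  inner_weighted hc hδ (fderiv_chartMap c δ p u) (fderiv_chartMap c δ p v)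

lemma injective_prodFrame (p : S2 × S2) {u : E2 × E2} (h : prodFrame p u = 0) : u = 0 := by
  have h1 : sphereFrame p.1 u.1 = 0 := congrArg (fun w : V6 ↦ w.fst) h
  have h2 : sphereFrame p.2 u.2 = 0 := congrArg (fun w : V6 ↦ w.snd) h
  refine Prod.ext ?_ ?_
  · rw [← norm_eq_zero, norm_sphereFrame] at h1
    exact norm_eq_zero.1 h1
  · rw [← norm_eq_zero, norm_sphereFrame] at h2
    exact norm_eq_zero.1 h2

lemma injective_fderiv_chartMap (hc : 0 ≤ c) (hδ : 0 ≤ δ) (p : S2 × S2) :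
    Function.Injective (fderiv ℝ (chartMap c δ p) 0) := by
  rw [injective_iff_map_eq_zero]
  intro u hu
  refine injective_prodFrame p ?_
  have h := inducedForm_chartMap hc hδ p u u
  rw [inducedForm_apply, hu, inner_zero_left, jetMetric_eq] at h
  have h2 : 0 ≤ c * jetMetricOne c δ (prodEmb p) (prodFrame p u) (prodFrame p u) :=
    mul_nonneg hc (Finset.sum_nonneg fun k _ ↦
      mul_nonneg (weightOne_nonneg hc hδ k) (mul_self_nonneg _))
  exact inner_self_eq_zero.1 (le_antisymm (by linarith) real_inner_self_nonneg)

lemma isGamma_christoffel (hc : 0 ≤ c) (hδ : 0 ≤ δ) (p : S2 × S2) (u v : E2 × E2) :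
    IsGamma c δ (prodEmb p) (prodFrame p u) (prodFrame p v)
      (prodFrame p (christoffel (inducedForm (chartMap c δ p)) 0 u v)) where
  tan := isTan_prodFrame p _
  eq e he := by
    obtain ⟨w, rfl⟩ := exists_prodFrame_eq p he
    rw [← inducedForm_chartMap hc hδ, inducedForm_apply, inducedForm_christoffel (contDiff_chartMap c δ p)
      (isInvertible_pullbackForm (injective_fderiv_chartMap hc hδ p))]
    exact inner_weighted hc hδ (fderiv_fderiv_chartMap c δ p u v) (fderiv_chartMap c δ p w)

/-- The sectional curvature of the metric in the chart at `p`. -/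
lemma isSec_coordSec (hc : 0 ≤ c) (hδ : 0 ≤ δ) (p : S2 × S2) (u v : E2 × E2) :
    IsSec c δ (prodEmb p) (prodFrame p u) (prodFrame p v)
      (coordSec (inducedForm (chartMap c δ p)) 0 u v) := by
  refine ⟨_, _, _, isGamma_christoffel hc hδ p u u, isGamma_christoffel hc hδ p u v,
    isGamma_christoffel hc hδ p v v, ?_⟩
  rw [coordSec, gauss_equation (contDiff_chartMap c δ p) (injective_fderiv_chartMap hc hδ p)]
  simp only [inducedForm_chartMap hc hδ]
  rw [inner_weighted hc hδ (fderiv_fderiv_chartMap c δ p u u) (fderiv_fderiv_chartMap c δ p v v),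
    inner_weighted hc hδ (fderiv_fderiv_chartMap c δ p u v) (fderiv_fderiv_chartMap c δ p u v),
    jetCurv, jetGram, ← Finset.sum_sub_distrib]
  congr 2
  refine Finset.sum_congr rfl fun k _ ↦ ?_
  simp only [curvTerm]
  ring

end GaussFormula

end

end SecTheta

namespace SecTheta

noncomputable section

section PullbackMetrics

variable {E : Type*} [NormedAddCommGroup E] [NormedSpace ℝ E]
  {H : Type*} [TopologicalSpace H] {I : ModelWithCorners ℝ E H}
  {M : Type*} [TopologicalSpace M] [ChartedSpace H M] [IsManifold I ∞ M]
  {E' : Type*} [NormedAddCommGroup E'] [NormedSpace ℝ E']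
  {H' : Type*} [TopologicalSpace H'] {I' : ModelWithCorners ℝ E' H'}
  {N : Type*} [TopologicalSpace N] [ChartedSpace H' N] [IsManifold I' ∞ N]
  {V : Type*} [NormedAddCommGroup V] [NormedSpace ℝ V]
  {W : Type*} [NormedAddCommGroup W] [InnerProductSpace ℝ W]

/-- The pullback of a metric under a map from a vector space. -/
def pullMetric (g : SmoothMetric I M) (f : V → M) (x : V) : V →L[ℝ] V →L[ℝ] ℝ :=
  let A : V →L[ℝ] TangentSpace I (f x) := mfderiv 𝓘(ℝ, V) I f x
  (ContinuousLinearMap.precomp ℝ A) ∘L (g.inner (f x)) ∘L A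

lemma pullMetric_apply (g : SmoothMetric I M) (f : V → M) (x u v : V) :
    pullMetric g f x u v =
      g.inner (f x) (mfderiv 𝓘(ℝ, V) I f x u) (mfderiv 𝓘(ℝ, V) I f x v) := rfl

lemma chartMetric_eq_pullMetric (g : SmoothMetric I M) (p : M) :
    chartMetric g p = pullMetric g (extChartAt I p).symm := rfl

lemma pullMetric_comp {f : V → M} {φ : M → N} (hf : MDifferentiable 𝓘(ℝ, V) I f)
    (hφ : MDifferentiable I I' φ) {h : SmoothMetric I' N} {g : SmoothMetric I M}
    (hp : IsPullback φ h g) : pullMetric h (φ ∘ f) = pullMetric g f := by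
  funext x
  ext u v
  rw [pullMetric_apply, pullMetric_apply, hp, mfderiv_comp x (hφ (f x)) (hf x)]
  rfl

lemma pullMetric_inducedMetric [FiniteDimensional ℝ E] {F : M → W} (hF : ContMDiff I 𝓘(ℝ, W) ∞ F)
    (hinj : ∀ p, Function.Injective (mvfderiv I F p)) {f : V → M}
    (hf : MDifferentiable 𝓘(ℝ, V) I f) :
    pullMetric (inducedMetric F hF hinj) f = inducedForm (F ∘ f) := by
  funext x
  ext u v
  have h : fderiv ℝ (F ∘ f) x = mvfderiv I F (f x) ∘L mfderiv 𝓘(ℝ, V) I f x := by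
    rw [← mfderiv_eq_fderiv, mfderiv_comp x (hF.mdifferentiable (by simp) (f x)) (hf x)]
    rfl
  rw [inducedForm_apply, h]
  rfl

lemma mdifferentiable_extChartAt_symm [I.Boundaryless] {p : M} (hp : (chartAt H p).target = univ) :
    MDifferentiable 𝓘(ℝ, E) I (extChartAt I p).symm := by
  have h := contMDiffOn_extChartAt_symm (I := I) (n := ∞) p
  have ht : (extChartAt I p).target = univ := by
    rw [extChartAt_target, hp, I.range_eq_univ]
    simp
  rw [ht, contMDiffOn_univ] at h
  exact h.mdifferentiable (by simp)

end PullbackMetrics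

section Family

/-- The map with which the metrics are defined, on `ℝ⁶`. -/
def ambientMap (c δ : ℝ) : V6 → EuclideanSpace ℝ Idx :=
  weightedMap (weight c δ) fun k z ↦ comp (fun i ↦ z.fst i) (fun i ↦ z.snd i) k

lemma contDiff_comp (k : Idx) :
    ContDiff ℝ ∞ fun z : V6 ↦ comp (fun i ↦ z.fst i) (fun i ↦ z.snd i) k := by
  have h1 (i : Fin 3) : ContDiff ℝ ∞ fun z : V6 ↦ z.fst i :=
    ((EuclideanSpace.proj i : E3 →L[ℝ] ℝ) ∘L (WithLp.fstL 2 ℝ E3 E3)).contDiff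
  have h2 (i : Fin 3) : ContDiff ℝ ∞ fun z : V6 ↦ z.snd i :=
    ((EuclideanSpace.proj i : E3 →L[ℝ] ℝ) ∘L (WithLp.sndL 2 ℝ E3 E3)).contDiff
  have hT : ContDiff ℝ ∞ fun z : V6 ↦ dotR (fun i ↦ z.fst i) (fun i ↦ z.snd i) :=
    (((h1 0).mul (h2 0)).add ((h1 1).mul (h2 1))).add ((h1 2).mul (h2 2))
  have hZ (i : Fin 3) : ContDiff ℝ ∞ fun z : V6 ↦ crossR (fun i ↦ z.fst i) (fun i ↦ z.snd i) i := by
    fin_cases i <;> exact ((h1 _).mul (h2 _)).sub ((h1 _).mul (h2 _))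
  rcases k with i | i | i | i | (i | ⟨i, j⟩) | i
  · exact h1 i
  · exact h2 i
  · exact hT
  · exact hZ i
  · exact (hZ i).mul hT
  · exact (hZ i).mul (hZ j)
  · exact hT.mul (h1 i)

/-- The map `S² × S² → ℝ^N` that induces the metric. -/
def familyMap (c δ : ℝ) : S2 × S2 → EuclideanSpace ℝ Idx := ambientMap c δ ∘ prodEmb

lemma contMDiff_familyMap (c δ : ℝ) : ContMDiff I4 𝓘(ℝ, EuclideanSpace ℝ Idx) ∞ (familyMap c δ) :=
  (contDiff_weightedMap _ contDiff_comp).contMDiff.comp contMDiff_prodEmb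

/-- The projection of `ℝ^N` to `ℝ⁶`. -/
def idxProj : EuclideanSpace ℝ Idx →L[ℝ] V6 where
  toFun v := WithLp.toLp 2 (WithLp.toLp 2 fun i ↦ v (.inl i), WithLp.toLp 2 fun i ↦ v (.inr (.inl i)))
  map_add' _ _ := rfl
  map_smul' _ _ := rfl
  cont := by fun_prop

lemma idxProj_familyMap (c δ : ℝ) (p : S2 × S2) : idxProj (familyMap c δ p) = prodEmb p := by
  refine WithLp.ofLp_injective _ (Prod.ext ?_ ?_)
  · ext i
    change √1 * (p.1 : E3) i = _
    rw [Real.sqrt_one, one_mul]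
    rfl
  · ext i
    change √1 * (p.2 : E3) i = _
    rw [Real.sqrt_one, one_mul]
    rfl

lemma injective_mvfderiv_familyMap (c δ : ℝ) (p : S2 × S2) :
    Function.Injective (mvfderiv I4 (familyMap c δ) p) := by
  have h2 : prodEmb = idxProj ∘ familyMap c δ := funext fun p ↦ (idxProj_familyMap c δ p).symm
  have hL : MDifferentiableAt 𝓘(ℝ, EuclideanSpace ℝ Idx) 𝓘(ℝ, V6) idxProj (familyMap c δ p) :=
    idxProj.contDiff.contMDiff.mdifferentiable (n := ∞) (by simp) _
  have hF : MDifferentiableAt I4 𝓘(ℝ, EuclideanSpace ℝ Idx) (familyMap c δ) p :=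
    (contMDiff_familyMap c δ).mdifferentiable (by simp) p
  intro u v huv
  refine injective_mvfderiv_prodEmb p ?_
  have e (w : TangentSpace I4 p) : mvfderiv I4 prodEmb p w =
      mvfderiv 𝓘(ℝ, EuclideanSpace ℝ Idx) idxProj (familyMap c δ p)
        (mvfderiv I4 (familyMap c δ) p w) := by
    rw [h2]
    exact congrArg (fun A : E2 × E2 →L[ℝ] V6 ↦ A w) (mfderiv_comp p hL hF)
  rw [e, e, huv]

/-- The family of metrics on `S² × S²`. -/
def familyMetric (c δ : ℝ) : SmoothMetric I4 (S2 × S2) :=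
  inducedMetric (familyMap c δ) (contMDiff_familyMap c δ) (injective_mvfderiv_familyMap c δ)

lemma extChartAt_S2_prod_symm (p : S2 × S2) (w : E2 × E2) : (extChartAt I4 p).symm w =
    ((chartAt E2 p.1).symm w.1, (chartAt E2 p.2).symm w.2) := by
  rw [extChartAt_prod]
  rfl

lemma extChartAt_S2_prod_self (p : S2 × S2) : extChartAt I4 p p = 0 := by
  rw [extChartAt_prod]
  exact Prod.ext (chartAt_sphere_self p.1) (chartAt_sphere_self p.2)

lemma mdifferentiable_S2_prod_symm (p : S2 × S2) :
    MDifferentiable 𝓘(ℝ, E2 × E2) I4 (extChartAt I4 p).symm := by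
  refine mdifferentiable_extChartAt_symm ?_
  rw [prodChartedSpace_chartAt]
  change (chartAt E2 p.1).target ×ˢ (chartAt E2 p.2).target = univ
  rw [chartAt_sphere_target, chartAt_sphere_target, univ_prod_univ]

lemma familyMap_chart (c δ : ℝ) (p : S2 × S2) :
    familyMap c δ ∘ (extChartAt I4 p).symm = chartMap c δ p := by
  funext w
  rw [Function.comp, extChartAt_S2_prod_symm]
  rfl

lemma chartMetric_familyMetric (c δ : ℝ) (p : S2 × S2) :
    chartMetric (familyMetric c δ) p = inducedForm (chartMap c δ p) := by
  rw [chartMetric_eq_pullMetric, familyMetric,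
    pullMetric_inducedMetric _ _ (mdifferentiable_S2_prod_symm p), familyMap_chart]

end Family

end

end SecTheta

namespace SecTheta

noncomputable section

section Invariance

variable {E : Type*} [NormedAddCommGroup E] [NormedSpace ℝ E] [FiniteDimensional ℝ E]
  {H : Type*} [TopologicalSpace H] {I : ModelWithCorners ℝ E H}
  {M : Type*} [TopologicalSpace M] [ChartedSpace H M] [IsManifold I ∞ M]
  {W : Type*} [NormedAddCommGroup W] [InnerProductSpace ℝ W]

lemma inducedMetric_inner {F : M → W} (hF : ContMDiff I 𝓘(ℝ, W) ∞ F)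
    (hinj : ∀ p, Function.Injective (mvfderiv I F p)) (p : M) (u v : TangentSpace I p) :
    (inducedMetric F hF hinj).inner p u v = inner ℝ (mvfderiv I F p u) (mvfderiv I F p v) := rfl

/-- A map covered by an isometry of the Euclidean space is an isometry of the induced metric. -/
lemma isPullback_of_comp_eq {F : M → W} (hF : ContMDiff I 𝓘(ℝ, W) ∞ F)
    (hinj : ∀ p, Function.Injective (mvfderiv I F p)) {a : M → M} (ha : MDifferentiable I I a)
    {S : W →L[ℝ] W} (hS : ∀ v w, inner ℝ (S v) (S w) = inner ℝ v w) (h : ∀ p, F (a p) = S (F p)) :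
    IsPullback a (inducedMetric F hF hinj) (inducedMetric F hF hinj) := by
  intro p u v
  have hFd := hF.mdifferentiable (by simp)
  have hSd : MDifferentiableAt 𝓘(ℝ, W) 𝓘(ℝ, W) S (F p) :=
    S.contDiff.contMDiff.mdifferentiable (n := ∞) (by simp) _
  have h1 : mfderiv I 𝓘(ℝ, W) (F ∘ a) p = mfderiv I 𝓘(ℝ, W) F (a p) ∘L mfderiv I I a p :=
    mfderiv_comp p (hFd (a p)) (ha p)
  have h2 : mfderiv I 𝓘(ℝ, W) (S ∘ F) p = mfderiv 𝓘(ℝ, W) 𝓘(ℝ, W) S (F p) ∘L mfderiv I 𝓘(ℝ, W) F p :=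
    mfderiv_comp p hSd (hFd p)
  have h3 : F ∘ a = S ∘ F := funext h
  have key (w : TangentSpace I p) :
      mvfderiv I F (a p) (mfderiv I I a p w) = S (mvfderiv I F p w) := by
    have e1 : mfderiv I 𝓘(ℝ, W) (F ∘ a) p w = mvfderiv I F (a p) (mfderiv I I a p w) :=
      congrArg (fun A : E →L[ℝ] W ↦ A w) h1
    have e2 : mfderiv I 𝓘(ℝ, W) (S ∘ F) p w = fderiv ℝ S (F p) (mvfderiv I F p w) := by
      rw [← mfderiv_eq_fderiv]
      exact congrArg (fun A : E →L[ℝ] W ↦ A w) h2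
    rw [S.fderiv] at e2
    rw [← e1, ← e2, h3]
  rw [inducedMetric_inner, inducedMetric_inner, key, key, hS]

lemma mdifferentiable_antipodal (ε₁ ε₂ : ℤˣ) : MDifferentiable I4 I4 (antipodal ε₁ ε₂) :=
  ((S2.contMDiff_smul ε₁).prodMap (S2.contMDiff_smul ε₂)).mdifferentiable (by simp)

lemma units_sq (ε : ℤˣ) : (((ε : ℤ) : ℝ)) * ((ε : ℤ) : ℝ) = 1 := by
  rcases Int.units_eq_one_or ε with rfl | rfl <;> simp

/-- The characters by which `ℤ₂ ⊕ ℤ₂` acts on the functions `comp`. -/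
def signs (s₁ s₂ : ℝ) : Idx → ℝ
  | .inl _ => s₁
  | .inr (.inl _) => s₂
  | .inr (.inr (.inl _)) => s₁ * s₂
  | .inr (.inr (.inr (.inl _))) => s₁ * s₂
  | .inr (.inr (.inr (.inr (.inl _)))) => 1
  | .inr (.inr (.inr (.inr (.inr _)))) => s₂

lemma comp_signs {s₁ s₂ : ℝ} (h₁ : s₁ * s₁ = 1) (h₂ : s₂ * s₂ = 1) (x y : Fin 3 → ℝ) (k : Idx) :
    comp (fun i ↦ s₁ * x i) (fun i ↦ s₂ * y i) k = signs s₁ s₂ k * comp x y k := by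
  have hT : dotR (fun i ↦ s₁ * x i) (fun i ↦ s₂ * y i) = s₁ * s₂ * dotR x y := by
    simp only [dotR]; ring
  have hZ (i : Fin 3) :
      crossR (fun i ↦ s₁ * x i) (fun i ↦ s₂ * y i) i = s₁ * s₂ * crossR x y i := by
    fin_cases i <;> simp [crossR] <;> ring
  have h12 : s₁ * s₂ * (s₁ * s₂) = 1 := by
    linear_combination (s₂ * s₂) * h₁ + h₂
  rcases k with i | i | i | i | (i | ⟨i, j⟩) | i <;> simp only [comp, signs, hT, hZ]
  · linear_combination (crossR x y i * dotR x y) * h12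
  · linear_combination (crossR x y i * crossR x y j) * h12
  · linear_combination (s₂ * dotR x y * x i) * h₁

lemma signs_sq {s₁ s₂ : ℝ} (h₁ : s₁ * s₁ = 1) (h₂ : s₂ * s₂ = 1) (k : Idx) :
    signs s₁ s₂ k * signs s₁ s₂ k = 1 := by
  have h12 : s₁ * s₂ * (s₁ * s₂) = 1 := by
    linear_combination (s₂ * s₂) * h₁ + h₂
  rcases k with i | i | i | i | (i | ⟨i, j⟩) | i <;> simp only [signs, mul_one] <;> assumption

/-- Multiplication of the coordinates by scalars. -/
def diagMap {ι : Type*} [Fintype ι] (s : ι → ℝ) : EuclideanSpace ℝ ι →L[ℝ] EuclideanSpace ℝ ι where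
  toFun v := WithLp.toLp 2 fun k ↦ s k * v k
  map_add' v w := by ext k; simp [mul_add]
  map_smul' r v := by ext k; simp [mul_left_comm]
  cont := by fun_prop

lemma isAntipodalInvariant_familyMetric (c δ : ℝ) : IsAntipodalInvariant (familyMetric c δ) := by
  intro ε₁ ε₂
  refine isPullback_of_comp_eq _ _ (mdifferentiable_antipodal ε₁ ε₂)
    (S := diagMap (signs ((ε₁ : ℤ) : ℝ) ((ε₂ : ℤ) : ℝ))) ?_ ?_
  · intro v w
    rw [PiLp.inner_apply, PiLp.inner_apply]
    refine Finset.sum_congr rfl fun k _ ↦ ?_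
    have := signs_sq (units_sq ε₁) (units_sq ε₂) k
    simp only [diagMap, RCLike.inner_apply, RCLike.conj_to_real, ContinuousLinearMap.coe_mk', 
      LinearMap.coe_mk, AddHom.coe_mk]
    linear_combination (w k * v k) * this
  · intro p
    ext k
    have h := comp_signs (units_sq ε₁) (units_sq ε₂) (fun i ↦ (p.1 : E3) i) (fun i ↦ (p.2 : E3) i) k
    have e1 (i : Fin 3) : ((ε₁ • p.1 : S2) : E3) i = ((ε₁ : ℤ) : ℝ) * (p.1 : E3) i := by
      rw [S2.coe_smul, ← Int.cast_smul_eq_zsmul ℝ]; rfl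
    have e2 (i : Fin 3) : ((ε₂ • p.2 : S2) : E3) i = ((ε₂ : ℤ) : ℝ) * (p.2 : E3) i := by
      rw [S2.coe_smul, ← Int.cast_smul_eq_zsmul ℝ]; rfl
    simp only [← e1, ← e2] at h
    change √(weight c δ k) * comp (fun i ↦ ((ε₁ • p.1 : S2) : E3) i)
      (fun i ↦ ((ε₂ • p.2 : S2) : E3) i) k =
      signs _ _ k * (√(weight c δ k) * comp (fun i ↦ (p.1 : E3) i) (fun i ↦ (p.2 : E3) i) k)
    rw [h]
    ring

lemma isAntipodalInvariant_productMetric : IsAntipodalInvariant productMetric := by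
  intro ε₁ ε₂
  let S : V6 →L[ℝ] V6 :=
    { toFun := fun v ↦ WithLp.toLp 2 (((ε₁ : ℤ) : ℝ) • v.fst, ((ε₂ : ℤ) : ℝ) • v.snd)
      map_add' := fun v w ↦ by
        refine WithLp.ofLp_injective _ (Prod.ext ?_ ?_)
        · exact smul_add _ v.fst w.fst
        · exact smul_add _ v.snd w.snd
      map_smul' := fun r v ↦ by
        refine WithLp.ofLp_injective _ (Prod.ext ?_ ?_)
        · exact smul_comm _ r v.fst
        · exact smul_comm _ r v.snd
      cont := by fun_prop }
  refine isPullback_of_comp_eq _ _ (mdifferentiable_antipodal ε₁ ε₂) (S := S) ?_ ?_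
  · intro v w
    rw [inner_V6, inner_V6]
    change dot (((ε₁ : ℤ) : ℝ) • v.fst) (((ε₁ : ℤ) : ℝ) • w.fst) +
      dot (((ε₂ : ℤ) : ℝ) • v.snd) (((ε₂ : ℤ) : ℝ) • w.snd) = _
    rw [dot_smul_left, dot_smul_right, dot_smul_left, dot_smul_right]
    linear_combination dot v.fst w.fst * units_sq ε₁ + dot v.snd w.snd * units_sq ε₂
  · intro p
    refine WithLp.ofLp_injective _ (Prod.ext ?_ ?_)
    · exact (Int.cast_smul_eq_zsmul ℝ _ _).symm
    · exact (Int.cast_smul_eq_zsmul ℝ _ _).symm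

end Invariance

section Convergence

/-- The part of the metric given by the function with index `k`, in the chart at `p`. -/
def partForm (p : S2 × S2) (k : Idx) (x : E2 × E2) : (E2 × E2) →L[ℝ] (E2 × E2) →L[ℝ] ℝ :=
  pullbackForm (fderiv ℝ (chartComp p k) x)

lemma contDiff_partForm (p : S2 × S2) (k : Idx) : ContDiff ℝ ∞ (partForm p k) :=
  contDiff_pullbackForm.comp ((hasJet_chartComp p k).contDiff.fderiv_right le_rfl)

lemma chartMetric_familyMetric_eq_sum {c δ : ℝ} (hc : 0 ≤ c) (hδ : 0 ≤ δ) (p : S2 × S2) :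
    chartMetric (familyMetric c δ) p = fun x ↦ ∑ k, weight c δ k • partForm p k x := by
  rw [chartMetric_familyMetric]
  funext x
  refine ContinuousLinearMap.ext fun u ↦ ContinuousLinearMap.ext fun v ↦ ?_
  rw [inducedForm_apply, chartMap, inner_weighted hc hδ
    (fderiv_weightedMap _ (fun k ↦ (hasJet_chartComp p k).contDiff) x u)
    (fderiv_weightedMap _ (fun k ↦ (hasJet_chartComp p k).contDiff) x v)]
  simp [partForm, pullbackForm_apply, mul_comm]

/-- The inclusion of `ℝ⁶` in `ℝ^N`. -/
def idxIncl : V6 →L[ℝ] EuclideanSpace ℝ Idx where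
  toFun z := WithLp.toLp 2 <| Sum.elim (fun i ↦ z.fst i) <| Sum.elim (fun i ↦ z.snd i) 0
  map_add' z w := by
    ext (i | i | i)
    · rfl
    · rfl
    · exact (add_zero (0 : ℝ)).symm
  map_smul' r z := by
    ext (i | i | i)
    · rfl
    · rfl
    · exact (mul_zero r).symm
  cont := by
    refine (PiLp.continuous_toLp 2 _).comp (continuous_pi ?_)
    rintro (i | i | i)
    · exact ((EuclideanSpace.proj i : E3 →L[ℝ] ℝ) ∘L (WithLp.fstL 2 ℝ E3 E3)).continuous
    · exact ((EuclideanSpace.proj i : E3 →L[ℝ] ℝ) ∘L (WithLp.sndL 2 ℝ E3 E3)).continuous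
    · exact continuous_const

lemma inner_idxIncl (z w : V6) : inner ℝ (idxIncl z) (idxIncl w) = inner ℝ z w := by
  rw [PiLp.inner_apply, Fintype.sum_sum_type, Fintype.sum_sum_type, WithLp.prod_inner_apply,
    PiLp.inner_apply, PiLp.inner_apply]
  simp [idxIncl]

lemma familyMap_zero (δ : ℝ) : familyMap 0 δ = idxIncl ∘ prodEmb := by
  funext p
  ext k
  change √(weight 0 δ k) * comp (fun i ↦ (p.1 : E3) i) (fun i ↦ (p.2 : E3) i) k = _
  rcases k with i | i | i | i | (i | ⟨i, j⟩) | i <;> simp [weight, comp, idxIncl, prodEmb]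

lemma differentiable_prodEmb_chart (p : S2 × S2) :
    Differentiable ℝ (prodEmb ∘ (extChartAt I4 p).symm) := fun x ↦
  (((contMDiff_prodEmb _).mdifferentiableAt (by simp)).comp x
    (mdifferentiable_S2_prod_symm p x)).differentiableAt

lemma chartMetric_productMetric (δ : ℝ) (p : S2 × S2) :
    chartMetric productMetric p = chartMetric (familyMetric 0 δ) p := by
  have hd := differentiable_prodEmb_chart p
  rw [chartMetric_eq_pullMetric, chartMetric_eq_pullMetric, productMetric, familyMetric,
    pullMetric_inducedMetric _ _ (mdifferentiable_S2_prod_symm p),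
    pullMetric_inducedMetric _ _ (mdifferentiable_S2_prod_symm p), familyMap_zero,
    Function.comp_assoc]
  funext x
  refine ContinuousLinearMap.ext fun u ↦ ContinuousLinearMap.ext fun v ↦ ?_
  rw [inducedForm_apply, inducedForm_apply,
    (idxIncl.hasFDerivAt.comp x (hd x).hasFDerivAt).fderiv]
  exact (inner_idxIncl _ _).symm

lemma continuous_weight (δ : ℝ) (k : Idx) : Continuous fun c ↦ weight c δ k := by
  rcases k with i | i | i | i | (i | ⟨i, j⟩) | i <;> simp only [weight] <;> fun_prop

lemma tendstoUniformlyOn_iteratedFDeriv_sum {E F ι : Type*} [NormedAddCommGroup E]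
    [NormedSpace ℝ E] [NormedAddCommGroup F] [NormedSpace ℝ F] [Fintype ι] {T : ι → E → F}
    (hT : ∀ k, ContDiff ℝ ∞ (T k)) {w : ℝ → ι → ℝ} (hw : ∀ k, Continuous fun c ↦ w c k)
    {l : Filter ℝ} (hl : l ≤ 𝓝 0) (j : ℕ) {K : Set E} (hK : IsCompact K) :
    TendstoUniformlyOn (fun c ↦ iteratedFDeriv ℝ j (fun x ↦ ∑ k, w c k • T k x))
      (iteratedFDeriv ℝ j (fun x ↦ ∑ k, w 0 k • T k x)) l K := by
  have hs (c : ℝ) (x : E) : iteratedFDeriv ℝ j (fun x ↦ ∑ k, w c k • T k x) x =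
      ∑ k, w c k • iteratedFDeriv ℝ j (T k) x := by
    have hj (k : ι) : ContDiff ℝ j (T k) := (hT k).of_le (by exact_mod_cast le_top)
    rw [iteratedFDeriv_fun_sum_apply fun k _ ↦ ((hj k).const_smul (w c k)).contDiffAt]
    refine Finset.sum_congr rfl fun k _ ↦ ?_
    exact iteratedFDeriv_const_smul_apply (hj k).contDiffAt
  have hb (k : ι) : ∃ C, ∀ x ∈ K, ‖iteratedFDeriv ℝ j (T k) x‖ ≤ C :=
    hK.exists_bound_of_continuousOn
      ((hT k).continuous_iteratedFDeriv (m := j) (by exact_mod_cast le_top)).continuousOn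
  choose C hC using hb
  rw [Metric.tendstoUniformlyOn_iff]
  intro ε hε
  have hlim : Filter.Tendsto (fun c ↦ ∑ k, |w 0 k - w c k| * C k) l (𝓝 0) := by
    have : Continuous fun c ↦ ∑ k, |w 0 k - w c k| * C k := by fun_prop
    have h0 := (this.tendsto 0).mono_left hl
    simpa using h0
  filter_upwards [hlim.eventually (gt_mem_nhds hε)] with c hcε x hx
  refine lt_of_le_of_lt ?_ hcε
  rw [hs, hs, dist_eq_norm, ← Finset.sum_sub_distrib]
  refine (norm_sum_le _ _).trans (Finset.sum_le_sum fun k _ ↦ ?_)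
  rw [← sub_smul, norm_smul, Real.norm_eq_abs]
  gcongr
  exact hC k x hx

variable {E : Type*} [NormedAddCommGroup E] [NormedSpace ℝ E]
  {H : Type*} [TopologicalSpace H] {I : ModelWithCorners ℝ E H}
  {M : Type*} [TopologicalSpace M] [ChartedSpace H M] [IsManifold I ∞ M]

/-- A family of metrics that depends linearly on weights, in the charts, is continuous in the
`C^m` topology. -/
lemma tendsto_CkTopology (m : ℕ) {ι : Type*} [Fintype ι] {G : ℝ → SmoothMetric I M}
    {g : SmoothMetric I M} {T : M → ι → E → E →L[ℝ] E →L[ℝ] ℝ} (hT : ∀ p k, ContDiff ℝ ∞ (T p k))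
    {w : ℝ → ι → ℝ} (hw : ∀ k, Continuous fun c ↦ w c k) {l : Filter ℝ} (hl : l ≤ 𝓝 0)
    (hG : ∀ᶠ c in l, ∀ p, chartMetric (G c) p = fun x ↦ ∑ k, w c k • T p k x)
    (hg : ∀ p, chartMetric g p = fun x ↦ ∑ k, w 0 k • T p k x) :
    Filter.Tendsto G l (@nhds _ (CkTopology I M m) g) := by
  rw [nhds_iInf]
  refine Filter.tendsto_iInf.2 fun p ↦ ?_
  rw [nhds_iInf]
  refine Filter.tendsto_iInf.2 fun j ↦ ?_
  rw [nhds_induced, Filter.tendsto_comap_iff, UniformOnFun.tendsto_iff_tendstoUniformlyOn]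
  rintro K ⟨hK, -⟩
  have key := tendstoUniformlyOn_iteratedFDeriv_sum (hT p) hw hl j hK
  rw [← hg] at key
  refine key.congr ?_
  filter_upwards [hG] with c hc x _
  rw [← hc]
  rfl

end Convergence

end

end SecTheta

namespace SecTheta

noncomputable section

section ChartCover

lemma hasMFDerivAt_extChartAt_symm_self {E : Type*} [NormedAddCommGroup E] [NormedSpace ℝ E]
    {H : Type*} [TopologicalSpace H] {I : ModelWithCorners ℝ E H} [I.Boundaryless]
    {M : Type*} [TopologicalSpace M] [ChartedSpace H M] [IsManifold I ∞ M] (p : M) :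
    HasMFDerivAt 𝓘(ℝ, E) I (extChartAt I p).symm (extChartAt I p p) (ContinuousLinearMap.id ℝ E) := by
  have h1 : MDifferentiableAt 𝓘(ℝ, E) I (extChartAt I p).symm (extChartAt I p p) :=
    ((contMDiffOn_extChartAt_symm (I := I) (n := ∞) p).contMDiffAt
      (extChartAt_target_mem_nhds p)).mdifferentiableAt (by simp)
  have : IsManifold I 1 M := IsManifold.of_le (n := ∞) (by simp)
  have h2 := mfderivWithin_range_extChartAt_symm (I := I) (x := p)
  rw [I.range_eq_univ, mfderivWithin_univ] at h2
  have h3 := h1.hasMFDerivAt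
  rw [h2] at h3
  exact h3

variable {N : Type*} [TopologicalSpace N] [ChartedSpace (ModelProd E2 E2) N] [IsManifold I4 ∞ N]

/-- A quotient of `S² × S²` by antipodal maps, with the charts of `S² × S²`. -/
structure IsChartCover (cov : S2 × S2 → N) (lift : N → S2 × S2) : Prop where
  symm_eq (q : N) : ⇑(extChartAt I4 q).symm = cov ∘ (extChartAt I4 (lift q)).symm
  self_eq (q : N) : extChartAt I4 q q = 0
  deck (p : S2 × S2) : ∃ ε₁ ε₂ : ℤˣ, antipodal ε₁ ε₂ p = lift (cov p) ∧
    cov ∘ antipodal ε₁ ε₂ = cov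

namespace IsChartCover

variable {cov : S2 × S2 → N} {lift : N → S2 × S2}

lemma cov_lift (hc : IsChartCover cov lift) (q : N) : cov (lift q) = q := by
  have h := (extChartAt I4 q).left_inv (mem_extChartAt_source q)
  rw [hc.symm_eq, hc.self_eq, ← extChartAt_S2_prod_self (lift q)] at h
  conv_rhs => rw [← h]
  exact congrArg cov ((extChartAt I4 (lift q)).left_inv (mem_extChartAt_source _)).symm

lemma contMDiffAt_lift (hc : IsChartCover cov lift) (q : N) : ContMDiffAt I4 I4 ∞ cov (lift q) := by
  have h1 : ContMDiffAt 𝓘(ℝ, E2 × E2) I4 ∞ (extChartAt I4 q).symm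
      (extChartAt I4 (lift q) (lift q)) := by
    rw [extChartAt_S2_prod_self, ← hc.self_eq q]
    exact (contMDiffOn_extChartAt_symm q).contMDiffAt (extChartAt_target_mem_nhds q)
  refine (h1.comp (lift q) contMDiffAt_extChartAt).congr_of_eventuallyEq ?_
  filter_upwards [extChartAt_source_mem_nhds (I := I4) (lift q)] with p hp
  rw [hc.symm_eq]
  exact congrArg cov ((extChartAt I4 (lift q)).left_inv hp).symm

lemma contMDiff (hc : IsChartCover cov lift) : ContMDiff I4 I4 ∞ cov := by
  intro p
  obtain ⟨ε₁, ε₂, h1, h2⟩ := hc.deck p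
  rw [← h2]
  refine ContMDiffAt.comp p ?_ (((S2.contMDiff_smul ε₁).prodMap (S2.contMDiff_smul ε₂)) p)
  have := hc.contMDiffAt_lift (cov p)
  rwa [← h1] at this

lemma mdifferentiable (hc : IsChartCover cov lift) : MDifferentiable I4 I4 cov := hc.contMDiff.mdifferentiable (by simp)

lemma mfderiv_lift (hc : IsChartCover cov lift) (q : N) (u : E2 × E2) : (mfderiv I4 I4 cov (lift q) u : E2 × E2) = u := by
  have h1 := hasMFDerivAt_extChartAt_symm_self (I := I4) q
  have h2 := hasMFDerivAt_extChartAt_symm_self (I := I4) (lift q)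
  rw [hc.symm_eq, hc.self_eq, ← extChartAt_S2_prod_self (lift q)] at h1
  have h3 := (hc.mdifferentiable ((extChartAt I4 (lift q)).symm
    (extChartAt I4 (lift q) (lift q)))).hasMFDerivAt.comp _ h2
  have h4 := hasMFDerivAt_unique h1 h3
  rw [(extChartAt I4 (lift q)).left_inv (mem_extChartAt_source _)] at h4
  exact (congrArg (fun A : E2 × E2 →L[ℝ] E2 × E2 ↦ A u) h4).symm

/-- The scalar product on a tangent space of the quotient. -/
def descendInner (lift : N → S2 × S2) (g : SmoothMetric I4 (S2 × S2)) (q : N) :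
    TangentSpace I4 q →L[ℝ] TangentSpace I4 q →L[ℝ] ℝ :=
  g.inner (lift q)

lemma inner_deck (hc : IsChartCover cov lift) {g : SmoothMetric I4 (S2 × S2)} (hg : IsAntipodalInvariant g) (p : S2 × S2)
    (u v : TangentSpace I4 p) :
    descendInner lift g (cov p) (mfderiv I4 I4 cov p u) (mfderiv I4 I4 cov p v) =
      g.inner p u v := by
  change (g.inner (lift (cov p)) : E2 × E2 →L[ℝ] E2 × E2 →L[ℝ] ℝ) (mfderiv I4 I4 cov p u)
      (mfderiv I4 I4 cov p v) = g.inner p u v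
  obtain ⟨ε₁, ε₂, h1, h2⟩ := hc.deck p
  rw [hg ε₁ ε₂ p u v]
  have h3 (w : TangentSpace I4 p) : (mfderiv I4 I4 cov p w : E2 × E2) =
      mfderiv I4 I4 (antipodal ε₁ ε₂) p w := by
    have h4 : mfderiv I4 I4 (cov ∘ antipodal ε₁ ε₂) p = _ :=
      mfderiv_comp p (hc.mdifferentiable _) (mdifferentiable_antipodal ε₁ ε₂ p)
    rw [h2] at h4
    have h5 : (mfderiv I4 I4 cov p w : E2 × E2) = mfderiv I4 I4 cov (antipodal ε₁ ε₂ p)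
      (mfderiv I4 I4 (antipodal ε₁ ε₂) p w) := congrArg (fun A : E2 × E2 →L[ℝ] E2 × E2 ↦ A w) h4
    rw [h5, h1]
    exact hc.mfderiv_lift _ _
  rw [h3, h3, ← h1]

/-- A local section of the covering. -/
lemma exists_section (hc : IsChartCover cov lift) (q : N) : ∃ s : N → S2 × S2, ∀ᶠ x in 𝓝 q, ContMDiffAt I4 I4 ∞ s x ∧
    cov ∘ s =ᶠ[𝓝 x] id := by
  refine ⟨(extChartAt I4 (lift q)).symm ∘ extChartAt I4 q, ?_⟩
  filter_upwards [(isOpen_extChartAt_source (I := I4) q).mem_nhds (mem_extChartAt_source q)]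
    with x hx
  constructor
  · refine ContMDiffAt.comp x ?_ (contMDiffAt_extChartAt' (by simpa using hx))
    refine (contMDiffOn_extChartAt_symm (lift q)).contMDiffAt ?_
    rw [extChartAt_prod]
    simp [chartAt_sphere_target]
  · filter_upwards [(isOpen_extChartAt_source (I := I4) q).mem_nhds hx] with y hy
    rw [← Function.comp_assoc, ← hc.symm_eq]
    exact (extChartAt I4 q).left_inv hy

variable {W : Type*} [NormedAddCommGroup W] [InnerProductSpace ℝ W]

/-- The metric on a quotient of `S² × S²` by antipodal maps that is covered by an invariant induced
metric. -/
def descend (hc : IsChartCover cov lift) {F : S2 × S2 → W} (hF : ContMDiff I4 𝓘(ℝ, W) ∞ F)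
    (hinj : ∀ p, Function.Injective (mvfderiv I4 F p))
    (hg : IsAntipodalInvariant (inducedMetric F hF hinj)) : SmoothMetric I4 N where
  inner := descendInner lift (inducedMetric F hF hinj)
  symm q := (inducedMetric F hF hinj).symm (lift q)
  pos q := (inducedMetric F hF hinj).pos (lift q)
  isVonNBounded q := (inducedMetric F hF hinj).isVonNBounded (lift q)
  contMDiff := by
    intro x₀
    obtain ⟨s, hs⟩ := hc.exists_section x₀
    rw [contMDiffAt_hom_bundle]
    refine ⟨contMDiffAt_id, ?_⟩
    have h1 := ((hF (s x₀)).comp x₀ hs.self_of_nhds.1).mfderiv_const (m := ∞) le_rfl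
    have h2 := contDiff_pullbackForm.contMDiff.contMDiffAt.comp x₀ h1
    refine h2.congr_of_eventuallyEq ?_
    filter_upwards [(chartAt (ModelProd E2 E2) x₀).open_source.mem_nhds (mem_chart_source _ x₀), hs]
      with x hx hsx
    refine ContinuousLinearMap.ext fun u ↦ ContinuousLinearMap.ext fun v ↦ ?_
    rw [inCoordinates_apply_eq₂ (by simpa using hx) (by simpa using hx) (mem_univ _)]
    have hA : ∀ w : E2 × E2, inTangentCoordinates I4 𝓘(ℝ, W) id (F ∘ s)
        (mfderiv I4 𝓘(ℝ, W) (F ∘ s)) x₀ x w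
        = mvfderiv I4 (F ∘ s) x ((trivializationAt (E2 × E2) (TangentSpace I4) x₀).symm x w) := by
      intro w
      simp [inTangentCoordinates, ContinuousLinearMap.inCoordinates]
      change mfderiv I4 𝓘(ℝ, W) (F ∘ s) x
        (Bundle.Trivialization.symmL ℝ (trivializationAt (E2 × E2) (TangentSpace I4) x₀) x w) = _
      rw [Bundle.Trivialization.symmL_apply]
      · rfl
      · simpa using hx
    have hB (w : TangentSpace I4 x) : mvfderiv I4 (F ∘ s) x w =
        mvfderiv I4 F (s x) (mfderiv I4 I4 s x w) :=
      congrArg (fun A : E2 × E2 →L[ℝ] W ↦ A w)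
        (mfderiv_comp x (hF.mdifferentiable (by simp) (s x)) (hsx.1.mdifferentiableAt (by simp)))
    have hC (w : TangentSpace I4 x) :
        (mfderiv I4 I4 cov (s x) (mfderiv I4 I4 s x w) : E2 × E2) = w := by
      have h3 : mfderiv I4 I4 (cov ∘ s) x = _ :=
        mfderiv_comp x (hc.mdifferentiable (s x)) (hsx.1.mdifferentiableAt (by simp))
      rw [hsx.2.mfderiv_eq, mfderiv_id] at h3
      exact (congrArg (fun A : E2 × E2 →L[ℝ] E2 × E2 ↦ A w) h3).symm
    change _ = inner ℝ (inTangentCoordinates I4 𝓘(ℝ, W) id (F ∘ s)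
      (mfderiv I4 𝓘(ℝ, W) (F ∘ s)) x₀ x u) (inTangentCoordinates I4 𝓘(ℝ, W) id (F ∘ s)
      (mfderiv I4 𝓘(ℝ, W) (F ∘ s)) x₀ x v)
    rw [hA, hA, hB, hB, ← inducedMetric_inner hF hinj, ← hc.inner_deck hg, hC, hC]
    have hD : ∀ y, y = x → ∀ u v : E2 × E2, (descendInner lift (inducedMetric F hF hinj) x :
        E2 × E2 →L[ℝ] E2 × E2 →L[ℝ] ℝ) u v = (descendInner lift (inducedMetric F hF hinj) y :
        E2 × E2 →L[ℝ] E2 × E2 →L[ℝ] ℝ) u v := by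
      rintro _ rfl u v
      rfl
    simp
    exact hD _ hsx.2.eq_of_nhds _ _

lemma isPullback_descend (hc : IsChartCover cov lift) {F : S2 × S2 → W} (hF : ContMDiff I4 𝓘(ℝ, W) ∞ F)
    (hinj : ∀ p, Function.Injective (mvfderiv I4 F p))
    (hg : IsAntipodalInvariant (inducedMetric F hF hinj)) :
    IsPullback cov (hc.descend hF hinj hg) (inducedMetric F hF hinj) :=
  fun p u v ↦ (hc.inner_deck hg p u v).symm

lemma chartMetric_eq (hc : IsChartCover cov lift) {h : SmoothMetric I4 N} {g : SmoothMetric I4 (S2 × S2)}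
    (hp : IsPullback cov h g) (q : N) : chartMetric h q = chartMetric g (lift q) := by
  rw [chartMetric_eq_pullMetric, hc.symm_eq,
    pullMetric_comp (mdifferentiable_S2_prod_symm _) hc.mdifferentiable hp]
  rfl

lemma injective_mfderiv {h : SmoothMetric I4 N} {g : SmoothMetric I4 (S2 × S2)}
    (hp : IsPullback cov h g) (p : S2 × S2) : Function.Injective (mfderiv I4 I4 cov p) := by
  refine (injective_iff_map_eq_zero _).2 fun u hu ↦ ?_
  by_contra hne
  refine (g.pos p u hne).ne' ?_
  rw [hp, hu]
  simp

lemma sec_eq (hc : IsChartCover cov lift) {h : SmoothMetric I4 N} {c δ : ℝ} (hp : IsPullback cov h (familyMetric c δ))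
    (σ : TangentPlane I4 N) : sec h σ =
      coordSec (inducedForm (chartMap c δ (lift σ.pt))) 0 (σ.basis 0 : TangentSpace I4 σ.pt)
        (σ.basis 1 : TangentSpace I4 σ.pt) := by
  have : IsManifold I4 1 N := IsManifold.of_le (n := ∞) (by simp)
  rw [sec, hc.chartMetric_eq hp, chartMetric_familyMetric, hc.self_eq]
  simp only [mfderiv_extChartAt_self]
  rfl

/-- The metrics of the family converge in the `C^m` topology. -/
lemma tendsto_family (hc : IsChartCover cov lift) (m : ℕ) {δ : ℝ} (hδ : 0 ≤ δ) {G : ℝ → SmoothMetric I4 N}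
    (hG : ∀ c, IsPullback cov (G c) (familyMetric c δ)) {h₀ : SmoothMetric I4 N}
    (h₀p : IsPullback cov h₀ productMetric) :
    Filter.Tendsto G (𝓝[>] 0) (@nhds _ (CkTopology I4 N m) h₀) := by
  refine tendsto_CkTopology m (T := fun q ↦ partForm (lift q)) (fun q k ↦ contDiff_partForm _ k)
    (continuous_weight δ) nhdsWithin_le_nhds ?_ ?_
  · filter_upwards [self_mem_nhdsWithin] with c hc0 q
    rw [hc.chartMetric_eq (hG c), chartMetric_familyMetric_eq_sum (le_of_lt hc0) hδ]
  · intro q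
    rw [hc.chartMetric_eq h₀p, chartMetric_productMetric δ,
      chartMetric_familyMetric_eq_sum le_rfl hδ]

end IsChartCover

end ChartCover

end

end SecTheta

namespace SecTheta

noncomputable section

section ProjectivePlane

lemma isChartCover_id : IsChartCover (id : S2 × S2 → S2 × S2) id where
  symm_eq _ := rfl
  self_eq := extChartAt_S2_prod_self
  deck p := ⟨1, 1, by simp [antipodal], by funext p; simp [antipodal]⟩

/-- The points of the sphere at which the charts of the projective plane are centred. -/
def RP2.lift : RP2 → S2 :=
  (Function.Surjective.hasRightInverse
    (Quotient.mk_surjective (s := MulAction.orbitRel ℤˣ S2))).choose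

lemma RP2.proj_lift (q : RP2) : RP2.proj (RP2.lift q) = q :=
  (Function.Surjective.hasRightInverse
    (Quotient.mk_surjective (s := MulAction.orbitRel ℤˣ S2))).choose_spec q

lemma RP2.chartAt_eq (q : RP2) : chartAt E2 q =
    (RP2.isLocalHomeomorph_proj.localInverseAt (RP2.lift q)).trans (chartAt E2 (RP2.lift q)) := rfl

lemma RP2.chartAt_symm_apply (q : RP2) (w : E2) :
    (chartAt E2 q).symm w = RP2.proj ((chartAt E2 (RP2.lift q)).symm w) := by
  rw [RP2.chartAt_eq]
  exact congrFun (RP2.isLocalHomeomorph_proj.localInverseAt_symm (RP2.lift q)) _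

lemma RP2.chartAt_self (q : RP2) : chartAt E2 q q = 0 := by
  have h : RP2.isLocalHomeomorph_proj.localInverseAt (RP2.lift q) q = RP2.lift q := by
    conv_lhs => rw [← RP2.proj_lift q]
    rw [RP2.proj_lift]
    have := (RP2.isLocalHomeomorph_proj.localInverseAt (RP2.lift q)).right_inv
      RP2.isLocalHomeomorph_proj.self_mem_localInverseAt_target
    rw [RP2.isLocalHomeomorph_proj.localInverseAt_symm, RP2.proj_lift] at this
    exact this
  rw [RP2.chartAt_eq]
  change chartAt E2 (RP2.lift q) (RP2.isLocalHomeomorph_proj.localInverseAt (RP2.lift q) q) = 0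
  rw [h, chartAt_sphere_self]

lemma RP2.exists_smul_eq_lift (x : S2) : ∃ ε : ℤˣ, ε • x = RP2.lift (RP2.proj x) := by
  obtain ⟨ε, hε⟩ : RP2.lift (RP2.proj x) ∈ MulAction.orbit ℤˣ x :=
    Quotient.exact (RP2.proj_lift (RP2.proj x))
  exact ⟨ε, hε⟩

lemma RP2.proj_smul (ε : ℤˣ) (x : S2) : RP2.proj (ε • x) = RP2.proj x := Quotient.sound ⟨ε, rfl⟩

lemma isChartCover_coveringMap :
    IsChartCover coveringMap fun q ↦ (RP2.lift q.1, RP2.lift q.2) where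
  symm_eq q := by
    funext w
    rw [Function.comp, extChartAt_S2_prod_symm, extChartAt_prod]
    exact Prod.ext (RP2.chartAt_symm_apply q.1 w.1) (RP2.chartAt_symm_apply q.2 w.2)
  self_eq q := by
    rw [extChartAt_prod]
    exact Prod.ext (RP2.chartAt_self q.1) (RP2.chartAt_self q.2)
  deck p := by
    obtain ⟨ε₁, h₁⟩ := RP2.exists_smul_eq_lift p.1
    obtain ⟨ε₂, h₂⟩ := RP2.exists_smul_eq_lift p.2
    refine ⟨ε₁, ε₂, Prod.ext h₁ h₂, ?_⟩
    funext p
    exact Prod.ext (RP2.proj_smul _ _) (RP2.proj_smul _ _)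

end ProjectivePlane

section Retraction

/-- The radial projection to the sphere. -/
def radial (z : E3) : S2 :=
  if h : z = 0 then ⟨EuclideanSpace.single 0 1, by simp⟩ else
    ⟨‖z‖⁻¹ • z, by simp [norm_smul, h]⟩

lemma coe_radial {z : E3} (h : z ≠ 0) : (radial z : E3) = ‖z‖⁻¹ • z := by
  rw [radial, dif_neg h]

lemma radial_coe (x : S2) : radial (x : E3) = x := by
  refine Subtype.ext ?_
  rw [coe_radial (ne_zero_of_mem_unit_sphere x), norm_eq_of_mem_sphere, inv_one, one_smul]

lemma contMDiffAt_radial {z : E3} (hz : z ≠ 0) : ContMDiffAt 𝓘(ℝ, E3) (𝓡 2) ∞ radial z := by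
  have : Fact (finrank ℝ E3 = 2 + 1) := ⟨finrank_euclideanSpace_fin⟩
  have hev : ∀ᶠ y in 𝓝 z, (radial y : E3) = ‖y‖⁻¹ • y := by
    filter_upwards [isOpen_ne.mem_nhds hz] with y hy using coe_radial hy
  have hs : ContDiffAt ℝ ∞ (fun y : E3 ↦ (radial y : E3)) z :=
    (((contDiffAt_norm ℝ hz).inv (norm_ne_zero_iff.2 hz)).smul contDiffAt_id).congr_of_eventuallyEq
      hev
  rw [contMDiffAt_iff_target]
  refine ⟨Topology.IsInducing.subtypeVal.continuousAt_iff.2 hs.continuousAt, ?_⟩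
  set v := radial z
  let U := (OrthonormalBasis.fromOrthogonalSpanSingleton (𝕜 := ℝ) (E := E3) 2
    (ne_zero_of_mem_unit_sphere (-v))).repr
  have h1 : ContDiffAt ℝ ∞ (stereoToFun ((-v : S2) : E3)) (radial z : E3) := by
    refine (contDiffOn_stereoToFun.contDiffAt ?_).of_le le_top
    refine IsOpen.mem_nhds ?_ ?_
    · exact isOpen_ne.preimage (innerSL ℝ ((-v : S2) : E3)).continuous
    · simp [v]
      norm_num
  have h2 := (U.contDiff.contDiffAt.comp z (h1.comp z hs)).contMDiffAt
  exact h2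

end Retraction

end

end SecTheta

namespace SecTheta

noncomputable section

section Frames

/-- The retraction of a neighbourhood of `S² × S²`. -/
def retr (z : V6) : S2 × S2 := (radial z.fst, radial z.snd)

/-- The neighbourhood of `S² × S²` on which `retr` is smooth. -/
def retrDomain : Set V6 := {z | z.fst ≠ 0 ∧ z.snd ≠ 0}

lemma isOpen_retrDomain : IsOpen retrDomain :=
  (isOpen_ne.preimage (WithLp.fstL 2 ℝ E3 E3).continuous).inter
    (isOpen_ne.preimage (WithLp.sndL 2 ℝ E3 E3).continuous)

lemma contMDiffOn_retr : ContMDiffOn 𝓘(ℝ, V6) I4 ∞ retr retrDomain := by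
  intro z hz
  refine ContMDiffAt.contMDiffWithinAt (ContMDiffAt.prodMk ?_ ?_)
  · exact (contMDiffAt_radial hz.1).comp z (WithLp.fstL 2 ℝ E3 E3).contDiff.contMDiff.contMDiffAt
  · exact (contMDiffAt_radial hz.2).comp z (WithLp.sndL 2 ℝ E3 E3).contDiff.contMDiff.contMDiffAt

lemma prodEmb_mem_retrDomain (p : S2 × S2) : prodEmb p ∈ retrDomain :=
  ⟨ne_zero_of_mem_unit_sphere p.1, ne_zero_of_mem_unit_sphere p.2⟩

lemma retr_prodEmb (p : S2 × S2) : retr (prodEmb p) = p :=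
  Prod.ext (radial_coe p.1) (radial_coe p.2)

lemma OrthoFrame.exists_prodEmb_eq {z u v : V6} (h : OrthoFrame z u v) : ∃ p, prodEmb p = z := by
  have key (a : E3) (ha : dot a a = 1) : a ∈ Metric.sphere (0 : E3) 1 := by
    rw [← inner_eq_dot, real_inner_self_eq_norm_sq] at ha
    rw [mem_sphere_zero_iff_norm]
    nlinarith [norm_nonneg a]
  exact ⟨(⟨z.fst, key _ h.xx⟩, ⟨z.snd, key _ h.yy⟩), rfl⟩

lemma hasFDerivAt_prodEmb_chart (p : S2 × S2) :
    ∃ L : E2 × E2 →L[ℝ] V6, HasFDerivAt (prodEmb ∘ (extChartAt I4 p).symm) L 0 ∧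
      ∀ u, L u = prodFrame p u := by
  have hd := (differentiable_prodEmb_chart p 0).hasFDerivAt
  refine ⟨_, hd, fun u ↦ ?_⟩
  refine WithLp.ofLp_injective _ (Prod.ext ?_ ?_)
  · ext i
    have h1 := (((EuclideanSpace.proj i : E3 →L[ℝ] ℝ) ∘L (WithLp.fstL 2 ℝ E3 E3)).hasFDerivAt.comp
      0 hd).fderiv
    have h2 := (hasJet_fst p i).d u
    have e : (fun w : E2 × E2 ↦ sphereParam p.1 w.1 i) =
        ((EuclideanSpace.proj i : E3 →L[ℝ] ℝ) ∘L (WithLp.fstL 2 ℝ E3 E3)) ∘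
          prodEmb ∘ (extChartAt I4 p).symm := by
      funext w
      rw [Function.comp, Function.comp, extChartAt_S2_prod_symm]
      rfl
    rw [e, h1] at h2
    exact h2
  · ext i
    have h1 := (((EuclideanSpace.proj i : E3 →L[ℝ] ℝ) ∘L (WithLp.sndL 2 ℝ E3 E3)).hasFDerivAt.comp
      0 hd).fderiv
    have h2 := (hasJet_snd p i).d u
    have e : (fun w : E2 × E2 ↦ sphereParam p.2 w.2 i) =
        ((EuclideanSpace.proj i : E3 →L[ℝ] ℝ) ∘L (WithLp.sndL 2 ℝ E3 E3)) ∘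
          prodEmb ∘ (extChartAt I4 p).symm := by
      funext w
      rw [Function.comp, Function.comp, extChartAt_S2_prod_symm]
      rfl
    rw [e, h1] at h2
    exact h2

lemma map_prodFrame (p : S2 × S2) (s t : ℝ) (u v : E2 × E2) :
    prodFrame p (s • u + t • v) = s • prodFrame p u + t • prodFrame p v := by
  refine WithLp.ofLp_injective _ (Prod.ext ?_ ?_)
  · exact (map_add (sphereFrame p.1) _ _).trans (congrArg₂ _ (map_smul _ _ _) (map_smul _ _ _))
  · exact (map_add (sphereFrame p.2) _ _).trans (congrArg₂ _ (map_smul _ _ _) (map_smul _ _ _))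

lemma isCompact_frameSet : IsCompact frameSet := by
  refine Metric.isCompact_of_isClosed_isBounded ?_ ?_
  · have z : Continuous fun w : V6 × V6 × V6 ↦ w.1 := by fun_prop
    have u : Continuous fun w : V6 × V6 × V6 ↦ w.2.1 := by fun_prop
    have v : Continuous fun w : V6 × V6 × V6 ↦ w.2.2 := by fun_prop
    have f := (WithLp.fstL 2 ℝ E3 E3).continuous
    have s := (WithLp.sndL 2 ℝ E3 E3).continuous
    have e : frameSet = {w | (inner ℝ w.1.fst w.1.fst = (1 : ℝ) ∧ inner ℝ w.1.snd w.1.snd = (1 : ℝ)) ∧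
        ((inner ℝ w.1.fst w.2.1.fst = (0 : ℝ) ∧ inner ℝ w.1.snd w.2.1.snd = (0 : ℝ)) ∧
        (inner ℝ w.1.fst w.2.2.fst = (0 : ℝ) ∧ inner ℝ w.1.snd w.2.2.snd = (0 : ℝ))) ∧
        inner ℝ w.2.1 w.2.1 = (1 : ℝ) ∧ inner ℝ w.2.2 w.2.2 = (1 : ℝ) ∧
        inner ℝ w.2.1 w.2.2 = (0 : ℝ)} := by
      ext w
      simp only [mem_ofPred_eq, inner_eq_dot]
      constructor
      · rintro ⟨a, b, c, d, e, f, g⟩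
        exact ⟨⟨a, b⟩, ⟨c, d⟩, e, f, g⟩
      · rintro ⟨⟨a, b⟩, ⟨c, d⟩, e, f, g⟩
        exact ⟨a, b, c, d, e, f, g⟩
    have zf := f.comp z
    have zs := s.comp z
    have uf := f.comp u
    have us := s.comp u
    have vf := f.comp v
    have vs := s.comp v
    rw [e]
    refine .inter (.inter ?_ ?_) (.inter (.inter (.inter ?_ ?_) (.inter ?_ ?_))
      (.inter ?_ (.inter ?_ ?_)))
    · exact isClosed_eq (zf.inner zf) continuous_const
    · exact isClosed_eq (zs.inner zs) continuous_const
    · exact isClosed_eq (zf.inner uf) continuous_const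
    · exact isClosed_eq (zs.inner us) continuous_const
    · exact isClosed_eq (zf.inner vf) continuous_const
    · exact isClosed_eq (zs.inner vs) continuous_const
    · exact isClosed_eq (u.inner u) continuous_const
    · exact isClosed_eq (v.inner v) continuous_const
    · exact isClosed_eq (u.inner v) continuous_const
  · refine (Metric.isBounded_closedBall (x := (0 : V6 × V6 × V6)) (r := 2)).subset ?_
    intro w hw
    obtain ⟨nz, nu, nv⟩ := OrthoFrame.norm_le hw
    rw [mem_closedBall_zero_iff, Prod.norm_def, Prod.norm_def]
    exact max_le nz (max_le (nu.trans one_le_two) (nv.trans one_le_two))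

end Frames

section PlaneMap

variable {N : Type*} [TopologicalSpace N] [ChartedSpace (ModelProd E2 E2) N] [IsManifold I4 ∞ N]
  {cov : S2 × S2 → N}

lemma mfderiv_comp_retr (hs : MDifferentiable I4 I4 cov) (p : S2 × S2) (u : E2 × E2) :
    (mfderiv 𝓘(ℝ, V6) I4 (cov ∘ retr) (prodEmb p) (prodFrame p u) : E2 × E2) =
      mfderiv I4 I4 cov p u := by
  obtain ⟨L, hL, hLu⟩ := hasFDerivAt_prodEmb_chart p
  have h0 := extChartAt_S2_prod_self p
  have hp : (extChartAt I4 p).symm 0 = p := by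
    rw [← h0]
    exact (extChartAt I4 p).left_inv (mem_extChartAt_source p)
  have h1 := hasMFDerivAt_extChartAt_symm_self (I := I4) p
  rw [h0] at h1
  have h2 := (hs ((extChartAt I4 p).symm 0)).hasMFDerivAt.comp 0 h1
  have h3 : MDifferentiableAt 𝓘(ℝ, V6) I4 (cov ∘ retr)
      ((prodEmb ∘ (extChartAt I4 p).symm) 0) :=
    (hs _).comp _ ((contMDiffOn_retr.contMDiffAt (isOpen_retrDomain.mem_nhds
      (prodEmb_mem_retrDomain _))).mdifferentiableAt (by simp))
  have h4 := h3.hasMFDerivAt.comp 0 hL.hasMFDerivAt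
  have e : (cov ∘ retr) ∘ prodEmb ∘ (extChartAt I4 p).symm = cov ∘ (extChartAt I4 p).symm := by
    funext w
    exact congrArg cov (retr_prodEmb _)
  rw [e] at h4
  have h5 := hasMFDerivAt_unique h4 h2
  have hq : (prodEmb ∘ (extChartAt I4 p).symm) 0 = prodEmb p := congrArg prodEmb hp
  rw [hp, hq] at h5
  have h6 := congrArg (fun A : E2 × E2 →L[ℝ] E2 × E2 ↦ A u) h5
  rw [← hLu]
  exact h6

/-- The plane of a quotient of `S² × S²` that corresponds to a frame in `ℝ⁶`. -/
def frameMap (hs : MDifferentiable I4 I4 cov) (hinj : ∀ p, Function.Injective (mfderiv I4 I4 cov p))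
    (w : frameSet) : TangentFrame I4 N where
  pt := (cov ∘ retr) w.1.1
  fst := mfderiv 𝓘(ℝ, V6) I4 (cov ∘ retr) w.1.1 w.1.2.1
  snd := mfderiv 𝓘(ℝ, V6) I4 (cov ∘ retr) w.1.1 w.1.2.2
  linInd := by
    obtain ⟨⟨z, U, V⟩, hw⟩ := w
    have hw' : OrthoFrame z U V := hw
    obtain ⟨p, rfl⟩ := hw'.exists_prodEmb_eq
    rw [LinearIndependent.pair_iff]
    intro s t hst
    let D : V6 →L[ℝ] E2 × E2 := mfderiv 𝓘(ℝ, V6) I4 (cov ∘ retr) (prodEmb p)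
    have hst' : s • D U + t • D V = 0 := hst
    obtain ⟨u, hu⟩ := exists_prodFrame_eq p hw'.tu
    obtain ⟨v, hv⟩ := exists_prodFrame_eq p hw'.tv
    have e : s • U + t • V = prodFrame p (s • u + t • v) := by
      rw [← hu, ← hv, map_prodFrame]
    rw [← map_smul, ← map_smul, ← map_add, e] at hst'
    have h1 : s • u + t • v = 0 := by
      refine hinj p (Eq.trans ?_ (map_zero (mfderiv I4 I4 cov p)).symm)
      exact (mfderiv_comp_retr hs p (s • u + t • v)).symm.trans hst'
    have h2 : s • U + t • V = 0 := by
      rw [e, h1]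
      exact WithLp.ofLp_injective _ (Prod.ext (map_zero (sphereFrame p.1)) (map_zero (sphereFrame p.2)))
    have h3 := congrArg (inner ℝ U) h2
    have h4 := congrArg (inner ℝ V) h2
    rw [inner_add_right, inner_smul_right, inner_smul_right, hw'.uu, hw'.uv, inner_zero_right] at h3
    rw [inner_add_right, inner_smul_right, inner_smul_right, hw'.vv, real_inner_comm, hw'.uv,
      inner_zero_right] at h4
    constructor <;> linarith

lemma continuous_frameMap (hs : ContMDiff I4 I4 ∞ cov)
    (hinj : ∀ p, Function.Injective (mfderiv I4 I4 cov p)) :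
    Continuous (frameMap (hs.mdifferentiable (by simp)) hinj) := by
  have hφ : ContMDiffOn 𝓘(ℝ, V6) I4 ∞ (cov ∘ retr) retrDomain :=
    hs.comp_contMDiffOn contMDiffOn_retr
  have hT := hφ.continuousOn_tangentMapWithin (by simp) isOpen_retrDomain.uniqueMDiffOn
  have key (f : frameSet → V6) (hf : Continuous f) : Continuous fun w : frameSet ↦
      (⟨(cov ∘ retr) w.1.1, mfderiv 𝓘(ℝ, V6) I4 (cov ∘ retr) w.1.1 (f w)⟩ : TangentBundle I4 N) := by
    have hmem (w : frameSet) : w.1.1 ∈ retrDomain := by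
      obtain ⟨p, hp⟩ := OrthoFrame.exists_prodEmb_eq w.2
      rw [← hp]
      exact prodEmb_mem_retrDomain p
    have hg : Continuous fun w : frameSet ↦ (⟨w.1.1, f w⟩ : TangentBundle 𝓘(ℝ, V6) V6) := by
      have h1 : Continuous fun w : frameSet ↦ ((w.1.1, f w) : ModelProd V6 V6) :=
        (continuous_fst.comp continuous_subtype_val).prodMk hf
      have h2 := (tangentBundleModelSpaceHomeomorph 𝓘(ℝ, V6)).symm.continuous.comp h1
      rw [tangentBundleModelSpaceHomeomorph_coe_symm] at h2
      exact h2
    have h3 := hT.comp_continuous hg hmem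
    refine h3.congr fun w ↦ ?_
    change (⟨_, mfderivWithin 𝓘(ℝ, V6) I4 (cov ∘ retr) retrDomain w.1.1 (f w)⟩ :
      TangentBundle I4 N) = _
    rw [mfderivWithin_of_isOpen isOpen_retrDomain (hmem w)]
  refine continuous_induced_rng.2 (Continuous.prodMk ?_ ?_)
  · exact key (fun w ↦ w.1.2.1) (by fun_prop)
  · exact key (fun w ↦ w.1.2.2) (by fun_prop)

lemma TangentPlane.ext_of_le {E : Type*} [NormedAddCommGroup E] [NormedSpace ℝ E]
    [FiniteDimensional ℝ E] {H : Type*} [TopologicalSpace H] {I : ModelWithCorners ℝ E H} {M : Type*}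
    [TopologicalSpace M] [ChartedSpace H M] {σ τ : TangentPlane I M} (h : σ.pt = τ.pt)
    (hle : (σ.plane : Submodule ℝ E) ≤ τ.plane) : σ = τ := by
  obtain ⟨p, S, hS⟩ := σ
  obtain ⟨q, T, hT⟩ := τ
  obtain rfl : p = q := h
  have : FiniteDimensional ℝ (TangentSpace I p) := inferInstanceAs (FiniteDimensional ℝ E)
  obtain rfl : S = T := Submodule.eq_of_le_of_finrank_eq hle (hS.trans hT.symm)
  rfl

/-- Frames that span the same plane in `ℝ⁶` define the same tangent plane. -/
lemma span_frameMap_eq (hs : MDifferentiable I4 I4 cov)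
    (hinj : ∀ p, Function.Injective (mfderiv I4 I4 cov p)) {w w' : frameSet} (h : w.1.1 = w'.1.1)
    (hsp : Submodule.span ℝ {w.1.2.1, w.1.2.2} = Submodule.span ℝ {w'.1.2.1, w'.1.2.2}) :
    (frameMap hs hinj w).span = (frameMap hs hinj w').span := by
  obtain ⟨⟨z, U, V⟩, hw⟩ := w
  obtain ⟨⟨z', U', V'⟩, hw'⟩ := w'
  obtain rfl : z = z' := h
  refine TangentPlane.ext_of_le rfl ?_
  let D : V6 →L[ℝ] E2 × E2 := mfderiv 𝓘(ℝ, V6) I4 (cov ∘ retr) z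
  have key (U V : V6) : Submodule.span ℝ (range ![D U, D V]) =
      (Submodule.span ℝ {U, V}).map (D : V6 →ₗ[ℝ] E2 × E2) := by
    rw [Submodule.map_span, image_pair, Matrix.range_cons, Matrix.range_cons, Matrix.range_empty,
      union_empty]
    rfl
  change Submodule.span ℝ (range ![D U, D V]) ≤ Submodule.span ℝ (range ![D U', D V'])
  rw [key, key]
  exact (congrArg _ hsp).le

end PlaneMap

end

end SecTheta

namespace SecTheta

noncomputable section

section Planes

lemma exists_orthonormal_combination {V : Type*} [NormedAddCommGroup V] [InnerProductSpace ℝ V]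
    {A B : V} (h : LinearIndependent ℝ ![A, B]) : ∃ a c d : ℝ, a ≠ 0 ∧ d ≠ 0 ∧
      inner ℝ (a • A) (a • A) = (1 : ℝ) ∧ inner ℝ (c • A + d • B) (c • A + d • B) = (1 : ℝ) ∧
      inner ℝ (a • A) (c • A + d • B) = (0 : ℝ) := by
  rw [LinearIndependent.pair_iff] at h
  have hA : A ≠ 0 := fun h0 ↦ one_ne_zero (h 1 0 (by simp [h0])).1
  set r : ℝ := -(inner ℝ A B / inner ℝ A A) with hr
  have hC : r • A + B ≠ 0 := fun h0 ↦ one_ne_zero (h r 1 (by simpa using h0)).2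
  have hAA : 0 < (inner ℝ A A : ℝ) := real_inner_self_pos.2 hA
  have hCC : 0 < ‖r • A + B‖ := norm_pos_iff.2 hC
  have hn (v : V) (hv : v ≠ 0) : inner ℝ (‖v‖⁻¹ • v) (‖v‖⁻¹ • v) = (1 : ℝ) := by
    rw [real_inner_self_eq_norm_sq, norm_smul, norm_inv, norm_norm,
      inv_mul_cancel₀ (norm_ne_zero_iff.2 hv), one_pow]
  have e : (‖r • A + B‖⁻¹ * r) • A + ‖r • A + B‖⁻¹ • B = ‖r • A + B‖⁻¹ • (r • A + B) := by
    rw [smul_add, smul_smul]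
  refine ⟨‖A‖⁻¹, ‖r • A + B‖⁻¹ * r, ‖r • A + B‖⁻¹, inv_ne_zero (norm_ne_zero_iff.2 hA),
    inv_ne_zero hCC.ne', hn A hA, ?_, ?_⟩
  · rw [e, hn _ hC]
  · rw [e, inner_smul_left, inner_smul_right, inner_add_right, inner_smul_right, hr]
    field_simp
    simp

lemma chartMetric_self {E : Type*} [NormedAddCommGroup E] [NormedSpace ℝ E]
    {H : Type*} [TopologicalSpace H] {I : ModelWithCorners ℝ E H} [I.Boundaryless] {M : Type*}
    [TopologicalSpace M] [ChartedSpace H M] [IsManifold I ∞ M] (h : SmoothMetric I M) (p : M)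
    (u v : TangentSpace I p) : chartMetric h p (extChartAt I p p) u v = h.inner p u v := by
  have hE := (hasMFDerivAt_extChartAt_symm_self (I := I) p).mfderiv
  have key : ∀ q, q = p → (h.inner q : E →L[ℝ] E →L[ℝ] ℝ) u v = h.inner p u v := by
    rintro _ rfl
    rfl
  have hw (w : E) : (mfderiv 𝓘(ℝ, E) I (extChartAt I p).symm (extChartAt I p p) w : E) = w :=
    congrArg (fun A : E →L[ℝ] E ↦ A w) hE
  exact (congrArg₂ (fun x y ↦ (h.inner ((extChartAt I p).symm (extChartAt I p p)) :
    E →L[ℝ] E →L[ℝ] ℝ) x y) (hw u) (hw v)).trans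
      (key _ ((extChartAt I p).left_inv (mem_extChartAt_source p)))

lemma exists_jetMetric_bound : ∃ C, 0 ≤ C ∧ ∀ c δ, 0 ≤ c → c ≤ 1 → 0 ≤ δ → δ ≤ 1 → ∀ z e e' : V6,
    ‖z‖ ≤ 2 → ‖e‖ ≤ 1 → ‖e'‖ ≤ 1 → |jetMetricOne c δ z e e'| ≤ C := by
  obtain ⟨C, hC1, hC⟩ := exists_bound_jet
  refine ⟨7 * Fintype.card Idx * C ^ 2, by positivity, fun c δ hc hc1 hδ hδ1 z e e' hz he he' ↦ ?_⟩
  refine (abs_sum_le_card (abs_weightOne_le hc hc1 hδ hδ1) (fun k ↦ (hC k z hz).1 e)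
    (fun k ↦ (hC k z hz).1 e') (by positivity)).trans ?_
  have : ‖e‖ * ‖e'‖ ≤ 1 := mul_le_one₀ he (norm_nonneg _) he'
  calc _ = 7 * Fintype.card Idx * C ^ 2 * (‖e‖ * ‖e'‖) := by ring
    _ ≤ 7 * Fintype.card Idx * C ^ 2 * 1 := by gcongr
    _ = _ := mul_one _

variable {N : Type*} [TopologicalSpace N] [ChartedSpace (ModelProd E2 E2) N] [IsManifold I4 ∞ N]
  {cov : S2 × S2 → N} {lift : N → S2 × S2}

namespace IsChartCover

lemma injective (hc : IsChartCover cov lift) (p : S2 × S2) :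
    Function.Injective (mfderiv I4 I4 cov p) :=
  injective_mfderiv (hc.isPullback_descend contMDiff_prodEmb injective_mvfderiv_prodEmb
    isAntipodalInvariant_productMetric) p

/-- The tangent plane that corresponds to a frame in `ℝ⁶`. -/
def planeMap (hc : IsChartCover cov lift) (w : frameSet) : TangentPlane I4 N :=
  (frameMap hc.mdifferentiable hc.injective w).span

lemma continuous_planeMap (hc : IsChartCover cov lift) : Continuous hc.planeMap :=
  continuous_coinduced_rng.comp (continuous_frameMap hc.contMDiff hc.injective)

/-- Every plane is spanned by an orthonormal frame in `ℝ⁶`. -/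
lemma exists_frame (hc : IsChartCover cov lift) (σ : TangentPlane I4 N) :
    ∃ u ∈ σ.plane, ∃ v ∈ σ.plane,
      ∃ hw : (prodEmb (lift σ.pt), prodFrame (lift σ.pt) u, prodFrame (lift σ.pt) v) ∈ frameSet,
        hc.planeMap ⟨_, hw⟩ = σ ∧ ∀ c δ, 0 ≤ c → 0 ≤ δ → ∀ h, IsPullback cov h (familyMetric c δ) →
          IsSec c δ (prodEmb (lift σ.pt)) (prodFrame (lift σ.pt) u) (prodFrame (lift σ.pt) v)
            (sec h σ) := by
  set p := lift σ.pt with hp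
  let b₀ : E2 × E2 := (σ.basis 0 : TangentSpace I4 σ.pt)
  let b₁ : E2 × E2 := (σ.basis 1 : TangentSpace I4 σ.pt)
  have hb : ∀ s t : ℝ, s • b₀ + t • b₁ = 0 → s = 0 ∧ t = 0 := by
    intro s t hst
    have h1 := σ.basis.linearIndependent
    have h2 : LinearIndependent ℝ ![σ.basis 0, σ.basis 1] := by
      convert h1 using 1
      ext i
      fin_cases i <;> rfl
    exact LinearIndependent.pair_iff.1 h2 s t (Subtype.ext hst)
  have hind : LinearIndependent ℝ ![prodFrame p b₀, prodFrame p b₁] := by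
    refine LinearIndependent.pair_iff.2 fun s t hst ↦ hb s t ?_
    rw [← map_prodFrame] at hst
    exact injective_prodFrame p hst
  obtain ⟨a, c', d', ha, hd, h1, h2, h3⟩ := exists_orthonormal_combination hind
  have e0 : a • prodFrame p b₀ = prodFrame p (a • b₀ + (0 : ℝ) • b₁) := by
    rw [map_prodFrame, zero_smul, add_zero]
  rw [← map_prodFrame] at h2 h3
  rw [e0] at h1 h3
  have hmem (s t : ℝ) : (s • b₀ + t • b₁ : E2 × E2) ∈ σ.plane :=
    σ.plane.add_mem (σ.plane.smul_mem s (σ.basis 0).2) (σ.plane.smul_mem t (σ.basis 1).2)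
  have hw : (prodEmb p, prodFrame p (a • b₀ + (0 : ℝ) • b₁), prodFrame p (c' • b₀ + d' • b₁))
      ∈ frameSet :=
    { xx := by simp [prodEmb, ← inner_eq_dot]
      yy := by simp [prodEmb, ← inner_eq_dot]
      tu := isTan_prodFrame p _
      tv := isTan_prodFrame p _
      uu := h1
      vv := h2
      uv := h3 }
  refine ⟨a • b₀ + (0 : ℝ) • b₁, hmem _ _, c' • b₀ + d' • b₁, hmem _ _, hw, ?_, ?_⟩
  · refine TangentPlane.ext_of_le ?_ ?_
    · change cov (retr (prodEmb p)) = σ.pt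
      rw [retr_prodEmb, hp, hc.cov_lift]
    · have key (u : E2 × E2) (hu : u ∈ σ.plane) :
          (mfderiv 𝓘(ℝ, V6) I4 (cov ∘ retr) (prodEmb p) (prodFrame p u) : E2 × E2) ∈ σ.plane := by
        rw [mfderiv_comp_retr hc.mdifferentiable, hp, hc.mfderiv_lift]
        exact hu
      let D : V6 →L[ℝ] E2 × E2 := mfderiv 𝓘(ℝ, V6) I4 (cov ∘ retr) (prodEmb p)
      change Submodule.span ℝ (range ![D (prodFrame p (a • b₀ + (0 : ℝ) • b₁)),
        D (prodFrame p (c' • b₀ + d' • b₁))]) ≤ (σ.plane : Submodule ℝ (E2 × E2))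
      refine (Submodule.span_le (p := (σ.plane : Submodule ℝ (E2 × E2)))).2 ?_
      rintro _ ⟨i, rfl⟩
      fin_cases i
      · exact key _ (hmem _ _)
      · exact key _ (hmem _ _)
  · intro c δ hc0 hδ h hh
    have h4 := isSec_coordSec hc0 hδ p (a • b₀ + (0 : ℝ) • b₁) (c' • b₀ + d' • b₁)
    rw [coordSec_inducedForm_combination (contDiff_chartMap c δ p)
      (injective_fderiv_chartMap hc0 hδ p) b₀ b₁ (by simp [ha, hd])] at h4
    rw [hc.sec_eq hh]
    exact h4

/-- `sec^θ > 0` for suitable parameters. -/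
theorem exists_secThetaPos (hc : IsChartCover cov lift) {d : MetricSpace (TangentPlane I4 N)}
    (hd : InducesStandardTopology d) {θ : ℝ} (hθ : 0 < θ) :
    ∃ δ, 0 ≤ δ ∧ ∃ c₁ > 0, ∀ c, 0 < c → c < c₁ → ∀ h, IsPullback cov h (familyMetric c δ) →
      SecThetaPos d θ h := by
  have : CompactSpace frameSet := isCompact_iff_compactSpace.1 isCompact_frameSet
  let Z : Set (frameSet × frameSet) := {w | w.1.1.1 = w.2.1.1} ∩
    {w | θ ≤ d.dist (hc.planeMap w.1) (hc.planeMap w.2)}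
  have hdist : Continuous fun w : frameSet × frameSet ↦
      d.dist (hc.planeMap w.1) (hc.planeMap w.2) := by
    have h1 : @Continuous _ _ _ d.toPseudoMetricSpace.toUniformSpace.toTopologicalSpace
        hc.planeMap := by
      rw [hd]
      exact hc.continuous_planeMap
    exact @Continuous.dist _ _ d.toPseudoMetricSpace _ _ _
      (@Continuous.comp _ _ _ _ _ d.toPseudoMetricSpace.toUniformSpace.toTopologicalSpace
        Prod.fst hc.planeMap h1 continuous_fst)
      (@Continuous.comp _ _ _ _ _ d.toPseudoMetricSpace.toUniformSpace.toTopologicalSpace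
        Prod.snd hc.planeMap h1 continuous_snd)
  have hZ : IsCompact Z := by
    refine IsClosed.isCompact (IsClosed.inter (isClosed_eq ?_ ?_) (isClosed_le continuous_const hdist))
    · fun_prop
    · fun_prop
  have hval : Continuous fun w : frameSet × frameSet ↦ (w.1.1, w.2.1) := by fun_prop
  obtain ⟨δ, hδ, -, c₁, hc₁, hpos⟩ := exists_parameters (hZ.image hval)
    (by rintro _ ⟨w, -, rfl⟩; exact ⟨w.1.2, w.2.2⟩)
    (by rintro _ ⟨w, hw, rfl⟩; exact hw.1)
    (by
      rintro _ ⟨w, hw, rfl⟩ hsp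
      have h1 : hc.planeMap w.1 = hc.planeMap w.2 :=
        span_frameMap_eq hc.mdifferentiable hc.injective hw.1 hsp
      have h2 := hw.2
      simp only [mem_ofPred_eq, h1] at h2
      have h3 : d.dist (hc.planeMap w.2) (hc.planeMap w.2) = 0 :=
        d.toPseudoMetricSpace.dist_self _
      linarith)
  refine ⟨δ, hδ, c₁, hc₁, fun c hc0 hcc h hh σ τ hστ hdθ ↦ ?_⟩
  obtain ⟨u, -, v, -, hw, hσ, hsec⟩ := hc.exists_frame σ
  obtain ⟨u', -, v', -, hw', hτ, hsec'⟩ := hc.exists_frame τ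
  have := hpos c hc0 hcc _ ⟨(⟨_, hw⟩, ⟨_, hw'⟩), ⟨by simp [hστ], by
    change θ ≤ d.dist (hc.planeMap _) (hc.planeMap _)
    rwa [hσ, hτ]⟩, rfl⟩ _ _ (hsec c δ hc0.le hδ h hh) (hsec' c δ hc0.le hδ h hh)
  linarith

/-- `sec^⊥ > 0` for suitable parameters. -/
theorem exists_secPerp_pos (hc : IsChartCover cov lift) :
    ∃ c δ : ℝ, ∀ h : SmoothMetric I4 N, IsPullback cov h (familyMetric c δ) →
      ∀ σ, 0 < secPerp h σ := by
  have : CompactSpace frameSet := isCompact_iff_compactSpace.1 isCompact_frameSet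
  let Z : Set (frameSet × frameSet) := {w | w.1.1.1 = w.2.1.1} ∩
    ({w | |inner ℝ w.1.1.2.1 w.2.1.2.1| ≤ (1 / 2 : ℝ)} ∩
      {w | |inner ℝ w.1.1.2.1 w.2.1.2.2| ≤ (1 / 2 : ℝ)})
  have hZ : IsCompact Z := by
    refine IsClosed.isCompact (IsClosed.inter (isClosed_eq ?_ ?_)
      (IsClosed.inter (isClosed_le ?_ continuous_const) (isClosed_le ?_ continuous_const)))
    all_goals fun_prop
  have hval : Continuous fun w : frameSet × frameSet ↦ (w.1.1, w.2.1) := by fun_prop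
  obtain ⟨δ, hδ, hδ1, c₁, hc₁, hpos⟩ := exists_parameters (hZ.image hval)
    (by rintro _ ⟨w, -, rfl⟩; exact ⟨w.1.2, w.2.2⟩)
    (by rintro _ ⟨w, hw, rfl⟩; exact hw.1)
    (by
      rintro _ ⟨⟨⟨⟨z, U, V⟩, h1⟩, ⟨⟨z', U', V'⟩, h2⟩⟩, ⟨hz, ⟨h3, h4⟩⟩, rfl⟩ hsp
      simp only [mem_ofPred_eq] at h3 h4 hsp
      have hU : U ∈ Submodule.span ℝ {U', V'} := by
        rw [← hsp]
        exact Submodule.subset_span (by simp)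
      obtain ⟨a, b, hab⟩ := Submodule.mem_span_pair.1 hU
      have f1 : OrthoFrame z U V := h1
      have f2 : OrthoFrame z' U' V' := h2
      have i1 : inner ℝ U U' = a := by
        rw [← hab, inner_add_left, inner_smul_left, inner_smul_left, f2.uu,
          real_inner_comm, f2.uv]
        simp
      have i2 : inner ℝ U V' = b := by
        rw [← hab, inner_add_left, inner_smul_left, inner_smul_left, f2.vv, f2.uv]
        simp
      have i3 : a * a + b * b = 1 := by
        have := inner_add_right (𝕜 := ℝ) U (a • U') (b • V')
        rw [hab, f1.uu, inner_smul_right, inner_smul_right, i1, i2] at this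
        exact this.symm
      rw [i1] at h3
      rw [i2] at h4
      nlinarith [abs_le.1 h3, abs_le.1 h4])
  obtain ⟨C, hC0, hC⟩ := exists_jetMetric_bound
  obtain ⟨c, hc0, hc1, hcc, hcC⟩ : ∃ c : ℝ, 0 < c ∧ c ≤ 1 ∧ c < c₁ ∧ c * C ≤ 1 / 2 := by
    refine ⟨min (c₁ / 2) (1 / (2 * (C + 1))), by positivity, ?_, ?_, ?_⟩
    · refine (min_le_right _ _).trans ?_
      rw [div_le_one (by positivity)]
      linarith
    · exact (min_le_left _ _).trans_lt (by linarith)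
    · calc _ ≤ 1 / (2 * (C + 1)) * C := by gcongr; exact min_le_right _ _
        _ ≤ 1 / 2 := by
          rw [div_mul_eq_mul_div, div_le_div_iff₀ (by positivity) (by positivity)]
          linarith
  refine ⟨c, δ, fun h hh σ ↦ ?_⟩
  obtain ⟨u, hu, v, -, hw, -, hsec⟩ := hc.exists_frame σ
  obtain ⟨u', hu', v', hv', hw', -, hsec'⟩ := hc.exists_frame (σ.orth h)
  change u' ∈ perp h σ.pt σ.plane at hu'
  change v' ∈ perp h σ.pt σ.plane at hv'
  have hbd (x y : E2 × E2) (hx : ‖prodFrame (lift σ.pt) x‖ ≤ 1) (hy : ‖prodFrame (lift σ.pt) y‖ ≤ 1)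
      (hxy : h.inner σ.pt x y = 0) :
      |inner ℝ (prodFrame (lift σ.pt) x) (prodFrame (lift σ.pt) y)| ≤ (1 / 2 : ℝ) := by
    have h1 : jetMetric c δ (prodEmb (lift σ.pt)) (prodFrame (lift σ.pt) x)
        (prodFrame (lift σ.pt) y) = 0 := by
      rw [← inducedForm_chartMap hc0.le hδ, ← chartMetric_familyMetric, ← hc.chartMetric_eq hh,
        ← hc.self_eq σ.pt]
      exact (chartMetric_self h σ.pt x y).trans hxy
    have h2 := hC c δ hc0.le hc1 hδ hδ1 (prodEmb (lift σ.pt)) _ _ (OrthoFrame.norm_le hw).1 hx hy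
    rw [jetMetric_eq] at h1
    rw [eq_neg_of_add_eq_zero_left h1, abs_neg, abs_mul, abs_of_pos hc0]
    exact (mul_le_mul_of_nonneg_left h2 hc0.le).trans hcC
  have := hpos c hc0 hcc _ ⟨(⟨_, hw⟩, ⟨_, hw'⟩), ⟨rfl,
    hbd _ _ (OrthoFrame.norm_le hw).2.1 (OrthoFrame.norm_le hw').2.1 (hu' u hu),
    hbd _ _ (OrthoFrame.norm_le hw).2.1 (OrthoFrame.norm_le hw').2.2 (hv' u hu)⟩, rfl⟩ _ _
    (hsec c δ hc0.le hδ h hh) (hsec' c δ hc0.le hδ h hh)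
  rw [secPerp]
  linarith

/-- Metrics with `sec^θ > 0` in every neighbourhood of the product metric. -/
theorem exists_secThetaPos_mem (hc : IsChartCover cov lift) {h₀ : SmoothMetric I4 N}
    (hp : IsPullback cov h₀ productMetric) {d : MetricSpace (TangentPlane I4 N)}
    (hd : InducesStandardTopology d) {θ : ℝ} (hθ : 0 < θ) (k : ℕ) {U : Set (SmoothMetric I4 N)}
    (hU : IsOpen[CkTopology I4 N k] U) (h₀U : h₀ ∈ U) : ∃ c δ, ∃ h ∈ U,
      IsPullback cov h (familyMetric c δ) ∧ SecThetaPos d θ h := by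
  obtain ⟨δ, hδ, c₁, hc₁, hpos⟩ := hc.exists_secThetaPos hd hθ
  let G (c : ℝ) : SmoothMetric I4 N := hc.descend (contMDiff_familyMap c δ)
    (injective_mvfderiv_familyMap c δ) (isAntipodalInvariant_familyMetric c δ)
  have hG (c : ℝ) : IsPullback cov (G c) (familyMetric c δ) := hc.isPullback_descend _ _ _
  have h1 := hc.tendsto_family k hδ hG hp
  have h2 {X : Type _} {t : TopologicalSpace X} {x : X} {V : Set X} (hV : IsOpen V) (hx : x ∈ V)
      {f : ℝ → X} (hf : Filter.Tendsto f (𝓝[>] 0) (𝓝 x)) : ∃ c, f c ∈ V ∧ c ∈ Ioo 0 c₁ :=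
    ((hf.eventually (hV.mem_nhds hx)).and (Ioo_mem_nhdsGT hc₁)).exists
  obtain ⟨c, hcU, hc0⟩ := h2 hU h₀U h1
  exact ⟨c, δ, G c, hcU, hG c, hpos c hc0.1 hc0.2 _ (hG c)⟩

end IsChartCover

end Planes

end

end SecTheta

namespace SecTheta

section Identity

lemma isPullback_id {E : Type*} [NormedAddCommGroup E] [NormedSpace ℝ E]
    {H : Type*} [TopologicalSpace H] {I : ModelWithCorners ℝ E H} {M : Type*}
    [TopologicalSpace M] [ChartedSpace H M] [IsManifold I ∞ M] (g : SmoothMetric I M) :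
    IsPullback id g g := by
  intro p u v
  rw [mfderiv_id]
  rfl

lemma isAntipodalInvariant_of_isPullback_id {g g' : SmoothMetric I4 (S2 × S2)}
    (h : IsPullback id g g') (hg : IsAntipodalInvariant g') : IsAntipodalInvariant g := by
  have key (p : S2 × S2) (u v : TangentSpace I4 p) : g'.inner p u v = g.inner p u v := by
    have := h p u v
    rw [mfderiv_id] at this
    exact this
  intro ε₁ ε₂ p u v
  rw [← key, ← key]
  exact hg ε₁ ε₂ p u v

end Identity

end SecTheta

theorem mainTheorem1 :
    -- metrics on `S² × S²` with `sec^θ > 0`, invariant and arbitrarily `C^k`-close to the product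
    (∀ d : MetricSpace (TangentPlane I4 (S2 × S2)), InducesStandardTopology d →
      ∀ θ : ℝ, 0 < θ → ∀ (k : ℕ) (U : Set (SmoothMetric I4 (S2 × S2))),
        IsOpen[CkTopology I4 (S2 × S2) k] U → productMetric ∈ U →
          ∃ g ∈ U, IsAntipodalInvariant g ∧ SecThetaPos d θ g) ∧
    -- metrics on `S² × S²` of positive biorthogonal curvature
    (∃ g : SmoothMetric I4 (S2 × S2), IsAntipodalInvariant g ∧ ∀ σ, 0 < secPerp g σ) ∧
    -- the same on `ℝP² × ℝP²`, whose standard product metric is the one covered by `productMetric`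
    ∃ h₀ : SmoothMetric I4 (RP2 × RP2), IsPullback coveringMap h₀ productMetric ∧
      (∀ d : MetricSpace (TangentPlane I4 (RP2 × RP2)), InducesStandardTopology d →
        ∀ θ : ℝ, 0 < θ → ∀ (k : ℕ) (U : Set (SmoothMetric I4 (RP2 × RP2))),
          IsOpen[CkTopology I4 (RP2 × RP2) k] U → h₀ ∈ U →
            ∃ h ∈ U, SecThetaPos d θ h) ∧
      ∃ h : SmoothMetric I4 (RP2 × RP2), ∀ σ, 0 < secPerp h σ := by
  refine ⟨fun d hd θ hθ k U hU hgU ↦ ?_, ?_, ?_⟩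
  · have hp : IsPullback (id : S2 × S2 → S2 × S2) productMetric productMetric := isPullback_id _
    obtain ⟨c, δ, g, hg, hpull, hpos⟩ :=
      isChartCover_id.exists_secThetaPos_mem hp hd hθ k hU hgU
    exact ⟨g, hg, isAntipodalInvariant_of_isPullback_id hpull (isAntipodalInvariant_familyMetric c δ),
      hpos⟩
  · obtain ⟨c, δ, h⟩ := isChartCover_id.exists_secPerp_pos
    exact ⟨familyMetric c δ, isAntipodalInvariant_familyMetric c δ, h _ (isPullback_id _)⟩
  · refine ⟨isChartCover_coveringMap.descend contMDiff_prodEmb injective_mvfderiv_prodEmb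
      isAntipodalInvariant_productMetric, isChartCover_coveringMap.isPullback_descend _ _ _, ?_, ?_⟩
    · intro d hd θ hθ k U hU hgU
      obtain ⟨c, δ, h, hh, -, hpos⟩ := isChartCover_coveringMap.exists_secThetaPos_mem
        (isChartCover_coveringMap.isPullback_descend _ _ _) hd hθ k hU hgU
      exact ⟨h, hh, hpos⟩
    · obtain ⟨c, δ, h⟩ := isChartCover_coveringMap.exists_secPerp_pos
      exact ⟨isChartCover_coveringMap.descend (contMDiff_familyMap c δ)
        (injective_mvfderiv_familyMap c δ) (isAntipodalInvariant_familyMetric c δ),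
        h _ (isChartCover_coveringMap.isPullback_descend _ _ _)⟩
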